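/- **Setting.** Let $W$ be a $d$-dimensional Brownian motion on $[0,T]$, $T>0$, with respect to a filtration $(\mathcal F_t)$ of a probability space, and write $\mathbb E_t=\mathbb E[\,\cdot\mid\mathcal F_t]$. Let $b:\mathbb R^d\to\mathbb R^d$, $\sigma:\mathbb R^d\to\mathbb R^{d\times d}$, $f:\mathbb R\times\mathbb R^d\to\mathbb R$ be Lipschitz, let $g\in C^1(\mathbb R^d;\mathbb R)$ have bounded derivative, let $X_0\in\mathbb R^d$, and let $(X,Y,Z)$ solve $$X_t=X_0+\int_0^t b(X_s)\,ds+\int_0^t\sigma(X_s)\,dW_s,\qquad Y_t=g(X_T)+\int_t^T f(Y_s,Z_s)\,ds-\int_t^T Z_s\,dW_s,\qquad 0\le t\le T,$$ where $X,Y$ are continuous adapted with square integrable supremum and $Z$ is progressively measurable with $\mathbb E\int_0^T|Z_s|^2ds<\infty$ (any version of $Z$, e.g. $Z_t=\nabla u^\top(t,X_t)\sigma(X_t)$ when $Y_t=u(t,X_t)$ with $u$ smooth). For a partition $\pi=\{0=t_0<\dots<t_n=T\}$ put $h_i=t_{i+1}-t_i$ and $|\pi|=\max_{i<n} h_i$.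 Fix $\kappa$ and call $\pi$ *admissible* if $h_i\le\kappa h_{i+1}$ for $0\le i\le n-2$ (uniform grids are admissible for $\kappa=1$). **Scheme.** Fix $r\ge1$, real $a_j,\alpha_j$ ($1\le j\le r$) with $\sum_{j=1}^r a_j=\sum_{j=1}^r\alpha_j=1$, and bounded measurable $\psi^\ell,\phi^\ell:[0,1]\to\mathbb R$ ($1\le\ell\le d$) with integral $1$. For $1\le j\le r$ and $i\le n-r$ let $H^Y_{i,j}$ be the vector with components $\frac1{h}\int_{t_i}^{t_i+h}\psi^\ell\big(\frac{u-t_i}{h}\big)dW^\ell_u$, $h=t_{i+j}-t_i$, and let $H^f_{i,j}$ be defined in the same way with $\phi$. On each $\pi$ let $b_{i,j},\beta_{i,j}$ be real numbers (which may depend on $\pi$) with $|a_j|+|b_{i,j}|+|\alpha_j|+|\beta_{i,j}|\le\Lambda$ for $0\le j\le r$, $i\le n-r$ ($a_0=\alpha_0=\beta_{i,0}=0$). Given $\mathcal F_{t_k}$-measurable square integrable $(Y_k,Z_k)$ for $n-r<k\le n$, the approximation satisfies, for $i\le n-r$, $$Y_i=\mathbb E_{t_i}\Big[\sum_{j=1}^r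 a_jY_{i+j}+h_i\sum_{j=0}^r b_{i,j}f(Y_{i+j},Z_{i+j})\Big],\qquad Z_i=\mathbb E_{t_i}\Big[\sum_{j=1}^r\alpha_jH^Y_{i,j}Y_{i+j}+h_i\sum_{j=1}^r\beta_{i,j}H^f_{i,j}f(Y_{i+j},Z_{i+j})\Big].$$ **Truncation error.** Let $$\check Z_{t_i}=\mathbb E_{t_i}\Big[\sum_{j=1}^r\alpha_jH^Y_{i,j}Y_{t_{i+j}}+h_i\sum_{j=1}^r\beta_{i,j}H^f_{i,j}f(Y_{t_{i+j}},Z_{t_{i+j}})\Big],$$ $$\check Y_{t_i}=\mathbb E_{t_i}\Big[\sum_{j=1}^r a_jY_{t_{i+j}}+h_i\sum_{j=1}^r b_{i,j}f(Y_{t_{i+j}},Z_{t_{i+j}})+h_ib_{i,0}f(\check Y_{t_i},\check Z_{t_i})\Big],$$ $$\mathcal T(\pi)=\sum_{i=0}^{n-r}h_i\Big(\tfrac1{h_i^2}\mathbb E|Y_{t_i}-\check Y_{t_i}|^2+\mathbb E|Z_{t_i}-\check Z_{t_i}|^2\Big).$$ **Theorem 2.1.** Let $m\ge0$ be an integer and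 assume - (Hc) $a_j\ge0$, $\sum_{j=1}^r a_j=1$, and $a_j=0\Rightarrow\alpha_j=0$ for $1\le j\le r$; - the scheme has global truncation error of order $m$ for $(Y,Z)$: $\mathcal T(\pi)\le C_1|\pi|^{2m}$ for all admissible $\pi$ with $|\pi|\le\delta_1$, where $\delta_1>0$ (in particular $\check Y$ exists on these grids); - for all admissible $\pi$ with $|\pi|\le\delta_1$ the terminal values satisfy $\displaystyle\max_{0\le j\le r-1}\mathbb E\big[|Y_{t_{n-j}}-Y_{n-j}|^2+|\pi|\,|Z_{t_{n-j}}-Z_{n-j}|^2\big]\le C_2|\pi|^{2m}$. Then there are $C,\delta>0$ such that for all admissible $\pi$ with $|\pi|\le\delta$ $$\max_{0\le i\le n}\mathbb E|Y_{t_i}-Y_i|^2+\sum_{i=0}^{n-1}h_i\,\mathbb E|Z_{t_i}-Z_i|^2\le C|\pi|^{2m}.$$ The constants $C,\delta$ depend neither on $\pi$, nor on the $b_{i,j},\beta_{i,j}$ (except through $\Lambda$), nor on the approximations $(Y_i,Z_i)$; they may depend on the remaining fixed data and on $m,\Lambda,\kappa,\delta_1,C_1,C_2$. -/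

import Mathlib

open MeasureTheory ProbabilityTheory Filter Topology
open scoped ENNReal

namespace BSDEMultistep

noncomputable section

/-- `ℝ^d` with its Euclidean norm (row and column vectors are not distinguished). -/
abbrev Vec (d : ℕ) : Type := EuclideanSpace ℝ (Fin d)

/-! ### Brownian motion and the Itô integral

All processes are indexed by real times; only their values for times in `[0, T]` matter. -/

/-- `W` is a `d`-dimensional Brownian motion on `[0, T]` with respect to the filtration `ℱ`:
adapted, started at `0`, with almost surely continuous paths, and with increments `W t - W s`
that are independent of `ℱ s` and have the law `N(0, (t - s) I_d)`. -/
structure IsBrownianMotion {Ω : Type*} {mΩ : MeasurableSpace Ω} (μ : Measure Ω)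
    (ℱ : Filtration ℝ mΩ) (T : ℝ) {d : ℕ} (W : ℝ → Ω → Vec d) : Prop where
  adapted : ∀ t ∈ Set.Icc 0 T, StronglyMeasurable[ℱ t] (W t)
  zero : ∀ᵐ ω ∂μ, W 0 ω = 0
  continuous : ∀ᵐ ω ∂μ, ContinuousOn (fun t => W t ω) (Set.Icc 0 T)
  indep : ∀ s t, 0 ≤ s → s ≤ t → t ≤ T →
    Indep (MeasurableSpace.comap (fun ω => W t ω - W s ω) inferInstance) (ℱ s) μ
  law : ∀ s t, 0 ≤ s → s ≤ t → t ≤ T →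
    HasLaw (fun ω => W t ω - W s ω)
      (multivariateGaussian (0 : Vec d) ((t - s) • (1 : Matrix (Fin d) (Fin d) ℝ))) μ

/-- A simple integrand on `(s, t]`: the value on `(τ k, τ (k+1)]` is the bounded
`ℱ (τ k)`-measurable random vector `ξ k`, for a finite subdivision
`s = τ 0 ≤ ⋯ ≤ τ N = t`. -/
structure SimpleIntegrand {Ω : Type*} {mΩ : MeasurableSpace Ω} (ℱ : Filtration ℝ mΩ)
    (d : ℕ) (s t : ℝ) where
  N : ℕ
  τ : ℕ → ℝ
  mono : Monotone τ
  left : τ 0 = s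
  right : τ N = t
  ξ : ℕ → Ω → Vec d
  meas : ∀ k < N, StronglyMeasurable[ℱ (τ k)] (ξ k)
  bdd : ∃ K : ℝ, ∀ k < N, ∀ ω, ‖ξ k ω‖ ≤ K

/-- The simple integrand as a process. -/
def SimpleIntegrand.process {Ω : Type*} {mΩ : MeasurableSpace Ω} {ℱ : Filtration ℝ mΩ}
    {d : ℕ} {s t : ℝ} (φ : SimpleIntegrand ℱ d s t) (u : ℝ) (ω : Ω) : Vec d :=
  ∑ k ∈ Finset.range φ.N,
    (Set.Ioc (φ.τ k) (φ.τ (k + 1))).indicator (fun _ => φ.ξ k ω) u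

/-- The elementary stochastic integral `∑ ξ_k · (W_{τ_{k+1}} - W_{τ_k})`. -/
def SimpleIntegrand.integral {Ω : Type*} {mΩ : MeasurableSpace Ω} {ℱ : Filtration ℝ mΩ}
    {d : ℕ} {s t : ℝ} (φ : SimpleIntegrand ℱ d s t) (W : ℝ → Ω → Vec d) (ω : Ω) : ℝ :=
  ∑ k ∈ Finset.range φ.N, inner ℝ (φ.ξ k ω) (W (φ.τ (k + 1)) ω - W (φ.τ k) ω)

/-- `I` is (a version of) the Itô integral `∫_s^t H_u dW_u`: the `L²(Ω)`-limit of the elementary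
integrals of simple integrands that converge to `H` in `L²((s, t] × Ω)`. -/
def IsItoIntegral {Ω : Type*} {mΩ : MeasurableSpace Ω} (μ : Measure Ω) (ℱ : Filtration ℝ mΩ)
    {d : ℕ} (W : ℝ → Ω → Vec d) (H : ℝ → Ω → Vec d) (s t : ℝ) (I : Ω → ℝ) : Prop :=
  MemLp I 2 μ ∧ ∃ φ : ℕ → SimpleIntegrand ℱ d s t,
    Tendsto (fun p => ∫⁻ ω, ∫⁻ u in Set.Ioc s t, ‖(φ p).process u ω - H u ω‖ₑ ^ 2 ∂volume ∂μ)
      atTop (𝓝 0) ∧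
    Tendsto (fun p => ∫⁻ ω, ‖I ω - (φ p).integral W ω‖ₑ ^ 2 ∂μ) atTop (𝓝 0)

/-! ### The forward-backward equation -/

/-- The space `𝒮²`: continuous adapted processes on `[0, T]` with square integrable supremum. -/
structure IsS2 {Ω : Type*} {mΩ : MeasurableSpace Ω} (μ : Measure Ω) (ℱ : Filtration ℝ mΩ)
    (T : ℝ) {E : Type*} [NormedAddCommGroup E] (V : ℝ → Ω → E) : Prop where
  adapted : ∀ t ∈ Set.Icc 0 T, StronglyMeasurable[ℱ t] (V t)
  continuous : ∀ᵐ ω ∂μ, ContinuousOn (fun t => V t ω) (Set.Icc 0 T)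
  sup_sq : ∫⁻ ω, (⨆ t ∈ Set.Icc 0 T, ‖V t ω‖ₑ ^ 2) ∂μ < ∞

/-- The space `ℋ²`: processes on `[0, T]` that are progressively measurable and satisfy
`E ∫_0^T |V_s|² ds < ∞`. Extending by `0` outside `[0, T]` turns progressive measurability on
`[0, T]` into progressive measurability for all real times. -/
structure IsH2 {Ω : Type*} {mΩ : MeasurableSpace Ω} (μ : Measure Ω) (ℱ : Filtration ℝ mΩ)
    (T : ℝ) {E : Type*} [NormedAddCommGroup E] (V : ℝ → Ω → E) : Prop where
  progressive : IsStronglyProgressive ℱ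
    (fun t ω => (Set.Icc 0 T).indicator (fun s => V s ω) t)
  sq : ∫⁻ ω, ∫⁻ s in Set.Icc 0 T, ‖V s ω‖ₑ ^ 2 ∂volume ∂μ < ∞

/-- The data of the forward-backward equation: `b`, `σ`, `f` are Lipschitz continuous and `g` is
continuously differentiable with bounded derivative. -/
structure Coefficients (d : ℕ) where
  b : Vec d → Vec d
  σ : Vec d → Matrix (Fin d) (Fin d) ℝ
  f : ℝ → Vec d → ℝ
  g : Vec d → ℝ
  b_lip : ∃ K, LipschitzWith K b
  σ_lip : ∀ k l, ∃ K, LipschitzWith K (fun x => σ x k l)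
  f_lip : ∃ K, LipschitzWith K (fun p : ℝ × Vec d => f p.1 p.2)
  g_diff : ContDiff ℝ 1 g
  g_bdd : ∃ K : ℝ, ∀ x, ‖fderiv ℝ g x‖ ≤ K

/-- `(X, Y, Z)` solves, on `[0, T]`,
`X_t = X₀ + ∫_0^t b(X_s) ds + ∫_0^t σ(X_s) dW_s` and
`Y_t = g(X_T) + ∫_t^T f(Y_s, Z_s) ds - ∫_t^T Z_s dW_s`,
with `X, Y ∈ 𝒮²` and `Z ∈ ℋ²`. -/
structure IsSolution {Ω : Type*} {mΩ : MeasurableSpace Ω} (μ : Measure Ω) (ℱ : Filtration ℝ mΩ)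
    (T : ℝ) {d : ℕ} (W : ℝ → Ω → Vec d) (c : Coefficients d) (X₀ : Vec d)
    (X : ℝ → Ω → Vec d) (Y : ℝ → Ω → ℝ) (Z : ℝ → Ω → Vec d) : Prop where
  X_mem : IsS2 μ ℱ T X
  Y_mem : IsS2 μ ℱ T Y
  Z_mem : IsH2 μ ℱ T Z
  forward : ∀ t ∈ Set.Icc 0 T, ∀ k : Fin d, ∃ I : Ω → ℝ,
    IsItoIntegral μ ℱ W (fun s ω => WithLp.toLp 2 (fun l => c.σ (X s ω) k l)) 0 t I ∧
    ∀ᵐ ω ∂μ, X t ω k = X₀ k + (∫ s in 0..t, c.b (X s ω) k) + I ω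
  backward : ∀ t ∈ Set.Icc 0 T, ∃ I : Ω → ℝ,
    IsItoIntegral μ ℱ W Z t T I ∧
    ∀ᵐ ω ∂μ, Y t ω = c.g (X T ω) + (∫ s in t..T, c.f (Y s ω) (Z s ω)) - I ω

/-! ### Partitions -/

/-- A partition `0 = t 0 < t 1 < ⋯ < t n = T` of `[0, T]` (values `t k` with `k > n` are
irrelevant). -/
structure Grid (T : ℝ) where
  n : ℕ
  t : ℕ → ℝ
  left : t 0 = 0
  right : t n = T
  lt : ∀ i < n, t i < t (i + 1)

/-- The step `h_i = t_{i+1} - t_i`. -/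
def Grid.h {T : ℝ} (π : Grid T) (i : ℕ) : ℝ := π.t (i + 1) - π.t i

/-- The mesh size `|π| = max_{i < n} h_i`. -/
def Grid.mesh {T : ℝ} (π : Grid T) : ℝ := ⨆ i : Fin π.n, π.h i

/-- Backward step ratios bounded by `κ`: `h_i ≤ κ h_{i+1}`. Uniform grids satisfy this with
`κ = 1`, and grids with `|π| ≤ κ min h_i` satisfy it as well. -/
def Grid.StepRatioLE {T : ℝ} (π : Grid T) (κ : ℝ) : Prop :=
  ∀ i, i + 1 < π.n → π.h i ≤ κ * π.h (i + 1)

/-! ### The random weights -/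

/-- The class `ℬ^m_{[0,1]}` of bounded measurable `ψ : [0, 1] → ℝ` with `∫ ψ = 1` and
`∫ ψ(u) u^k du = 0` for `1 ≤ k ≤ m`. -/
structure IsMomentFunction (m : ℕ) (ψ : ℝ → ℝ) : Prop where
  meas : Measurable ((Set.Icc (0 : ℝ) 1).domRestrict ψ)
  bdd : ∃ K : ℝ, ∀ u ∈ Set.Icc (0 : ℝ) 1, |ψ u| ≤ K
  int_one : ∫ u in (0 : ℝ)..1, ψ u = 1
  int_pow : ∀ k, 1 ≤ k → k ≤ m → ∫ u in (0 : ℝ)..1, ψ u * u ^ k = 0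

/-- `H` is (a version of) the random vector
`H^ψ_{t,h} = ( (1/h) ∫_t^{t+h} ψ^ℓ((u - t)/h) dW^ℓ_u )_ℓ`. -/
def IsWeight {Ω : Type*} {mΩ : MeasurableSpace Ω} (μ : Measure Ω) (ℱ : Filtration ℝ mΩ)
    {d : ℕ} (W : ℝ → Ω → Vec d) (ψ : Fin d → ℝ → ℝ) (t h : ℝ) (H : Ω → Vec d) : Prop :=
  ∀ l : Fin d, ∃ I : Ω → ℝ,
    IsItoIntegral μ ℱ W
      (fun u _ => EuclideanSpace.single l (ψ l ((u - t) / h))) t (t + h) I ∧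
    ∀ᵐ ω ∂μ, H ω l = (1 / h) * I ω

/-- The weights of the scheme on the grid `π`: `H i j` is `H^ψ` on the interval
`[t_i, t_{i+j}]`. -/
def IsWeightFamily {Ω : Type*} {mΩ : MeasurableSpace Ω} (μ : Measure Ω) (ℱ : Filtration ℝ mΩ)
    {T : ℝ} {d : ℕ} (W : ℝ → Ω → Vec d) (r : ℕ) (ψ : Fin d → ℝ → ℝ) (π : Grid T)
    (H : ℕ → ℕ → Ω → Vec d) : Prop :=
  ∀ i j, i + r ≤ π.n → 1 ≤ j → j ≤ r →
    IsWeight μ ℱ W ψ (π.t i) (π.t (i + j) - π.t i) (H i j)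

/-! ### Linear multi-step schemes -/

/-- The pre-consistency condition `∑ a_j = ∑ α_j = 1` (sums over `1 ≤ j ≤ r`). -/
structure PreConsistent (r : ℕ) (a α : ℕ → ℝ) : Prop where
  sum_a : ∑ j ∈ Finset.Icc 1 r, a j = 1
  sum_α : ∑ j ∈ Finset.Icc 1 r, α j = 1

/-- The `a_j` are nonnegative with sum `1`, and `a_j = 0` implies `α_j = 0` (`1 ≤ j ≤ r`). -/
structure Hc (r : ℕ) (a α : ℕ → ℝ) : Prop where
  nonneg : ∀ j, 1 ≤ j → j ≤ r → 0 ≤ a j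
  sum_a : ∑ j ∈ Finset.Icc 1 r, a j = 1
  support : ∀ j, 1 ≤ j → j ≤ r → a j = 0 → α j = 0

/-- The coefficients `b_{i,j}` (`0 ≤ j ≤ r`) and `β_{i,j}` (`1 ≤ j ≤ r`), `i ≤ n - r`, of a
multi-step scheme. They may depend on the grid, but together with the fixed `a_j` and `α_j`
they are bounded by `Λ`; the missing coefficients `a_0, α_0, β_{i,0}` count as zero. -/
structure StepCoefficients (T : ℝ) (r : ℕ) (Λ : ℝ) (a α : ℕ → ℝ) where
  b : Grid T → ℕ → ℕ → ℝ
  β : Grid T → ℕ → ℕ → ℝ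
  bound : ∀ (π : Grid T) (i j : ℕ), i + r ≤ π.n → 1 ≤ j → j ≤ r →
    |a j| + |b π i j| + |α j| + |β π i j| ≤ Λ
  bound_zero : ∀ (π : Grid T) (i : ℕ), i + r ≤ π.n → |b π i 0| ≤ Λ

/-- The map
`E_{t_i}[ ∑_{j=1}^r a_j y_{i+j} + h_i ∑_{j=1}^r b_{i,j} f(y_{i+j}, z_{i+j}) + h_i b_{i,0} f(y₀, z₀) ]`.
-/
def stepY {Ω : Type*} {mΩ : MeasurableSpace Ω} (μ : Measure Ω) (ℱ : Filtration ℝ mΩ)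
    {T : ℝ} {d : ℕ} (f : ℝ → Vec d → ℝ) (r : ℕ) (a : ℕ → ℝ) (b : ℕ → ℕ → ℝ) (π : Grid T)
    (y : ℕ → Ω → ℝ) (z : ℕ → Ω → Vec d) (i : ℕ) (y₀ : Ω → ℝ) (z₀ : Ω → Vec d) : Ω → ℝ :=
  μ[fun ω => ∑ j ∈ Finset.Icc 1 r, a j * y (i + j) ω
      + π.h i * ∑ j ∈ Finset.Icc 1 r, b i j * f (y (i + j) ω) (z (i + j) ω)
      + π.h i * b i 0 * f (y₀ ω) (z₀ ω) | ℱ (π.t i)]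

/-- The map
`E_{t_i}[ ∑_{j=1}^r α_j H^Y_{i,j} y_{i+j} + h_i ∑_{j=1}^r β_{i,j} H^f_{i,j} f(y_{i+j}, z_{i+j}) ]`.
-/
def stepZ {Ω : Type*} {mΩ : MeasurableSpace Ω} (μ : Measure Ω) (ℱ : Filtration ℝ mΩ)
    {T : ℝ} {d : ℕ} (f : ℝ → Vec d → ℝ) (r : ℕ) (α : ℕ → ℝ) (β : ℕ → ℕ → ℝ)
    (HY Hf : ℕ → ℕ → Ω → Vec d) (π : Grid T)
    (y : ℕ → Ω → ℝ) (z : ℕ → Ω → Vec d) (i : ℕ) : Ω → Vec d :=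
  μ[fun ω => ∑ j ∈ Finset.Icc 1 r, (α j * y (i + j) ω) • HY i j ω
      + π.h i • ∑ j ∈ Finset.Icc 1 r, (β i j * f (y (i + j) ω) (z (i + j) ω)) • Hf i j ω
    | ℱ (π.t i)]

/-- `(Yh_i, Zh_i)_{0 ≤ i ≤ n}` is an approximation produced by the multi-step scheme on `π`:
the `r` terminal values, of indices `n - r < k ≤ n`, are square integrable and
`ℱ_{t_k}`-measurable, and the others are given by the scheme. -/
structure IsApproximation {Ω : Type*} {mΩ : MeasurableSpace Ω} (μ : Measure Ω)
    (ℱ : Filtration ℝ mΩ) {T : ℝ} {d : ℕ} (f : ℝ → Vec d → ℝ) (r : ℕ) (a α : ℕ → ℝ)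
    (b β : ℕ → ℕ → ℝ) (HY Hf : ℕ → ℕ → Ω → Vec d) (π : Grid T)
    (Yh : ℕ → Ω → ℝ) (Zh : ℕ → Ω → Vec d) : Prop where
  terminal_meas : ∀ k, k ≤ π.n → π.n < k + r →
    StronglyMeasurable[ℱ (π.t k)] (Yh k) ∧ StronglyMeasurable[ℱ (π.t k)] (Zh k)
  terminal_sq : ∀ k, k ≤ π.n → π.n < k + r → MemLp (Yh k) 2 μ ∧ MemLp (Zh k) 2 μ
  eqY : ∀ i, i + r ≤ π.n → Yh i =ᵐ[μ] stepY μ ℱ f r a b π Yh Zh i (Yh i) (Zh i)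
  eqZ : ∀ i, i + r ≤ π.n → Zh i =ᵐ[μ] stepZ μ ℱ f r α β HY Hf π Yh Zh i

/-! ### Errors (with values in `[0, ∞]`) -/

/-- The mean square distance `E[|U - V|²]`. -/
def msd {Ω : Type*} {mΩ : MeasurableSpace Ω} (μ : Measure Ω) {E : Type*}
    [NormedAddCommGroup E] (U V : Ω → E) : ℝ≥0∞ :=
  ∫⁻ ω, ‖U ω - V ω‖ₑ ^ 2 ∂μ

/-- `ℰ_Y(π) = max_{0 ≤ i ≤ n} E[|Y_{t_i} - Y_i|²]`. -/
def errorY {Ω : Type*} {mΩ : MeasurableSpace Ω} (μ : Measure Ω) {T : ℝ} (π : Grid T)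
    (Y : ℝ → Ω → ℝ) (Yh : ℕ → Ω → ℝ) : ℝ≥0∞ :=
  (Finset.range (π.n + 1)).sup fun i => msd μ (Y (π.t i)) (Yh i)

/-- `ℰ_Z(π) = ∑_{0 ≤ i < n} h_i E[|Z_{t_i} - Z_i|²]`. -/
def errorZ {Ω : Type*} {mΩ : MeasurableSpace Ω} (μ : Measure Ω) {T : ℝ} {d : ℕ} (π : Grid T)
    (Z : ℝ → Ω → Vec d) (Zh : ℕ → Ω → Vec d) : ℝ≥0∞ :=
  ∑ i ∈ Finset.range π.n, ENNReal.ofReal (π.h i) * msd μ (Z (π.t i)) (Zh i)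

/-- The global truncation error
`∑_{i=0}^{n-r} h_i ( h_i⁻² E[|Y_{t_i} - Yc_i|²] + E[|Z_{t_i} - Zc_i|²] )`.
The index set `range (n + 1 - r)` is `{i | i + r ≤ n}`. -/
def globalTruncation {Ω : Type*} {mΩ : MeasurableSpace Ω} (μ : Measure Ω) {T : ℝ} {d : ℕ}
    (r : ℕ) (π : Grid T) (Y : ℝ → Ω → ℝ) (Z : ℝ → Ω → Vec d)
    (Yc : ℕ → Ω → ℝ) (Zc : ℕ → Ω → Vec d) : ℝ≥0∞ :=
  ∑ i ∈ Finset.range (π.n + 1 - r), ENNReal.ofReal (π.h i) *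
    (ENNReal.ofReal (1 / π.h i ^ 2) * msd μ (Y (π.t i)) (Yc i) + msd μ (Z (π.t i)) (Zc i))

/-- The global truncation error of the scheme for the solution `(Y, Z)` is at most
`C₁ |π|^{2m}` on all grids with mesh at most `δ₁` and step ratios bounded by `κ`. Here `Zc i` is
one explicit step of the scheme started from the exact solution and `Yc i` solves the
corresponding (possibly implicit) equation. -/
def HasTruncationOrder {Ω : Type*} {mΩ : MeasurableSpace Ω} (μ : Measure Ω)
    (ℱ : Filtration ℝ mΩ) {T : ℝ} {d : ℕ} (f : ℝ → Vec d → ℝ) (Y : ℝ → Ω → ℝ)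
    (Z : ℝ → Ω → Vec d) {r : ℕ} {Λ : ℝ} {a α : ℕ → ℝ} (S : StepCoefficients T r Λ a α)
    (HY Hf : Grid T → ℕ → ℕ → Ω → Vec d) (m : ℕ) (κ δ₁ C₁ : ℝ) : Prop :=
  ∀ π : Grid T, π.StepRatioLE κ → π.mesh ≤ δ₁ →
    ∃ (Yc : ℕ → Ω → ℝ) (Zc : ℕ → Ω → Vec d),
      (∀ i, i + r ≤ π.n → Zc i = stepZ μ ℱ f r α (S.β π) (HY π) (Hf π) π
        (fun k => Y (π.t k)) (fun k => Z (π.t k)) i) ∧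
      (∀ i, i + r ≤ π.n → Yc i =ᵐ[μ] stepY μ ℱ f r a (S.b π) π
        (fun k => Y (π.t k)) (fun k => Z (π.t k)) i (Yc i) (Zc i)) ∧
      globalTruncation μ r π Y Z Yc Zc ≤ ENNReal.ofReal (C₁ * π.mesh ^ (2 * m))

/-- The `r` terminal values on `π` have accuracy
`max_{0 ≤ j ≤ r-1} E[|Y_{t_{n-j}} - Y_{n-j}|² + |π| |Z_{t_{n-j}} - Z_{n-j}|²] ≤ C₂ |π|^{2m}`. -/
def TerminalAccuracy {Ω : Type*} {mΩ : MeasurableSpace Ω} (μ : Measure Ω) {T : ℝ} {d : ℕ}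
    (r : ℕ) (π : Grid T) (Y : ℝ → Ω → ℝ) (Z : ℝ → Ω → Vec d)
    (Yh : ℕ → Ω → ℝ) (Zh : ℕ → Ω → Vec d) (m : ℕ) (C₂ : ℝ) : Prop :=
  ∀ k, k ≤ π.n → π.n < k + r →
    msd μ (Y (π.t k)) (Yh k) + ENNReal.ofReal π.mesh * msd μ (Z (π.t k)) (Zh k)
      ≤ ENNReal.ofReal (C₂ * π.mesh ^ (2 * m))

end

end BSDEMultistep

namespace BSDEMultistep

/-! ### Itô integrals of bounded integrands: conditional mean and second moment. -/

section Ito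

variable {Ω : Type*} {mΩ : MeasurableSpace Ω} {μ : Measure Ω} {ℱ : Filtration ℝ mΩ} {T : ℝ}
  {d : ℕ} {W : ℝ → Ω → Vec d}

/-! The scheme is stable in mean square, so a truncation error of order m produces a global error of
the same order. The obstacle is the Z-step: its weights have conditional second moment of order
1/h_i, and a direct Lipschitz estimate would lose that factor at every step.

Two observations repair this. Write E_i for conditional expectation at t_i and U_k for the error of
Y at t_k. A weight H is conditionally centred, so E_i[H U] only sees U - E_i U, and E|E_i[H U]|² ≤
(C/h_i)(E U² - E|E_i U|²); this is `IsCenteredWeight.integral_condExp_mul_sq_le_sub`. On the other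
side, the a_j are convex weights, so Jensen's inequality bounds the main part of the Y-step by ∑ a_j
E|E_i U_{i+j}|² = ∑ a_j E|U_{i+j}|² - v_i, where v_i is the a-weighted sum of the expected
conditional variances. The Y-recursion thus gains the very variances that the Z-recursion pays for.
Since a_j = 0 forces α_j = 0, there is a constant with α_j² ≤ Ka a_j, and the cost of the Z-step is
a multiple of v_i.

With e, w the mean square errors of Y, Z and p, q the truncation errors, `Y_step_bound` and
`Z_step_bound` give, up to constants and further small terms, e_i + v_i ≤ ∑ a_j e_{i+j} + ε h_i
(e-terms) + (h_i/ε)(w-terms) + p_i/h_i + h_i q_i and h_i w_i ≤ K v_i + h_i² (e- and w-terms) + h_i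
q_i. The rest is deterministic (`exists_recursion_bound`): both relations are summed backward in
time, the sum over a_j telescopes (`add_sum_le_of_multistep`), the bounded step ratios control the
index shifts (`sum_step_mul_shift_le`), a large ε lets ∑ h w be absorbed by ∑ v, and a discrete
Gronwall argument (`add_le_exp_of_backward`) finishes.

Before these estimates apply, everything must be known to be square integrable. For the
approximation this comes from backward induction with a contraction argument in the implicit step;
for Z at the grid points it is extracted from the finiteness of the truncation and terminal errors.
-/

lemma enorm_sq_le_two_mul {E : Type*} [NormedAddCommGroup E] (x y : E) :
    ‖x‖ₑ ^ 2 ≤ 2 * ‖x - y‖ₑ ^ 2 + 2 * ‖y‖ₑ ^ 2 := by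
  simp only [← ofReal_norm]
  rw [← ENNReal.ofReal_pow (norm_nonneg _), ← ENNReal.ofReal_pow (norm_nonneg _),
    ← ENNReal.ofReal_pow (norm_nonneg _), show (2 : ℝ≥0∞) = ENNReal.ofReal 2 by simp,
    ← ENNReal.ofReal_mul (by norm_num), ← ENNReal.ofReal_mul (by norm_num),
    ← ENNReal.ofReal_add (by positivity) (by positivity)]
  apply ENNReal.ofReal_le_ofReal
  have h : ‖x‖ ≤ ‖x - y‖ + ‖y‖ := by simpa using norm_add_le (x - y) y
  nlinarith [norm_nonneg x, sq_nonneg (‖x - y‖ - ‖y‖)]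

lemma enorm_sq_eq_ofReal_sq (x : ℝ) : ‖x‖ₑ ^ 2 = ENNReal.ofReal (x ^ 2) := by
  rw [← ofReal_norm, ← ENNReal.ofReal_pow (norm_nonneg _), Real.norm_eq_abs, sq_abs]

namespace IsBrownianMotion

lemma stronglyMeasurable_increment (hW : IsBrownianMotion μ ℱ T W) {s t : ℝ} (hs : 0 ≤ s)
    (hst : s ≤ t) (ht : t ≤ T) : StronglyMeasurable[ℱ t] (fun ω => W t ω - W s ω) :=
  (hW.adapted t ⟨hs.trans hst, ht⟩).sub ((hW.adapted s ⟨hs, hst.trans ht⟩).mono (ℱ.mono hst))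

lemma memLp_increment (hW : IsBrownianMotion μ ℱ T W) {s t : ℝ} (hs : 0 ≤ s)
    (hst : s ≤ t) (ht : t ≤ T) (l : Fin d) : MemLp (fun ω => (W t ω - W s ω) l) 2 μ := by
  have h1 : MemLp id 2 (multivariateGaussian (0 : Vec d)
      ((t - s) • (1 : Matrix (Fin d) (Fin d) ℝ))) := IsGaussian.memLp_id _ 2 (by simp)
  have hlaw := hW.law s t hs hst ht
  rw [← hlaw.map_eq] at h1
  have h2 := h1.comp_of_map hlaw.aemeasurable
  exact memLp_piLp_iff.1 h2 l

lemma integral_increment [IsProbabilityMeasure μ] (hW : IsBrownianMotion μ ℱ T W) {s t : ℝ}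
    (hs : 0 ≤ s) (hst : s ≤ t) (ht : t ≤ T) (l : Fin d) :
    ∫ ω, (W t ω - W s ω) l ∂μ = 0 := by
  have hlaw := hW.law s t hs hst ht
  have hint : ∀ l, Integrable (fun ω => (W t ω - W s ω) l) μ := fun l =>
    (hW.memLp_increment hs hst ht l).integrable (by norm_num)
  have h0 : ∫ ω, (W t ω - W s ω) ∂μ = 0 := by
    have := hlaw.integral_comp (f := id) aestronglyMeasurable_id
    simpa [Function.comp_def] using this
  rw [← eval_integral_piLp hint l, h0]
  rfl

lemma integral_increment_mul [IsProbabilityMeasure μ] (hW : IsBrownianMotion μ ℱ T W) {s t : ℝ}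
    (hs : 0 ≤ s) (hst : s ≤ t) (ht : t ≤ T) (l k : Fin d) :
    ∫ ω, (W t ω - W s ω) l * (W t ω - W s ω) k ∂μ = if l = k then t - s else 0 := by
  have hlaw := hW.law s t hs hst ht
  have hpos : ((t - s) • (1 : Matrix (Fin d) (Fin d) ℝ)).PosSemidef :=
    Matrix.PosSemidef.one.smul (sub_nonneg.2 hst)
  have hc := hlaw.covariance_comp (f := fun x : Vec d => x l) (g := fun x : Vec d => x k)
    (by fun_prop) (by fun_prop)
  rw [covariance_eval_multivariateGaussian hpos, covariance] at hc
  simp only [Function.comp_apply, hW.integral_increment hs hst ht, sub_zero] at hc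
  rw [hc]
  simp [Matrix.one_apply]

/-- Functionals of an increment are uncorrelated with the past. -/
lemma integral_mul_comp_increment [IsProbabilityMeasure μ] (hW : IsBrownianMotion μ ℱ T W)
    {s t : ℝ} (hs : 0 ≤ s) (hst : s ≤ t) (ht : t ≤ T) {g : Ω → ℝ}
    (hg : StronglyMeasurable[ℱ s] g) (hgi : Integrable g μ) {F : Vec d → ℝ} (hF : Measurable F)
    (hFi : Integrable (fun ω => F (W t ω - W s ω)) μ) :
    Integrable (fun ω => g ω * F (W t ω - W s ω)) μ ∧
    ∫ ω, g ω * F (W t ω - W s ω) ∂μ = (∫ ω, g ω ∂μ) * ∫ ω, F (W t ω - W s ω) ∂μ := by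
  have hind : IndepFun g (fun ω => F (W t ω - W s ω)) μ := by
    have h1 : IndepFun (fun ω => W t ω - W s ω) g μ := by
      rw [IndepFun_iff_Indep]
      exact indep_of_indep_of_le_right (hW.indep s t hs hst ht) hg.measurable.comap_le
    exact (h1.comp hF measurable_id).symm
  exact ⟨hind.integrable_mul hgi hFi,
    hind.integral_mul_eq_mul_integral hgi.aestronglyMeasurable hFi.aestronglyMeasurable⟩

lemma inner_eq_sum (x y : Vec d) : inner ℝ x y = ∑ l, x l * y l := by
  simp [PiLp.inner_apply, mul_comm]

/-- Coordinatewise, `g * ξ l` belongs to the past and the increment is independent of it with mean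
zero. With `g` an indicator this centres the elementary integrals; with `g` a partial sum it removes
the cross terms in their second moment. -/
lemma integral_mul_inner_increment [IsProbabilityMeasure μ] (hW : IsBrownianMotion μ ℱ T W)
    {s t : ℝ} (hs : 0 ≤ s) (hst : s ≤ t) (ht : t ≤ T) {g : Ω → ℝ}
    (hg : StronglyMeasurable[ℱ s] g) (hgi : Integrable g μ) {ξ : Ω → Vec d}
    (hξ : StronglyMeasurable[ℱ s] ξ) {K : ℝ} (hK : ∀ ω, ‖ξ ω‖ ≤ K) :
    Integrable (fun ω => g ω * inner ℝ (ξ ω) (W t ω - W s ω)) μ ∧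
    ∫ ω, g ω * inner ℝ (ξ ω) (W t ω - W s ω) ∂μ = 0 := by
  have hξl : ∀ l, StronglyMeasurable[ℱ s] (fun ω => ξ ω l) := fun l =>
    (PiLp.continuous_apply 2 _ l).comp_stronglyMeasurable hξ
  have key : ∀ l : Fin d, Integrable (fun ω => (g ω * ξ ω l) * (W t ω - W s ω) l) μ ∧
      ∫ ω, (g ω * ξ ω l) * (W t ω - W s ω) l ∂μ = 0 := by
    intro l
    have h := hW.integral_mul_comp_increment hs hst ht (g := fun ω => g ω * ξ ω l)
      (hg.mul (hξl l))
      (hgi.mul_bdd (c := K) ((hξl l).mono (ℱ.le s)).aestronglyMeasurable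
        (ae_of_all _ fun ω => (PiLp.norm_apply_le _ _).trans (hK ω)))
      (F := fun x => x l) (by fun_prop)
      ((hW.memLp_increment hs hst ht l).integrable (by norm_num))
    rw [hW.integral_increment hs hst ht l, mul_zero] at h
    exact h
  have hrw : (fun ω => g ω * inner ℝ (ξ ω) (W t ω - W s ω))
      = fun ω => ∑ l, (g ω * ξ ω l) * (W t ω - W s ω) l := by
    ext ω
    rw [inner_eq_sum, Finset.mul_sum]
    exact Finset.sum_congr rfl fun l _ => by ring
  rw [hrw]
  refine ⟨integrable_finsetSum _ fun l _ => (key l).1, ?_⟩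
  rw [integral_finsetSum _ fun l _ => (key l).1]
  exact Finset.sum_eq_zero fun l _ => (key l).2

lemma memLp_inner_increment (hW : IsBrownianMotion μ ℱ T W)
    {s t : ℝ} (hs : 0 ≤ s) (hst : s ≤ t) (ht : t ≤ T) {ξ : Ω → Vec d}
    (hξ : StronglyMeasurable[ℱ s] ξ) {K : ℝ} (hK : ∀ ω, ‖ξ ω‖ ≤ K) :
    MemLp (fun ω => inner ℝ (ξ ω) (W t ω - W s ω)) 2 μ := by
  have hΔ : MemLp (fun ω => W t ω - W s ω) 2 μ :=
    memLp_piLp_iff.2 fun l => hW.memLp_increment hs hst ht l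
  refine MemLp.of_le_mul (c := K) hΔ ?_ (ae_of_all _ fun ω => ?_)
  · exact (((hξ.mono (ℱ.le s))).inner
      ((hW.stronglyMeasurable_increment hs hst ht).mono (ℱ.le t))).aestronglyMeasurable
  · exact (norm_inner_le_norm _ _).trans
      (mul_le_mul_of_nonneg_right (hK ω) (norm_nonneg _))

/-- Itô isometry on one step, localised to a past event. -/
lemma setIntegral_inner_increment_sq [IsProbabilityMeasure μ] (hW : IsBrownianMotion μ ℱ T W)
    {s t : ℝ} (hs : 0 ≤ s) (hst : s ≤ t) (ht : t ≤ T) {A : Set Ω} (hA : MeasurableSet[ℱ s] A)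
    {ξ : Ω → Vec d} (hξ : StronglyMeasurable[ℱ s] ξ) {K : ℝ} (hK : ∀ ω, ‖ξ ω‖ ≤ K) :
    ∫ ω in A, (inner ℝ (ξ ω) (W t ω - W s ω)) ^ 2 ∂μ = (t - s) * ∫ ω in A, ‖ξ ω‖ ^ 2 ∂μ := by
  have hξl : ∀ l, StronglyMeasurable[ℱ s] (fun ω => ξ ω l) := fun l =>
    (PiLp.continuous_apply 2 _ l).comp_stronglyMeasurable hξ
  have hbd : ∀ l k ω, ‖A.indicator (fun ω => ξ ω l * ξ ω k) ω‖ ≤ K * K := by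
    intro l k ω
    refine (norm_indicator_le_norm_self _ ω).trans ?_
    rw [norm_mul]
    exact mul_le_mul ((PiLp.norm_apply_le _ _).trans (hK ω)) ((PiLp.norm_apply_le _ _).trans (hK ω))
      (norm_nonneg _) ((norm_nonneg _).trans (hK ω))
  have hms : ∀ l k, StronglyMeasurable[ℱ s] (A.indicator (fun ω => ξ ω l * ξ ω k)) := fun l k =>
    ((hξl l).mul (hξl k)).indicator hA
  have hint : ∀ l k, Integrable (A.indicator (fun ω => ξ ω l * ξ ω k)) μ := fun l k =>
    Integrable.of_bound ((hms l k).mono (ℱ.le s)).aestronglyMeasurable (K * K)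
      (ae_of_all _ (hbd l k))
  have key : ∀ l k : Fin d, Integrable (fun ω => A.indicator (fun ω => ξ ω l * ξ ω k) ω *
        ((W t ω - W s ω) l * (W t ω - W s ω) k)) μ ∧
      ∫ ω, A.indicator (fun ω => ξ ω l * ξ ω k) ω * ((W t ω - W s ω) l * (W t ω - W s ω) k) ∂μ
        = if l = k then (t - s) * ∫ ω, A.indicator (fun ω => ξ ω l * ξ ω k) ω ∂μ else 0 := by
    intro l k
    have h := hW.integral_mul_comp_increment hs hst ht (hms l k) (hint l k)
      (F := fun x => x l * x k) (by fun_prop)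
      ((hW.memLp_increment hs hst ht l).integrable_mul (hW.memLp_increment hs hst ht k))
    rw [hW.integral_increment_mul hs hst ht l k] at h
    refine ⟨h.1, h.2.trans ?_⟩
    split_ifs <;> ring
  have hA' := ℱ.le s A hA
  rw [← integral_indicator hA', ← integral_indicator hA']
  have hL : A.indicator (fun ω => (inner ℝ (ξ ω) (W t ω - W s ω)) ^ 2)
      = fun ω => ∑ l, ∑ k, A.indicator (fun ω => ξ ω l * ξ ω k) ω *
        ((W t ω - W s ω) l * (W t ω - W s ω) k) := by
    ext ω
    by_cases hω : ω ∈ A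
    · simp only [Set.indicator_of_mem hω]
      rw [inner_eq_sum, sq, Finset.sum_mul_sum]
      exact Finset.sum_congr rfl fun l _ => Finset.sum_congr rfl fun k _ => by ring
    · simp [Set.indicator_of_notMem hω]
  have hR : A.indicator (fun ω => ‖ξ ω‖ ^ 2)
      = fun ω => ∑ l, A.indicator (fun ω => ξ ω l * ξ ω l) ω := by
    ext ω
    by_cases hω : ω ∈ A
    · simp only [Set.indicator_of_mem hω]
      rw [← real_inner_self_eq_norm_sq, inner_eq_sum]
    · simp [Set.indicator_of_notMem hω]
  rw [hL, hR, integral_finsetSum _ fun l _ => integrable_finsetSum _ fun k _ => (key l k).1,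
    integral_finsetSum _ fun l _ => hint l l, Finset.mul_sum]
  refine Finset.sum_congr rfl fun l _ => ?_
  rw [integral_finsetSum _ fun k _ => (key l k).1]
  rw [Finset.sum_congr rfl fun k _ => (key l k).2, Finset.sum_ite_eq]
  simp

end IsBrownianMotion

namespace SimpleIntegrand

variable {s t : ℝ}

lemma partition_mem (φ : SimpleIntegrand ℱ d s t) {k : ℕ} (hk : k ≤ φ.N) :
    s ≤ φ.τ k ∧ φ.τ k ≤ t :=
  ⟨φ.left.symm.le.trans (φ.mono (Nat.zero_le k)), (φ.mono hk).trans φ.right.le⟩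

/-- The first `n` terms of the elementary integral form a square integrable martingale with the
expected bracket. -/
lemma partial_integral [IsProbabilityMeasure μ] (hW : IsBrownianMotion μ ℱ T W) (hs : 0 ≤ s)
    (ht : t ≤ T) (φ : SimpleIntegrand ℱ d s t) {A : Set Ω} (hA : MeasurableSet[ℱ s] A) (n : ℕ)
    (hn : n ≤ φ.N) :
    StronglyMeasurable[ℱ (φ.τ n)]
      (fun ω => ∑ k ∈ Finset.range n, inner ℝ (φ.ξ k ω) (W (φ.τ (k + 1)) ω - W (φ.τ k) ω)) ∧
    MemLp (fun ω => ∑ k ∈ Finset.range n,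
      inner ℝ (φ.ξ k ω) (W (φ.τ (k + 1)) ω - W (φ.τ k) ω)) 2 μ ∧
    ∫ ω in A, (∑ k ∈ Finset.range n,
      inner ℝ (φ.ξ k ω) (W (φ.τ (k + 1)) ω - W (φ.τ k) ω)) ∂μ = 0 ∧
    ∫ ω in A, (∑ k ∈ Finset.range n,
      inner ℝ (φ.ξ k ω) (W (φ.τ (k + 1)) ω - W (φ.τ k) ω)) ^ 2 ∂μ
      = ∑ k ∈ Finset.range n, (φ.τ (k + 1) - φ.τ k) * ∫ ω in A, ‖φ.ξ k ω‖ ^ 2 ∂μ := by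
  induction n with
  | zero =>
    simp only [Finset.range_zero, Finset.sum_empty]
    refine ⟨stronglyMeasurable_const, ?_, by simp, by simp⟩
    simp
  | succ n ih =>
    obtain ⟨h1, h2, h3, h4⟩ := ih (by omega)
    simp only [Finset.sum_range_succ]
    set M : Ω → ℝ := fun ω => ∑ k ∈ Finset.range n,
      inner ℝ (φ.ξ k ω) (W (φ.τ (k + 1)) ω - W (φ.τ k) ω) with hM
    have hτn := φ.partition_mem (show n ≤ φ.N by omega)
    have hτn1 := φ.partition_mem hn
    have hle : φ.τ n ≤ φ.τ (n + 1) := φ.mono (Nat.le_succ n)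
    have hn0 : 0 ≤ φ.τ n := hs.trans hτn.1
    have hn1 : φ.τ (n + 1) ≤ T := hτn1.2.trans ht
    obtain ⟨K, hK⟩ := φ.bdd
    have hξm := φ.meas n (by omega)
    have hξb := hK n (by omega)
    have hAn : MeasurableSet[ℱ (φ.τ n)] A := ℱ.mono hτn.1 A hA
    have hAm := ℱ.le s A hA
    have hD := hW.memLp_inner_increment hn0 hle hn1 hξm hξb
    have hDm : StronglyMeasurable[ℱ (φ.τ (n + 1))]
        (fun ω => inner ℝ (φ.ξ n ω) (W (φ.τ (n + 1)) ω - W (φ.τ n) ω)) :=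
      (hξm.mono (ℱ.mono hle)).inner (hW.stronglyMeasurable_increment hn0 hle hn1)
    have hmean : ∫ ω in A, inner ℝ (φ.ξ n ω) (W (φ.τ (n + 1)) ω - W (φ.τ n) ω) ∂μ = 0 := by
      have h := (hW.integral_mul_inner_increment hn0 hle hn1 (g := A.indicator fun _ => (1 : ℝ))
        (stronglyMeasurable_const.indicator hAn)
        ((integrable_const (1 : ℝ)).indicator hAm) hξm hξb).2
      rw [← integral_indicator hAm, ← h]
      congr 1
      ext ω
      by_cases hω : ω ∈ A <;> simp [hω]
    -- The earlier terms `M` are known at time `τ n`, hence orthogonal to the next one, also on the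
    -- past event `A`.
    have hcross : ∫ ω in A, M ω * inner ℝ (φ.ξ n ω) (W (φ.τ (n + 1)) ω - W (φ.τ n) ω) ∂μ = 0 := by
      have h := (hW.integral_mul_inner_increment hn0 hle hn1 (g := A.indicator M)
        (h1.indicator hAn) ((h2.integrable (by norm_num)).indicator hAm) hξm hξb).2
      rw [← integral_indicator hAm, ← h]
      congr 1
      ext ω
      by_cases hω : ω ∈ A <;> simp [hω]
    have hsq := hW.setIntegral_inner_increment_sq hn0 hle hn1 hAn hξm hξb
    refine ⟨(h1.mono (ℱ.mono hle)).add hDm, h2.add hD, ?_, ?_⟩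
    · rw [integral_add (h2.integrable (by norm_num)).integrableOn
        (hD.integrable (by norm_num)).integrableOn, hmean, add_zero]
      exact h3
    · have hexp : ∀ ω, (M ω + inner ℝ (φ.ξ n ω) (W (φ.τ (n + 1)) ω - W (φ.τ n) ω)) ^ 2
          = M ω ^ 2 + (2 * (M ω * inner ℝ (φ.ξ n ω) (W (φ.τ (n + 1)) ω - W (φ.τ n) ω))
            + inner ℝ (φ.ξ n ω) (W (φ.τ (n + 1)) ω - W (φ.τ n) ω) ^ 2) := fun ω => by ring
      refine (integral_congr_ae (ae_of_all _ hexp)).trans ?_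
      have i1 := h2.integrable_sq.integrableOn (s := A)
      have i2 := ((h2.integrable_mul hD).const_mul 2).integrableOn (s := A)
      have i3 := hD.integrable_sq.integrableOn (s := A)
      refine (integral_add i1 (i2.add i3)).trans ?_
      refine (congrArg₂ (· + ·) h4 ((integral_add i2 i3).trans ?_))
      refine (congrArg₂ (· + ·) ((integral_const_mul _ _).trans ?_) hsq).trans (zero_add _)
      exact (congrArg (2 * ·) hcross).trans (mul_zero 2)

lemma process_eq (φ : SimpleIntegrand ℱ d s t) {k : ℕ} (hk : k < φ.N) {u : ℝ}
    (hu : u ∈ Set.Ioc (φ.τ k) (φ.τ (k + 1))) (ω : Ω) : φ.process u ω = φ.ξ k ω := by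
  rw [process, Finset.sum_eq_single k]
  · simp [Set.indicator_of_mem hu]
  · intro j _ hj
    refine Set.indicator_of_notMem (fun hu' => ?_) _
    exact (Set.disjoint_left.1 (φ.mono.pairwise_disjoint_on_Ioc_succ hj)) hu' hu
  · intro h
    exact absurd (Finset.mem_range.2 hk) h

/-- The intervals of the subdivision are disjoint, and on each of them the process equals one `ξ k`.
Only this direction is needed, so no value outside their union matters. -/
lemma sum_le_lintegral_process (φ : SimpleIntegrand ℱ d s t) (ω : Ω) :
    ∑ k ∈ Finset.range φ.N, ENNReal.ofReal (φ.τ (k + 1) - φ.τ k) * ‖φ.ξ k ω‖ₑ ^ 2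
      ≤ ∫⁻ u in Set.Ioc s t, ‖φ.process u ω‖ₑ ^ 2 := by
  have h1 : ∀ u, ∑ k ∈ Finset.range φ.N,
      (Set.Ioc (φ.τ k) (φ.τ (k + 1))).indicator (fun _ => ‖φ.ξ k ω‖ₑ ^ 2) u
        ≤ ‖φ.process u ω‖ₑ ^ 2 := by
    intro u
    by_cases hu : ∃ k < φ.N, u ∈ Set.Ioc (φ.τ k) (φ.τ (k + 1))
    · obtain ⟨k, hk, hu⟩ := hu
      rw [φ.process_eq hk hu, Finset.sum_eq_single k]
      · simp [Set.indicator_of_mem hu]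
      · intro j _ hj
        refine Set.indicator_of_notMem (fun hu' => ?_) _
        exact (Set.disjoint_left.1 (φ.mono.pairwise_disjoint_on_Ioc_succ hj)) hu' hu
      · intro h
        exact absurd (Finset.mem_range.2 hk) h
    · push Not at hu
      rw [Finset.sum_eq_zero]
      · exact zero_le
      · intro k hk
        exact Set.indicator_of_notMem (hu k (Finset.mem_range.1 hk)) _
  refine le_trans (le_of_eq ?_) (lintegral_mono h1)
  rw [lintegral_finsetSum _ fun k _ => measurable_const.indicator measurableSet_Ioc]
  refine Finset.sum_congr rfl fun k hk => ?_
  have hk := Finset.mem_range.1 hk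
  rw [lintegral_indicator_const measurableSet_Ioc, Measure.restrict_apply measurableSet_Ioc,
    Set.inter_eq_left.2 (Set.Ioc_subset_Ioc (φ.partition_mem hk.le).1 (φ.partition_mem hk).2),
    Real.volume_Ioc, mul_comm]

/-- Half of the Itô isometry. Restricting to an event `A` known at time `s` is what turns it into a
bound on the conditional second moment. -/
lemma setLIntegral_integral_sq_le [IsProbabilityMeasure μ] (hW : IsBrownianMotion μ ℱ T W)
    (hs : 0 ≤ s) (ht : t ≤ T) (φ : SimpleIntegrand ℱ d s t) {A : Set Ω}
    (hA : MeasurableSet[ℱ s] A) :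
    ∫⁻ ω in A, ‖φ.integral W ω‖ₑ ^ 2 ∂μ
      ≤ ∫⁻ ω in A, ∫⁻ u in Set.Ioc s t, ‖φ.process u ω‖ₑ ^ 2 ∂volume ∂μ := by
  obtain ⟨_, h2, _, h4⟩ := φ.partial_integral hW hs ht hA φ.N le_rfl
  obtain ⟨K, hK⟩ := φ.bdd
  have hξm : ∀ k ∈ Finset.range φ.N, StronglyMeasurable (φ.ξ k) := fun k hk =>
    (φ.meas k (Finset.mem_range.1 hk)).mono (ℱ.le _)
  refine le_trans (le_of_eq ?_) (lintegral_mono fun ω => φ.sum_le_lintegral_process ω)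
  rw [lintegral_finsetSum' _ fun k hk => ((hξm k hk).enorm.pow_const 2).const_mul _ |>.aemeasurable]
  simp only [integral, enorm_sq_eq_ofReal_sq]
  rw [← ofReal_integral_eq_lintegral_ofReal h2.integrable_sq.integrableOn
    (ae_of_all _ fun ω => sq_nonneg _)]
  rw [h4, ENNReal.ofReal_sum_of_nonneg]
  · refine Finset.sum_congr rfl fun k hk => ?_
    have hle : 0 ≤ φ.τ (k + 1) - φ.τ k := sub_nonneg.2 (φ.mono (Nat.le_succ k))
    have hi : Integrable (fun ω => ‖φ.ξ k ω‖ ^ 2) μ := by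
      refine Integrable.of_bound ((hξm k hk).norm.pow 2).aestronglyMeasurable (K ^ 2)
        (ae_of_all _ fun ω => ?_)
      rw [norm_pow, norm_norm]
      exact pow_le_pow_left₀ (norm_nonneg _) (hK k (Finset.mem_range.1 hk) ω) 2
    rw [lintegral_const_mul _ ((hξm k hk).enorm.pow_const 2), ENNReal.ofReal_mul hle,
      ofReal_integral_eq_lintegral_ofReal hi.integrableOn (ae_of_all _ fun ω => sq_nonneg _)]
    congr 1
    refine lintegral_congr fun ω => ?_
    rw [ENNReal.ofReal_pow (norm_nonneg _), ofReal_norm]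
  · intro k _
    exact mul_nonneg (sub_nonneg.2 (φ.mono (Nat.le_succ k)))
      (integral_nonneg fun ω => sq_nonneg _)

end SimpleIntegrand

/-- A square integrable `X` with `E[X | m] = 0` and `E[X² | m] ≤ c`. -/
structure IsCenteredWeight (μ : Measure Ω) (m : MeasurableSpace Ω) (c : ℝ) (X : Ω → ℝ) :
    Prop where
  memLp : MemLp X 2 μ
  mean : ∀ A, MeasurableSet[m] A → ∫ ω in A, X ω ∂μ = 0
  second : ∀ A, MeasurableSet[m] A → ∫⁻ ω in A, ‖X ω‖ₑ ^ 2 ∂μ ≤ ENNReal.ofReal c * μ A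

/-- Both properties hold for elementary integrals and pass to the limit in L². The factor 4 comes
from using |x|² ≤ 2|x - y|² + 2|y|² twice: to compare `I` with an elementary integral, and the
simple process with `H`. -/
lemma IsItoIntegral.isCenteredWeight [IsProbabilityMeasure μ] (hW : IsBrownianMotion μ ℱ T W)
    {s t : ℝ} (hs : 0 ≤ s) (ht : t ≤ T) {H : ℝ → Ω → Vec d} {I : Ω → ℝ}
    (hI : IsItoIntegral μ ℱ W H s t I) {K : ℝ} (hK : 0 ≤ K)
    (hH : ∀ u ∈ Set.Ioc s t, ∀ ω, ‖H u ω‖ ≤ K) :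
    IsCenteredWeight μ (ℱ s) (4 * K ^ 2 * (t - s)) I := by
  obtain ⟨hI2, φ, hφ1, hφ2⟩ := hI
  have hmem : ∀ p, MemLp ((φ p).integral W) 2 μ := fun p =>
    ((φ p).partial_integral hW hs ht (MeasurableSet.univ (α := Ω)) (φ p).N le_rfl).2.1
  refine ⟨hI2, fun A hA => ?_, fun A hA => ?_⟩
  · have hz : ∀ p, ∫ ω in A, (φ p).integral W ω ∂μ = 0 := fun p =>
      ((φ p).partial_integral hW hs ht hA (φ p).N le_rfl).2.2.1
    -- The elementary integral has mean zero on `A`, so it may be subtracted for free; nonnegativity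
    -- of the variance of the restricted difference then plays the role of the Cauchy–Schwarz
    -- inequality.
    have hsq : ∀ p, ENNReal.ofReal ((∫ ω in A, I ω ∂μ) ^ 2)
        ≤ ∫⁻ ω, ‖I ω - (φ p).integral W ω‖ₑ ^ 2 ∂μ := by
      intro p
      have hd : MemLp (fun ω => I ω - (φ p).integral W ω) 2 μ := hI2.sub (hmem p)
      have e1 : ∫ ω in A, I ω ∂μ = ∫ ω in A, (I ω - (φ p).integral W ω) ∂μ := by
        rw [integral_sub (hI2.integrable (by norm_num)).integrableOn
          ((hmem p).integrable (by norm_num)).integrableOn, hz p, sub_zero]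
      have hA' := ℱ.le s A hA
      have hind : MemLp (A.indicator (fun ω => I ω - (φ p).integral W ω)) 2 μ := hd.indicator hA'
      have e3 := variance_nonneg (A.indicator (fun ω => I ω - (φ p).integral W ω)) μ
      rw [variance_eq_sub hind] at e3
      rw [e1, ← integral_indicator hA']
      simp only [enorm_sq_eq_ofReal_sq]
      rw [← ofReal_integral_eq_lintegral_ofReal hd.integrable_sq (ae_of_all _ fun ω => sq_nonneg _)]
      refine ENNReal.ofReal_le_ofReal ((sub_nonneg.1 e3).trans ?_)
      refine integral_mono hind.integrable_sq hd.integrable_sq fun ω => ?_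
      by_cases hω : ω ∈ A
      · simp [hω]
      · simp [hω, sq_nonneg]
    have h0 : ENNReal.ofReal ((∫ ω in A, I ω ∂μ) ^ 2) ≤ 0 :=
      ge_of_tendsto hφ2 (Eventually.of_forall hsq)
    have h1 : (∫ ω in A, I ω ∂μ) ^ 2 ≤ 0 := ENNReal.ofReal_eq_zero.1 (le_antisymm h0 zero_le)
    exact pow_eq_zero_iff (two_ne_zero) |>.1 (le_antisymm h1 (sq_nonneg _))
  · have hp : ∀ p, ∫⁻ ω in A, ‖I ω‖ₑ ^ 2 ∂μ
        ≤ 2 * (∫⁻ ω, ‖I ω - (φ p).integral W ω‖ₑ ^ 2 ∂μ)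
          + 2 * (2 * (∫⁻ ω, ∫⁻ u in Set.Ioc s t, ‖(φ p).process u ω - H u ω‖ₑ ^ 2 ∂volume ∂μ)
            + 2 * (ENNReal.ofReal K ^ 2 * ENNReal.ofReal (t - s)) * μ A) := by
      intro p
      have hIm : AEMeasurable (fun ω => 2 * ‖(φ p).integral W ω‖ₑ ^ 2) (μ.restrict A) :=
        ((hmem p).aestronglyMeasurable.enorm.pow_const 2).const_mul 2 |>.restrict
      have hin : ∀ ω, ∫⁻ u in Set.Ioc s t, ‖(φ p).process u ω‖ₑ ^ 2
          ≤ 2 * (∫⁻ u in Set.Ioc s t, ‖(φ p).process u ω - H u ω‖ₑ ^ 2)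
            + 2 * (ENNReal.ofReal K ^ 2 * ENNReal.ofReal (t - s)) := by
        intro ω
        calc ∫⁻ u in Set.Ioc s t, ‖(φ p).process u ω‖ₑ ^ 2
            ≤ ∫⁻ u in Set.Ioc s t, (2 * ‖(φ p).process u ω - H u ω‖ₑ ^ 2
                + 2 * ENNReal.ofReal K ^ 2) := by
              refine setLIntegral_mono' measurableSet_Ioc fun u hu => ?_
              refine (enorm_sq_le_two_mul _ (H u ω)).trans ?_
              gcongr
              rw [← ofReal_norm]
              exact ENNReal.ofReal_le_ofReal (hH u hu ω)
          _ = _ := by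
              rw [lintegral_add_right _ measurable_const, lintegral_const_mul' _ _ (by simp),
                lintegral_const, Measure.restrict_apply_univ, Real.volume_Ioc, mul_assoc]
      calc ∫⁻ ω in A, ‖I ω‖ₑ ^ 2 ∂μ
          ≤ ∫⁻ ω in A, (2 * ‖I ω - (φ p).integral W ω‖ₑ ^ 2
              + 2 * ‖(φ p).integral W ω‖ₑ ^ 2) ∂μ :=
            lintegral_mono fun ω => enorm_sq_le_two_mul _ _
        _ = 2 * (∫⁻ ω in A, ‖I ω - (φ p).integral W ω‖ₑ ^ 2 ∂μ)
              + 2 * ∫⁻ ω in A, ‖(φ p).integral W ω‖ₑ ^ 2 ∂μ := by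
            rw [lintegral_add_right' _ hIm, lintegral_const_mul' _ _ (by simp),
              lintegral_const_mul' _ _ (by simp)]
        _ ≤ _ := by
            gcongr
            · exact Measure.restrict_le_self
            · refine ((φ p).setLIntegral_integral_sq_le hW hs ht hA).trans ?_
              refine (lintegral_mono fun ω => hin ω).trans ?_
              rw [lintegral_add_right _ measurable_const, lintegral_const_mul' _ _ (by simp),
                lintegral_const, Measure.restrict_apply_univ]
              gcongr
              exact Measure.restrict_le_self
    have hlim := ENNReal.Tendsto.const_mul (a := 2) hφ2 (Or.inr (by simp))
    have hlim2 := ENNReal.Tendsto.const_mul (a := 2) hφ1 (Or.inr (by simp))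
    have hlim3 := hlim.add (ENNReal.Tendsto.const_mul (a := 2)
      (hlim2.add_const (2 * (ENNReal.ofReal K ^ 2 * ENNReal.ofReal (t - s)) * μ A))
      (Or.inr (by simp)))
    refine (ge_of_tendsto hlim3 (Eventually.of_forall hp)).trans (le_of_eq ?_)
    rw [ENNReal.ofReal_mul (by positivity), ENNReal.ofReal_mul (by norm_num),
      ENNReal.ofReal_pow hK, show ENNReal.ofReal 4 = 2 * 2 by norm_num]
    ring

lemma IsCenteredWeight.const_mul {m : MeasurableSpace Ω} {c : ℝ} {X : Ω → ℝ}
    (hX : IsCenteredWeight μ m c X) (k : ℝ) :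
    IsCenteredWeight μ m (k ^ 2 * c) (fun ω => k * X ω) := by
  refine ⟨hX.memLp.const_mul k, fun A hA => ?_, fun A hA => ?_⟩
  · rw [integral_const_mul, hX.mean A hA, mul_zero]
  · simp only [enorm_mul, mul_pow]
    rw [lintegral_const_mul' _ _ (by simp), enorm_sq_eq_ofReal_sq,
      ENNReal.ofReal_mul (sq_nonneg k), mul_assoc]
    gcongr
    exact hX.second A hA

lemma IsCenteredWeight.congr {m : MeasurableSpace Ω} {c : ℝ} {X X' : Ω → ℝ}
    (hX : IsCenteredWeight μ m c X) (h : X' =ᵐ[μ] X) : IsCenteredWeight μ m c X' := by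
  refine ⟨(memLp_congr_ae h).2 hX.memLp, fun A hA => ?_, fun A hA => ?_⟩
  · rw [integral_congr_ae (ae_restrict_of_ae h), hX.mean A hA]
  · refine le_trans (le_of_eq (lintegral_congr_ae ?_)) (hX.second A hA)
    filter_upwards [ae_restrict_of_ae h] with ω hω
    rw [hω]

lemma IsCenteredWeight.mono {m : MeasurableSpace Ω} {c c' : ℝ} {X : Ω → ℝ}
    (hX : IsCenteredWeight μ m c X) (h : c ≤ c') : IsCenteredWeight μ m c' X :=
  ⟨hX.memLp, hX.mean, fun A hA => (hX.second A hA).trans (by gcongr)⟩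

/-- The normalisation 1/h squared, times the bound 4K²h for the integral, gives the characteristic
order 1/h of the second moment. -/
lemma IsWeight.isCenteredWeight [IsProbabilityMeasure μ] (hW : IsBrownianMotion μ ℱ T W)
    {ψ : Fin d → ℝ → ℝ} {t h : ℝ} (ht : 0 ≤ t) (hh : 0 < h) (hT : t + h ≤ T) {H : Ω → Vec d}
    (hH : IsWeight μ ℱ W ψ t h H) {K : ℝ} (hK : 0 ≤ K)
    (hψ : ∀ l, ∀ u ∈ Set.Icc (0 : ℝ) 1, |ψ l u| ≤ K) (l : Fin d) :
    IsCenteredWeight μ (ℱ t) (4 * K ^ 2 / h) (fun ω => H ω l) := by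
  obtain ⟨I, hI, hHI⟩ := hH l
  have h1 := hI.isCenteredWeight hW ht hT hK fun u hu ω => by
    refine (PiLp.norm_single _ _ _ _).trans_le ?_
    refine hψ l _ ⟨div_nonneg (by linarith [hu.1]) hh.le, ?_⟩
    rw [div_le_one hh]
    linarith [hu.2]
  refine ((h1.const_mul (1 / h)).congr hHI).mono (le_of_eq ?_)
  field_simp
  ring

end Ito


/-! ### Conditional expectations of products with a centred weight. -/

section CondExp

variable {Ω : Type*} {m mΩ : MeasurableSpace Ω} {μ : Measure Ω}

lemma memLp_two_condExp {V : Ω → ℝ} (hV : MemLp V 2 μ) : MemLp (μ[V | m]) 2 μ :=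
  hV.condExp (by norm_num)

/-- Pythagoras for the conditional expectation. -/
lemma integral_sub_condExp_sq [IsProbabilityMeasure μ] (hm : m ≤ mΩ) {V : Ω → ℝ} (hV : MemLp V 2 μ) :
    ∫ ω, (V ω - (μ[V | m]) ω) ^ 2 ∂μ = ∫ ω, V ω ^ 2 ∂μ - ∫ ω, (μ[V | m]) ω ^ 2 ∂μ := by
  have hE := memLp_two_condExp (m := m) hV
  have hi : Integrable ((V - μ[V | m]) ^ 2) μ := (hV.sub hE).integrable_sq
  have h1 := setIntegral_condVar (hm := hm) hi MeasurableSet.univ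
  have h2 : ∫ ω, (Var[V; μ | m]) ω ∂μ = ∫ ω, (μ[V ^ 2 | m] - μ[V | m] ^ 2 : Ω → ℝ) ω ∂μ :=
    integral_congr_ae (condVar_ae_eq_condExp_sq_sub_sq_condExp hm hV)
  rw [setIntegral_univ, setIntegral_univ, h2] at h1
  have h3 : ∫ ω, (μ[V ^ 2 | m] - μ[V | m] ^ 2 : Ω → ℝ) ω ∂μ
      = ∫ ω, (μ[V ^ 2 | m]) ω ∂μ - ∫ ω, (μ[V | m]) ω ^ 2 ∂μ :=
    integral_sub integrable_condExp hE.integrable_sq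
  rw [h3, integral_condExp hm] at h1
  exact h1.symm

lemma integral_condExp_sq_le [IsProbabilityMeasure μ] (hm : m ≤ mΩ) {V : Ω → ℝ} (hV : MemLp V 2 μ) :
    ∫ ω, (μ[V | m]) ω ^ 2 ∂μ ≤ ∫ ω, V ω ^ 2 ∂μ := by
  have h := integral_sub_condExp_sq hm hV
  have h0 : 0 ≤ ∫ ω, (V ω - (μ[V | m]) ω) ^ 2 ∂μ := integral_nonneg fun ω => sq_nonneg _
  linarith

namespace IsCenteredWeight

variable {c : ℝ} {X V : Ω → ℝ}

/-- The bound on events says that the measure X²μ is dominated by cμ on the σ-algebra `m`;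
integrating an `m`-measurable function against both measures preserves this. -/
lemma lintegral_mul_le (hm : m ≤ mΩ) (hX : IsCenteredWeight μ m c X) {g : Ω → ℝ≥0∞}
    (hg : Measurable[m] g) :
    ∫⁻ ω, g ω * ‖X ω‖ₑ ^ 2 ∂μ ≤ ENNReal.ofReal c * ∫⁻ ω, g ω ∂μ := by
  have hXm : AEMeasurable (fun ω => ‖X ω‖ₑ ^ 2) μ :=
    hX.memLp.aestronglyMeasurable.enorm.pow_const 2
  have hle : (μ.withDensity fun ω => ‖X ω‖ₑ ^ 2).trim hm ≤ (ENNReal.ofReal c • μ).trim hm := by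
    refine Measure.le_iff.2 fun A hA => ?_
    rw [trim_measurableSet_eq hm hA, trim_measurableSet_eq hm hA,
      withDensity_apply _ (hm A hA)]
    exact hX.second A hA
  have h := lintegral_mono' hle (le_refl g)
  rw [lintegral_trim hm hg, lintegral_trim hm hg, lintegral_smul_measure,
    lintegral_withDensity_eq_lintegral_mul₀ hXm (hg.mono hm le_rfl).aemeasurable] at h
  refine le_trans (le_of_eq (lintegral_congr fun ω => ?_)) h
  rw [Pi.mul_apply, mul_comm]

lemma condExp_eq_zero [IsProbabilityMeasure μ] (hm : m ≤ mΩ) (hX : IsCenteredWeight μ m c X) : μ[X | m] =ᵐ[μ] 0 := by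
  refine (ae_eq_condExp_of_forall_setIntegral_eq hm (hX.memLp.integrable (by norm_num))
    (fun A _ _ => integrableOn_zero) (fun A hA _ => ?_)
    aestronglyMeasurable_zero).symm
  rw [hX.mean A hA]
  simp

/-- Formally, with D = E[XV | m], E D² = E[D X V] ≤ (2c)⁻¹ E[D²X²] + (c/2) E V² ≤ (1/2) E D² + (c/2)
E V², and half of E D² is absorbed. Absorption needs E D² finite, which is not known beforehand, so
D is truncated to |D| ≤ N and N tends to infinity by monotone convergence. -/
lemma lintegral_condExp_mul_sq_le [IsProbabilityMeasure μ] (hm : m ≤ mΩ) (hc : 0 < c) (hX : IsCenteredWeight μ m c X)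
    (hV : MemLp V 2 μ) :
    ∫⁻ ω, ENNReal.ofReal ((μ[X * V | m]) ω ^ 2) ∂μ ≤ ENNReal.ofReal (c * ∫ ω, V ω ^ 2 ∂μ) := by
  set D := μ[X * V | m] with hD
  have hDm : StronglyMeasurable[m] D := stronglyMeasurable_condExp
  let S : ℕ → Set Ω := fun N => {ω | |D ω| ≤ N}
  have hS : ∀ N, MeasurableSet[m] (S N) := fun N =>
    (continuous_abs.measurable.comp hDm.measurable) (measurableSet_Iic (a := (N : ℝ)))
  have hDN : ∀ N, StronglyMeasurable[m] ((S N).indicator D) := fun N => hDm.indicator (hS N)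
  have hDb : ∀ N ω, ‖(S N).indicator D ω‖ ≤ N := by
    intro N ω
    by_cases h : ω ∈ S N
    · rw [Set.indicator_of_mem h]; exact h
    · rw [Set.indicator_of_notMem h]; simp
  have hXV : Integrable (X * V) μ := hX.memLp.integrable_mul hV
  have hbound : ∀ N, ∫ ω, (S N).indicator D ω ^ 2 ∂μ ≤ c * ∫ ω, V ω ^ 2 ∂μ := by
    intro N
    set G := (S N).indicator D with hG
    have hGm : AEStronglyMeasurable G μ := ((hDN N).mono hm).aestronglyMeasurable
    have hGae : ∀ᵐ ω ∂μ, ‖G ω‖ ≤ N := ae_of_all _ (hDb N)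
    have hG2 : MemLp G 2 μ := MemLp.of_bound hGm N hGae
    have hGXV : Integrable (G * (X * V)) μ := hXV.bdd_mul hGm hGae
    have e1 : ∫ ω, G ω ^ 2 ∂μ = ∫ ω, G ω * (X ω * V ω) ∂μ := by
      have hp := condExp_mul_of_stronglyMeasurable_left (hDN N) hGXV hXV
      have h2 : ∫ ω, (μ[G * (X * V) | m]) ω ∂μ = ∫ ω, G ω ^ 2 ∂μ := by
        refine integral_congr_ae (hp.trans (ae_of_all _ fun ω => ?_))
        change G ω * D ω = G ω ^ 2
        by_cases h : ω ∈ S N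
        · simp only [hG, Set.indicator_of_mem h]; ring
        · simp only [hG, Set.indicator_of_notMem h]; ring
      rw [← h2, integral_condExp hm]
      rfl
    have hGX : Integrable (fun ω => G ω ^ 2 * X ω ^ 2) μ := by
      refine hX.memLp.integrable_sq.bdd_mul (c := (N : ℝ) ^ 2) (hGm.pow 2) ?_
      filter_upwards [hGae] with ω hω
      rw [norm_pow]
      exact pow_le_pow_left₀ (norm_nonneg _) hω 2
    have e2 : ∫ ω, G ω ^ 2 * X ω ^ 2 ∂μ ≤ c * ∫ ω, G ω ^ 2 ∂μ := by
      have h := hX.lintegral_mul_le hm (g := fun ω => ENNReal.ofReal (G ω ^ 2))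
        (((hDN N).measurable.pow_const 2).ennreal_ofReal)
      have h3 : ∫⁻ ω, ENNReal.ofReal (G ω ^ 2) * ‖X ω‖ₑ ^ 2 ∂μ
          = ENNReal.ofReal (∫ ω, G ω ^ 2 * X ω ^ 2 ∂μ) := by
        rw [ofReal_integral_eq_lintegral_ofReal hGX (ae_of_all _ fun ω => by positivity)]
        refine lintegral_congr fun ω => ?_
        rw [enorm_sq_eq_ofReal_sq, ENNReal.ofReal_mul (sq_nonneg _)]
      rw [h3, ← ofReal_integral_eq_lintegral_ofReal hG2.integrable_sq
        (ae_of_all _ fun ω => sq_nonneg _), ← ENNReal.ofReal_mul hc.le] at h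
      exact (ENNReal.ofReal_le_ofReal_iff
        (mul_nonneg hc.le (integral_nonneg fun ω => sq_nonneg _))).1 h
    have e3 : ∫ ω, G ω * (X ω * V ω) ∂μ
        ≤ ∫ ω, ((2 * c)⁻¹ * (G ω ^ 2 * X ω ^ 2) + c / 2 * V ω ^ 2) ∂μ := by
      refine integral_mono hGXV ((hGX.const_mul _).add (hV.integrable_sq.const_mul _)) fun ω => ?_
      have h : 0 ≤ (2 * c)⁻¹ * (G ω * X ω - c * V ω) ^ 2 := by positivity
      have h' : (2 * c)⁻¹ * (G ω * X ω - c * V ω) ^ 2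
          = (2 * c)⁻¹ * (G ω ^ 2 * X ω ^ 2) + c / 2 * V ω ^ 2 - G ω * (X ω * V ω) := by
        field_simp
        ring
      change G ω * (X ω * V ω) ≤ _
      linarith
    rw [integral_add (hGX.const_mul _) (hV.integrable_sq.const_mul _), integral_const_mul,
      integral_const_mul] at e3
    have e4 : (2 * c)⁻¹ * ∫ ω, G ω ^ 2 * X ω ^ 2 ∂μ ≤ (2 * c)⁻¹ * (c * ∫ ω, G ω ^ 2 ∂μ) :=
      mul_le_mul_of_nonneg_left e2 (by positivity)
    have e5 : (2 * c)⁻¹ * (c * ∫ ω, G ω ^ 2 ∂μ) = (∫ ω, G ω ^ 2 ∂μ) / 2 := by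
      field_simp
    linarith
  have hmono : ∀ᵐ ω ∂μ, Monotone fun N => ENNReal.ofReal ((S N).indicator D ω ^ 2) := by
    refine ae_of_all _ fun ω N M hNM => ENNReal.ofReal_le_ofReal ?_
    by_cases h : ω ∈ S N
    · have h' : ω ∈ S M := le_trans (show |D ω| ≤ N from h) (by exact_mod_cast hNM)
      rw [Set.indicator_of_mem h, Set.indicator_of_mem h']
    · rw [Set.indicator_of_notMem h]; simp [sq_nonneg]
  have htend : ∀ᵐ ω ∂μ, Tendsto (fun N => ENNReal.ofReal ((S N).indicator D ω ^ 2)) atTop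
      (𝓝 (ENNReal.ofReal (D ω ^ 2))) := by
    refine ae_of_all _ fun ω => tendsto_const_nhds.congr' ?_
    obtain ⟨M, hM⟩ := exists_nat_ge |D ω|
    filter_upwards [eventually_ge_atTop M] with N hN
    have h : ω ∈ S N := hM.trans (by exact_mod_cast hN)
    rw [Set.indicator_of_mem h]
  refine le_of_tendsto' (lintegral_tendsto_of_tendsto_of_monotone
    (fun N => (((hDN N).mono hm).measurable.pow_const 2).ennreal_ofReal.aemeasurable)
    hmono htend) fun N => ?_
  rw [← ofReal_integral_eq_lintegral_ofReal
    (MemLp.of_bound ((hDN N).mono hm).aestronglyMeasurable N (ae_of_all _ (hDb N))).integrable_sq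
    (ae_of_all _ fun ω => sq_nonneg _)]
  exact ENNReal.ofReal_le_ofReal (hbound N)

lemma memLp_condExp_mul [IsProbabilityMeasure μ] (hm : m ≤ mΩ) (hc : 0 < c) (hX : IsCenteredWeight μ m c X)
    (hV : MemLp V 2 μ) : MemLp (μ[X * V | m]) 2 μ := by
  have hmeas : AEStronglyMeasurable (μ[X * V | m]) μ :=
    (stronglyMeasurable_condExp.mono hm).aestronglyMeasurable
  rw [memLp_two_iff_integrable_sq hmeas]
  refine ⟨hmeas.pow 2, ?_⟩
  rw [hasFiniteIntegral_iff_ofReal (ae_of_all _ fun ω => sq_nonneg _)]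
  exact (hX.lintegral_condExp_mul_sq_le hm hc hV).trans_lt ENNReal.ofReal_lt_top

lemma integral_condExp_mul_sq_le [IsProbabilityMeasure μ] (hm : m ≤ mΩ) (hc : 0 < c) (hX : IsCenteredWeight μ m c X)
    (hV : MemLp V 2 μ) : ∫ ω, (μ[X * V | m]) ω ^ 2 ∂μ ≤ c * ∫ ω, V ω ^ 2 ∂μ := by
  have h := hX.lintegral_condExp_mul_sq_le hm hc hV
  rw [← ofReal_integral_eq_lintegral_ofReal (hX.memLp_condExp_mul hm hc hV).integrable_sq
    (ae_of_all _ fun ω => sq_nonneg _)] at h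
  exact (ENNReal.ofReal_le_ofReal_iff
    (mul_nonneg hc.le (integral_nonneg fun ω => sq_nonneg _))).1 h

/-- Since X is conditionally centred, E[X E[V | m] | m] = 0 and V may be replaced by V - E[V | m];
Pythagoras computes the second moment of the latter. This gain over the crude bound by E V² is the
key to the stability of the Z-step. -/
lemma integral_condExp_mul_sq_le_sub [IsProbabilityMeasure μ] (hm : m ≤ mΩ) (hc : 0 < c) (hX : IsCenteredWeight μ m c X)
    (hV : MemLp V 2 μ) :
    ∫ ω, (μ[X * V | m]) ω ^ 2 ∂μ
      ≤ c * (∫ ω, V ω ^ 2 ∂μ - ∫ ω, (μ[V | m]) ω ^ 2 ∂μ) := by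
  have hE := memLp_two_condExp (m := m) hV
  have hXE : Integrable (μ[V | m] * X) μ := hE.integrable_mul hX.memLp
  have h0 : μ[μ[V | m] * X | m] =ᵐ[μ] 0 := by
    refine (condExp_mul_of_stronglyMeasurable_left stronglyMeasurable_condExp hXE
      (hX.memLp.integrable (by norm_num))).trans ?_
    filter_upwards [hX.condExp_eq_zero hm] with ω hω
    rw [Pi.mul_apply, hω]
    simp
  have h1 : μ[X * V | m] =ᵐ[μ] μ[X * (V - μ[V | m]) | m] := by
    have h2 : X * (V - μ[V | m]) = X * V - μ[V | m] * X := by ring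
    rw [h2]
    refine EventuallyEq.trans ?_ (condExp_sub (hX.memLp.integrable_mul hV) hXE m).symm
    filter_upwards [h0] with ω hω
    simp [hω]
  rw [← integral_sub_condExp_sq hm hV]
  refine le_trans (le_of_eq (integral_congr_ae ?_))
    (hX.integral_condExp_mul_sq_le hm hc (hV.sub hE))
  filter_upwards [h1] with ω hω
  rw [hω]
  rfl

end IsCenteredWeight

end CondExp


/-! ### Mean square inequalities and Lipschitz drivers. -/

section Integrals

variable {Ω : Type*} {mΩ : MeasurableSpace Ω} {μ : Measure Ω} {d : ℕ}

lemma integrable_norm_sq {E : Type*} [NormedAddCommGroup E] {U : Ω → E} (hU : MemLp U 2 μ) :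
    Integrable (fun ω => ‖U ω‖ ^ 2) μ :=
  hU.norm.integrable_sq

lemma lintegral_enorm_sq {E : Type*} [NormedAddCommGroup E] {U : Ω → E} (hU : MemLp U 2 μ) :
    ∫⁻ ω, ‖U ω‖ₑ ^ 2 ∂μ = ENNReal.ofReal (∫ ω, ‖U ω‖ ^ 2 ∂μ) := by
  rw [ofReal_integral_eq_lintegral_ofReal (integrable_norm_sq hU)
    (ae_of_all _ fun ω => sq_nonneg _)]
  refine lintegral_congr fun ω => ?_
  rw [ENNReal.ofReal_pow (norm_nonneg _), ofReal_norm]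

lemma memLp_two_of_lintegral {E : Type*} [NormedAddCommGroup E] {U : Ω → E}
    (hU : AEStronglyMeasurable U μ) (h : ∫⁻ ω, ‖U ω‖ₑ ^ 2 ∂μ < ∞) : MemLp U 2 μ := by
  refine ⟨hU, ?_⟩
  rw [eLpNorm_lt_top_iff_lintegral_rpow_enorm_lt_top (by norm_num) (by norm_num)]
  simpa using h

lemma integral_norm_add_sq_le {E : Type*} [NormedAddCommGroup E] {U V : Ω → E}
    (hU : MemLp U 2 μ) (hV : MemLp V 2 μ) :
    ∫ ω, ‖U ω + V ω‖ ^ 2 ∂μ ≤ 2 * ∫ ω, ‖U ω‖ ^ 2 ∂μ + 2 * ∫ ω, ‖V ω‖ ^ 2 ∂μ := by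
  have hi := ((integrable_norm_sq hU).const_mul 2).add ((integrable_norm_sq hV).const_mul 2)
  have h := integral_mono (integrable_norm_sq (hU.add hV)) hi fun ω => by
    change ‖U ω + V ω‖ ^ 2 ≤ 2 * ‖U ω‖ ^ 2 + 2 * ‖V ω‖ ^ 2
    have := norm_add_le (U ω) (V ω)
    nlinarith [norm_nonneg (U ω + V ω), sq_nonneg (‖U ω‖ - ‖V ω‖)]
  refine h.trans (le_of_eq ?_)
  rw [← integral_const_mul, ← integral_const_mul]
  exact integral_add ((integrable_norm_sq hU).const_mul 2) ((integrable_norm_sq hV).const_mul 2)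

lemma integral_norm_sub_sq_le {E : Type*} [NormedAddCommGroup E] {U V V' : Ω → E}
    (hU : MemLp U 2 μ) (hV : MemLp V 2 μ) (hV' : MemLp V' 2 μ) :
    ∫ ω, ‖V ω - V' ω‖ ^ 2 ∂μ ≤ 2 * ∫ ω, ‖U ω - V' ω‖ ^ 2 ∂μ + 2 * ∫ ω, ‖U ω - V ω‖ ^ 2 ∂μ := by
  have h := integral_norm_add_sq_le (hU.sub hV') (hV.sub hU)
  refine le_trans (le_of_eq (integral_congr_ae (ae_of_all _ fun ω => ?_)))
    (h.trans (le_of_eq ?_))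
  · simp
  · congr 2
    exact integral_congr_ae (ae_of_all _ fun ω => by simp [norm_sub_rev])

lemma integral_sum_sq_le {J : Finset ℕ} {U : ℕ → Ω → ℝ} (hU : ∀ j ∈ J, MemLp (U j) 2 μ) :
    ∫ ω, (∑ j ∈ J, U j ω) ^ 2 ∂μ ≤ J.card * ∑ j ∈ J, ∫ ω, U j ω ^ 2 ∂μ := by
  rw [← integral_finsetSum _ fun j hj => (hU j hj).integrable_sq, ← integral_const_mul]
  refine integral_mono (memLp_finsetSum J hU).integrable_sq
    ((integrable_finsetSum _ fun j hj => (hU j hj).integrable_sq).const_mul _) fun ω => ?_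
  exact sq_sum_le_card_mul_sum_sq

variable {f : ℝ → Vec d → ℝ} {L : NNReal}

lemma abs_sub_le_of_lipschitz (hf : LipschitzWith L (fun p : ℝ × Vec d => f p.1 p.2))
    (y y' : ℝ) (z z' : Vec d) : |f y z - f y' z'| ≤ L * (|y - y'| + ‖z - z'‖) := by
  have h := hf.dist_le_mul (y, z) (y', z')
  rw [Real.dist_eq, Prod.dist_eq, Real.dist_eq, dist_eq_norm] at h
  refine h.trans (mul_le_mul_of_nonneg_left (max_le ?_ ?_) L.coe_nonneg)
  · exact le_add_of_nonneg_right (norm_nonneg _)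
  · exact le_add_of_nonneg_left (abs_nonneg _)

lemma abs_le_of_lipschitz (hf : LipschitzWith L (fun p : ℝ × Vec d => f p.1 p.2))
    (y : ℝ) (z : Vec d) : |f y z| ≤ |f 0 0| + L * |y| + L * ‖z‖ := by
  have h := abs_sub_le_of_lipschitz hf y 0 z 0
  rw [sub_zero, sub_zero] at h
  have := abs_sub_abs_le_abs_sub (f y z) (f 0 0)
  linarith

lemma memLp_comp_of_lipschitz [IsFiniteMeasure μ]
    (hf : LipschitzWith L (fun p : ℝ × Vec d => f p.1 p.2)) {y : Ω → ℝ} {z : Ω → Vec d}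
    (hy : MemLp y 2 μ) (hz : MemLp z 2 μ) : MemLp (fun ω => f (y ω) (z ω)) 2 μ := by
  have hb := ((memLp_const (μ := μ) (p := 2) |f 0 0|).add (hy.norm.const_mul (L : ℝ))).add
    (hz.norm.const_mul (L : ℝ))
  refine hb.of_le (hf.continuous.comp_aestronglyMeasurable
    (hy.aestronglyMeasurable.prodMk hz.aestronglyMeasurable)) (ae_of_all _ fun ω => ?_)
  exact (abs_le_of_lipschitz hf _ _).trans (le_abs_self _)

lemma integral_sub_sq_le_of_lipschitz [IsFiniteMeasure μ]
    (hf : LipschitzWith L (fun p : ℝ × Vec d => f p.1 p.2)) {y y' : Ω → ℝ} {z z' : Ω → Vec d}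
    (hy : MemLp y 2 μ) (hz : MemLp z 2 μ) (hy' : MemLp y' 2 μ) (hz' : MemLp z' 2 μ) :
    ∫ ω, (f (y ω) (z ω) - f (y' ω) (z' ω)) ^ 2 ∂μ
      ≤ 2 * (L : ℝ) ^ 2 * (∫ ω, ‖y ω - y' ω‖ ^ 2 ∂μ + ∫ ω, ‖z ω - z' ω‖ ^ 2 ∂μ) := by
  have i1 := integrable_norm_sq (hy.sub hy')
  have i2 := integrable_norm_sq (hz.sub hz')
  have h := integral_mono
    ((memLp_comp_of_lipschitz hf hy hz).sub (memLp_comp_of_lipschitz hf hy' hz')).integrable_sq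
    ((i1.add i2).const_mul (2 * (L : ℝ) ^ 2)) fun ω => by
      change (f (y ω) (z ω) - f (y' ω) (z' ω)) ^ 2
        ≤ 2 * (L : ℝ) ^ 2 * (‖y ω - y' ω‖ ^ 2 + ‖z ω - z' ω‖ ^ 2)
      have h1 := abs_sub_le_of_lipschitz hf (y ω) (y' ω) (z ω) (z' ω)
      rw [← sq_abs, Real.norm_eq_abs]
      calc |f (y ω) (z ω) - f (y' ω) (z' ω)| ^ 2
          ≤ (L * (|y ω - y' ω| + ‖z ω - z' ω‖)) ^ 2 := pow_le_pow_left₀ (abs_nonneg _) h1 2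
        _ = (L : ℝ) ^ 2 * (|y ω - y' ω| + ‖z ω - z' ω‖) ^ 2 := mul_pow _ _ _
        _ ≤ (L : ℝ) ^ 2 * (2 * (|y ω - y' ω| ^ 2 + ‖z ω - z' ω‖ ^ 2)) := by
            refine mul_le_mul_of_nonneg_left ?_ (sq_nonneg _)
            nlinarith [sq_nonneg (|y ω - y' ω| - ‖z ω - z' ω‖)]
        _ = _ := by ring
  refine h.trans (le_of_eq ?_)
  rw [integral_const_mul]
  congr 1
  exact integral_add i1 i2

end Integrals

/-! ### The implicit equation for one value of Y. -/

section ImplicitStep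

variable {Ω : Type*} {m mΩ : MeasurableSpace Ω} {μ : Measure Ω} [IsProbabilityMeasure μ] {d : ℕ}
  {f : ℝ → Vec d → ℝ} {L : NNReal} {G u : Ω → ℝ} {z : Ω → Vec d} {k : ℝ}

/-- A solution agrees a.e. with a conditional expectation, so it is `m`-measurable up to null sets;
so is the driver term, which therefore comes out of the conditional expectation. -/
lemma implicit_eq_of_integrable (hm : m ≤ mΩ)
    (hf : LipschitzWith L (fun p : ℝ × Vec d => f p.1 p.2)) (hG : Integrable G μ)
    (hz : AEStronglyMeasurable[m] z μ) (hfi : Integrable (fun ω => k * f (u ω) (z ω)) μ)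
    (hu : u =ᵐ[μ] μ[fun ω => G ω + k * f (u ω) (z ω) | m]) :
    u =ᵐ[μ] fun ω => (μ[G | m]) ω + k * f (u ω) (z ω) := by
  have hum : AEStronglyMeasurable[m] u μ :=
    (stronglyMeasurable_condExp.aestronglyMeasurable).congr hu.symm
  have hfm : AEStronglyMeasurable[m] (fun ω => k * f (u ω) (z ω)) μ :=
    (hf.continuous.comp_aestronglyMeasurable (hum.prodMk hz)).const_mul k
  have h1 := condExp_add hG hfi m
  have h2 := condExp_of_aestronglyMeasurable' hm hfm hfi
  filter_upwards [hu, h1, h2] with ω e1 e2 e3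
  refine e1.trans (e2.trans ?_)
  rw [Pi.add_apply, e3]

lemma memLp_of_implicit (hm : m ≤ mΩ)
    (hf : LipschitzWith L (fun p : ℝ × Vec d => f p.1 p.2)) (hG : MemLp G 2 μ)
    (hzm : AEStronglyMeasurable[m] z μ) (hz : MemLp z 2 μ) (hk : |k| * L ≤ 1 / 2)
    (hu : u =ᵐ[μ] μ[fun ω => G ω + k * f (u ω) (z ω) | m]) : MemLp u 2 μ := by
  have hGi : Integrable G μ := hG.integrable (by norm_num)
  -- The conditional expectation of a non-integrable function is 0 by convention. It would force u =
  -- 0 a.e., and then the function is G + k f(0, z), which is integrable: a contradiction.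
  have hint : Integrable (fun ω => G ω + k * f (u ω) (z ω)) μ := by
    by_contra hni
    rw [condExp_of_not_integrable hni] at hu
    apply hni
    have h0 : Integrable (fun ω => G ω + k * f 0 (z ω)) μ :=
      hGi.add (((memLp_comp_of_lipschitz hf (MemLp.zero' (μ := μ) (p := 2)) hz).integrable
        (by norm_num)).const_mul k)
    refine h0.congr ?_
    filter_upwards [hu] with ω hω
    rw [hω]
    rfl
  have hfi : Integrable (fun ω => k * f (u ω) (z ω)) μ := by
    refine (hint.sub hGi).congr (ae_of_all _ fun ω => ?_)
    simp
  have heq := implicit_eq_of_integrable hm hf hGi hzm hfi hu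
  have hum : AEStronglyMeasurable u μ :=
    ((stronglyMeasurable_condExp.mono hm).aestronglyMeasurable).congr hu.symm
  -- The contribution |k| L |u| ≤ |u|/2 of the unknown is moved to the left side, which doubles the
  -- remaining terms.
  have hb := ((memLp_two_condExp (m := m) hG).norm.const_mul 2).add
    (((memLp_const (μ := μ) (p := 2) |f 0 0|).add (hz.norm.const_mul (L : ℝ))).const_mul
      (2 * |k|))
  refine hb.of_le hum ?_
  filter_upwards [heq] with ω hω
  refine le_trans ?_ (le_abs_self _)
  change |u ω| ≤ 2 * |(μ[G | m]) ω| + 2 * |k| * (|f 0 0| + L * ‖z ω‖)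
  have h1 : |u ω| ≤ |(μ[G | m]) ω| + |k| * |f (u ω) (z ω)| := by
    conv_lhs => rw [hω]
    exact (abs_add_le _ _).trans (by rw [abs_mul])
  have h2 := mul_le_mul_of_nonneg_left (abs_le_of_lipschitz hf (u ω) (z ω)) (abs_nonneg k)
  have h3 := mul_le_mul_of_nonneg_right hk (abs_nonneg (u ω))
  have h4 : |k| * (|f 0 0| + L * |u ω| + L * ‖z ω‖)
      = |k| * L * |u ω| + |k| * (|f 0 0| + L * ‖z ω‖) := by ring
  linarith

end ImplicitStep

/-! ### Jensen's inequality for the Y-step. -/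

section YStep

variable {Ω : Type*} {m mΩ : MeasurableSpace Ω} {μ : Measure Ω}

lemma condExp_sum_const_mul {J : Finset ℕ} (a : ℕ → ℝ) {U : ℕ → Ω → ℝ}
    (hU : ∀ j ∈ J, Integrable (U j) μ) :
    μ[fun ω => ∑ j ∈ J, a j * U j ω | m] =ᵐ[μ] fun ω => ∑ j ∈ J, a j * (μ[U j | m]) ω := by
  have h1 := condExp_finsetSum (m := m) (μ := μ) (s := J) (f := fun j => a j • U j)
    (fun j hj => (hU j hj).smul (a j))
  have h2 : ∀ᵐ ω ∂μ, ∀ j ∈ (J : Set ℕ), (μ[a j • U j | m]) ω = a j * (μ[U j | m]) ω := by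
    refine (ae_ball_iff J.countable_toSet).2 fun j _ => ?_
    filter_upwards [condExp_smul (a j) (U j) m (μ := μ)] with ω hω
    rw [hω]
    rfl
  have h3 : (fun ω => ∑ j ∈ J, a j * U j ω) = ∑ j ∈ J, a j • U j := by
    ext ω
    simp
  rw [h3]
  filter_upwards [h1, h2] with ω e1 e2
  rw [e1, Finset.sum_apply]
  exact Finset.sum_congr rfl fun j hj => e2 j hj

/-- One step of the `Y`-recursion: convexity keeps the conditional variances. -/
lemma integral_sq_le_of_convex_step [IsProbabilityMeasure μ] {J : Finset ℕ} {a : ℕ → ℝ}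
    (ha : ∀ j ∈ J, 0 ≤ a j) (ha1 : ∑ j ∈ J, a j = 1) {U : ℕ → Ω → ℝ}
    (hU : ∀ j ∈ J, MemLp (U j) 2 μ) {R V : Ω → ℝ} (hR : MemLp R 2 μ)
    (hV : V =ᵐ[μ] fun ω => (μ[fun ω => ∑ j ∈ J, a j * U j ω | m]) ω + R ω)
    {x : ℝ} (hx : 0 < x) :
    ∫ ω, V ω ^ 2 ∂μ ≤ (1 + x) * (∑ j ∈ J, a j * ∫ ω, (μ[U j | m]) ω ^ 2 ∂μ)
      + (1 + 1 / x) * ∫ ω, R ω ^ 2 ∂μ := by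
  have hE : ∀ j ∈ J, MemLp (μ[U j | m]) 2 μ := fun j hj => memLp_two_condExp (hU j hj)
  have hsum := condExp_sum_const_mul (m := m) a fun j hj => (hU j hj).integrable (by norm_num)
  have hint : Integrable (fun ω => ∑ j ∈ J, a j * (μ[U j | m]) ω ^ 2) μ :=
    integrable_finsetSum _ fun j hj => (hE j hj).integrable_sq.const_mul _
  have hDL : MemLp (fun ω => ∑ j ∈ J, a j * (μ[U j | m]) ω) 2 μ :=
    memLp_finsetSum J fun j hj => (hE j hj).const_mul _
  have hVL : MemLp V 2 μ := by
    refine (memLp_congr_ae ?_).2 (hDL.add hR)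
    filter_upwards [hV, hsum] with ω e1 e2
    rw [e1, e2]
    rfl
  have h := integral_mono_ae hVL.integrable_sq
    ((hint.const_mul (1 + x)).add (hR.integrable_sq.const_mul (1 + 1 / x))) (by
      filter_upwards [hV, hsum] with ω e1 e2
      change V ω ^ 2 ≤ (1 + x) * (∑ j ∈ J, a j * (μ[U j | m]) ω ^ 2) + (1 + 1 / x) * R ω ^ 2
      rw [e1, e2]
      set D := ∑ j ∈ J, a j * (μ[U j | m]) ω with hD
      have hjen : D ^ 2 ≤ ∑ j ∈ J, a j * (μ[U j | m]) ω ^ 2 := by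
        have := (even_two.convexOn_pow (𝕜 := ℝ)).map_sum_le (t := J) (w := a)
          (p := fun j => (μ[U j | m]) ω) ha ha1 (fun _ _ => Set.mem_univ _)
        simpa [smul_eq_mul] using this
      -- Young's inequality (D + R)² ≤ (1 + x) D² + (1 + 1/x) R², written as a square.
      have h1 : 0 ≤ x⁻¹ * (x * D - R ω) ^ 2 := by positivity
      have h2 : x⁻¹ * (x * D - R ω) ^ 2 = x * D ^ 2 - 2 * D * R ω + 1 / x * R ω ^ 2 := by
        field_simp
        ring
      have h3 := mul_le_mul_of_nonneg_left hjen (by positivity : 0 ≤ 1 + x)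
      nlinarith)
  refine h.trans (le_of_eq ?_)
  rw [← integral_const_mul, Finset.sum_congr rfl fun j _ => (integral_const_mul (a j) _).symm,
    ← integral_finsetSum _ fun j hj => (hE j hj).integrable_sq.const_mul _, ← integral_const_mul]
  exact integral_add (hint.const_mul _) (hR.integrable_sq.const_mul _)

end YStep

/-! ### Conditional variance bound for the Z-step. -/

section ZStep

variable {Ω : Type*} {m mΩ : MeasurableSpace Ω} {μ : Measure Ω} {d : ℕ}

/-- The random vector whose conditional expectation is the `Z`-step of the scheme. -/
def weightedSum (J : Finset ℕ) (h : ℝ) (α β : ℕ → ℝ) (HY Hf : ℕ → Ω → Vec d)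
    (y F : ℕ → Ω → ℝ) (ω : Ω) : Vec d :=
  ∑ j ∈ J, (α j * y j ω) • HY j ω + h • ∑ j ∈ J, (β j * F j ω) • Hf j ω

lemma weightedSum_apply (J : Finset ℕ) (h : ℝ) (α β : ℕ → ℝ) (HY Hf : ℕ → Ω → Vec d)
    (y F : ℕ → Ω → ℝ) (ω : Ω) (l : Fin d) :
    weightedSum J h α β HY Hf y F ω l
      = ∑ j ∈ J, α j * (HY j ω l * y j ω) + h * ∑ j ∈ J, β j * (Hf j ω l * F j ω) := by
  simp only [weightedSum, PiLp.add_apply, PiLp.smul_apply, WithLp.ofLp_sum, Finset.sum_apply,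
    smul_eq_mul]
  congr 1
  · exact Finset.sum_congr rfl fun j _ => by ring
  · congr 1
    exact Finset.sum_congr rfl fun j _ => by ring

lemma weightedSum_sub (J : Finset ℕ) (h : ℝ) (α β : ℕ → ℝ) (HY Hf : ℕ → Ω → Vec d)
    (y F y' F' : ℕ → Ω → ℝ) :
    weightedSum J h α β HY Hf y F - weightedSum J h α β HY Hf y' F'
      = weightedSum J h α β HY Hf (fun j => y j - y' j) (fun j => F j - F' j) := by
  ext ω l
  simp only [Pi.sub_apply, PiLp.sub_apply, weightedSum_apply, mul_sub, Finset.sum_sub_distrib]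
  ring

variable {J : Finset ℕ} {h c : ℝ} {α β : ℕ → ℝ} {HY Hf : ℕ → Ω → Vec d} {y F : ℕ → Ω → ℝ}

lemma integrable_weightedSum
    (hHY : ∀ j ∈ J, ∀ l, IsCenteredWeight μ m c (fun ω => HY j ω l))
    (hHf : ∀ j ∈ J, ∀ l, IsCenteredWeight μ m c (fun ω => Hf j ω l))
    (hy : ∀ j ∈ J, MemLp (y j) 2 μ) (hF : ∀ j ∈ J, MemLp (F j) 2 μ) :
    Integrable (weightedSum J h α β HY Hf y F) μ := by
  rw [integrable_piLp_iff]
  intro l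
  simp only [weightedSum_apply]
  exact (integrable_finsetSum _ fun j hj =>
      ((hHY j hj l).memLp.integrable_mul (hy j hj)).const_mul _).add
    ((integrable_finsetSum _ fun j hj =>
      ((hHf j hj l).memLp.integrable_mul (hF j hj)).const_mul _).const_mul h)

lemma condExp_weightedSum_apply
    (hHY : ∀ j ∈ J, ∀ l, IsCenteredWeight μ m c (fun ω => HY j ω l))
    (hHf : ∀ j ∈ J, ∀ l, IsCenteredWeight μ m c (fun ω => Hf j ω l))
    (hy : ∀ j ∈ J, MemLp (y j) 2 μ) (hF : ∀ j ∈ J, MemLp (F j) 2 μ) (l : Fin d) :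
    (fun ω => (μ[weightedSum J h α β HY Hf y F | m]) ω l) =ᵐ[μ] fun ω =>
      ∑ j ∈ J, α j * (μ[(fun ω => HY j ω l) * y j | m]) ω
        + h * ∑ j ∈ J, β j * (μ[(fun ω => Hf j ω l) * F j | m]) ω := by
  have iY : ∀ j ∈ J, Integrable ((fun ω => HY j ω l) * y j) μ := fun j hj =>
    (hHY j hj l).memLp.integrable_mul (hy j hj)
  have iF : ∀ j ∈ J, Integrable ((fun ω => Hf j ω l) * F j) μ := fun j hj =>
    (hHf j hj l).memLp.integrable_mul (hF j hj)
  have h1 := (EuclideanSpace.proj (𝕜 := ℝ) l).comp_condExp_comm (m := m)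
    (integrable_weightedSum (h := h) (α := α) (β := β) hHY hHf hy hF)
  have h2 : (EuclideanSpace.proj (𝕜 := ℝ) l) ∘ weightedSum J h α β HY Hf y F
      = (fun ω => ∑ j ∈ J, α j * ((fun ω => HY j ω l) * y j) ω)
        + h • fun ω => ∑ j ∈ J, β j * ((fun ω => Hf j ω l) * F j) ω := by
    ext ω
    simp [weightedSum_apply]
  rw [h2] at h1
  have sY : Integrable (fun ω => ∑ j ∈ J, α j * ((fun ω => HY j ω l) * y j) ω) μ :=
    integrable_finsetSum _ fun j hj => (iY j hj).const_mul (α j)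
  have sF : Integrable (fun ω => ∑ j ∈ J, β j * ((fun ω => Hf j ω l) * F j) ω) μ :=
    integrable_finsetSum _ fun j hj => (iF j hj).const_mul (β j)
  filter_upwards [h1, condExp_add sY (sF.smul h) m,
    condExp_smul h (fun ω => ∑ j ∈ J, β j * ((fun ω => Hf j ω l) * F j) ω) m (μ := μ),
    condExp_sum_const_mul (m := m) α iY, condExp_sum_const_mul (m := m) β iF]
    with ω e1 e3 e4 e5 e6
  refine e1.trans ?_
  rw [e3, Pi.add_apply, e4, Pi.smul_apply, e5, e6, smul_eq_mul]

lemma memLp_condExp_weightedSum [IsProbabilityMeasure μ] (hm : m ≤ mΩ) (hc : 0 < c)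
    (hHY : ∀ j ∈ J, ∀ l, IsCenteredWeight μ m c (fun ω => HY j ω l))
    (hHf : ∀ j ∈ J, ∀ l, IsCenteredWeight μ m c (fun ω => Hf j ω l))
    (hy : ∀ j ∈ J, MemLp (y j) 2 μ) (hF : ∀ j ∈ J, MemLp (F j) 2 μ) :
    MemLp (μ[weightedSum J h α β HY Hf y F | m]) 2 μ := by
  rw [memLp_piLp_iff]
  intro l
  rw [memLp_congr_ae (condExp_weightedSum_apply hHY hHf hy hF l)]
  exact (memLp_finsetSum J fun j hj =>
      ((hHY j hj l).memLp_condExp_mul hm hc (hy j hj)).const_mul _).add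
    ((memLp_finsetSum J fun j hj =>
      ((hHf j hj l).memLp_condExp_mul hm hc (hF j hj)).const_mul _).const_mul h)

lemma integral_const_mul_sum_sq_le {P : ℕ → Ω → ℝ} {A : ℕ → ℝ}
    (hP : ∀ j ∈ J, MemLp (P j) 2 μ ∧ ∫ ω, P j ω ^ 2 ∂μ ≤ c * A j) :
    ∫ ω, ‖∑ j ∈ J, α j * P j ω‖ ^ 2 ∂μ ≤ J.card * (c * ∑ j ∈ J, α j ^ 2 * A j) := by
  have h3 := integral_sum_sq_le (μ := μ) (J := J) (U := fun j ω => α j * P j ω)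
    fun j hj => (hP j hj).1.const_mul _
  simp only [Real.norm_eq_abs, sq_abs]
  refine h3.trans (mul_le_mul_of_nonneg_left ?_ (Nat.cast_nonneg _))
  rw [Finset.mul_sum]
  refine Finset.sum_le_sum fun j hj => ?_
  simp only [mul_pow]
  rw [integral_const_mul]
  exact (mul_le_mul_of_nonneg_left (hP j hj).2 (sq_nonneg _)).trans (le_of_eq (by ring))

lemma integral_two_sums_sq_le {P Q : ℕ → Ω → ℝ} {A B : ℕ → ℝ}
    (hP : ∀ j ∈ J, MemLp (P j) 2 μ ∧ ∫ ω, P j ω ^ 2 ∂μ ≤ c * A j)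
    (hQ : ∀ j ∈ J, MemLp (Q j) 2 μ ∧ ∫ ω, Q j ω ^ 2 ∂μ ≤ c * B j) :
    ∫ ω, (∑ j ∈ J, α j * P j ω + h * ∑ j ∈ J, β j * Q j ω) ^ 2 ∂μ
      ≤ 2 * J.card * c * (∑ j ∈ J, α j ^ 2 * A j + h ^ 2 * ∑ j ∈ J, β j ^ 2 * B j) := by
  have mP : MemLp (fun ω => ∑ j ∈ J, α j * P j ω) 2 μ :=
    memLp_finsetSum J fun j hj => (hP j hj).1.const_mul _
  have mQ : MemLp (fun ω => ∑ j ∈ J, β j * Q j ω) 2 μ :=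
    memLp_finsetSum J fun j hj => (hQ j hj).1.const_mul _
  have h1 := integral_const_mul_sum_sq_le (α := α) hP
  have h2 := integral_const_mul_sum_sq_le (α := β) hQ
  have h3 : ∀ ω, ‖h * ∑ j ∈ J, β j * Q j ω‖ ^ 2 = h ^ 2 * ‖∑ j ∈ J, β j * Q j ω‖ ^ 2 := by
    intro ω
    rw [norm_mul, mul_pow, Real.norm_eq_abs h, sq_abs]
  have h4 := integral_norm_add_sq_le mP (mQ.const_mul h)
  rw [integral_congr_ae (ae_of_all μ h3), integral_const_mul] at h4
  have h5 := mul_le_mul_of_nonneg_left h2 (sq_nonneg h)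
  refine le_trans (le_of_eq (integral_congr_ae (ae_of_all _ fun ω => ?_))) (h4.trans ?_)
  · exact (sq_abs _).symm
  · linarith

/-- One step of the `Z`-recursion is controlled by the conditional variances. -/
lemma integral_condExp_weightedSum_sq_le [IsProbabilityMeasure μ] (hm : m ≤ mΩ) (hc : 0 < c)
    (hHY : ∀ j ∈ J, ∀ l, IsCenteredWeight μ m c (fun ω => HY j ω l))
    (hHf : ∀ j ∈ J, ∀ l, IsCenteredWeight μ m c (fun ω => Hf j ω l))
    (hy : ∀ j ∈ J, MemLp (y j) 2 μ) (hF : ∀ j ∈ J, MemLp (F j) 2 μ) :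
    ∫ ω, ‖(μ[weightedSum J h α β HY Hf y F | m]) ω‖ ^ 2 ∂μ
      ≤ d * (2 * J.card * c * (∑ j ∈ J, α j ^ 2 *
          (∫ ω, y j ω ^ 2 ∂μ - ∫ ω, (μ[y j | m]) ω ^ 2 ∂μ)
        + h ^ 2 * ∑ j ∈ J, β j ^ 2 * ∫ ω, F j ω ^ 2 ∂μ)) := by
  have hmem := memLp_piLp_iff.1 (memLp_condExp_weightedSum (h := h) (α := α) (β := β)
    hm hc hHY hHf hy hF)
  have hnorm : ∫ ω, ‖(μ[weightedSum J h α β HY Hf y F | m]) ω‖ ^ 2 ∂μ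
      = ∑ l : Fin d, ∫ ω, ((μ[weightedSum J h α β HY Hf y F | m]) ω l) ^ 2 ∂μ := by
    rw [← integral_finsetSum _ fun l _ => (hmem l).integrable_sq]
    refine integral_congr_ae (ae_of_all _ fun ω => ?_)
    exact EuclideanSpace.real_norm_sq_eq _
  rw [hnorm]
  refine (Finset.sum_le_card_nsmul Finset.univ _ (2 * J.card * c * (∑ j ∈ J, α j ^ 2 *
          (∫ ω, y j ω ^ 2 ∂μ - ∫ ω, (μ[y j | m]) ω ^ 2 ∂μ)
        + h ^ 2 * ∑ j ∈ J, β j ^ 2 * ∫ ω, F j ω ^ 2 ∂μ)) fun l _ => ?_).trans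
    (le_of_eq ?_)
  · have h0 := condExp_weightedSum_apply (h := h) (α := α) (β := β) hHY hHf hy hF l
    refine le_trans (le_of_eq (integral_congr_ae ?_)) (integral_two_sums_sq_le
      (fun j hj => ⟨(hHY j hj l).memLp_condExp_mul hm hc (hy j hj),
        (hHY j hj l).integral_condExp_mul_sq_le_sub hm hc (hy j hj)⟩)
      (fun j hj => ⟨(hHf j hj l).memLp_condExp_mul hm hc (hF j hj),
        (hHf j hj l).integral_condExp_mul_sq_le hm hc (hF j hj)⟩))
    filter_upwards [h0] with ω e
    rw [e]
  · rw [Finset.card_univ, Fintype.card_fin, nsmul_eq_mul]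

end ZStep


/-! ### The deterministic recursion: summation by parts, absorption and Gronwall. -/

section Recursion

variable {h : ℕ → ℝ} {κ ρ B : ℝ} {n N r : ℕ}

lemma step_le_pow_mul (hκ : 1 ≤ κ) (hratio : ∀ i, i + 1 < n → h i ≤ κ * h (i + 1)) (i j : ℕ)
    (hij : i + j < n) : h i ≤ κ ^ j * h (i + j) := by
  induction j with
  | zero => simp
  | succ j ih =>
    refine (ih (by omega)).trans ?_
    rw [pow_succ, mul_assoc]
    exact mul_le_mul_of_nonneg_left (hratio (i + j) (by omega)) (by positivity)

/-- Shifting the argument of a weighted sum costs a factor `κ ^ r` and the terminal values. -/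
lemma sum_step_mul_shift_le (hκ : 1 ≤ κ) (hB : 0 ≤ B) (hN : N + r = n + 1) (hr : 1 ≤ r)
    (hratio : ∀ i, i + 1 < n → h i ≤ κ * h (i + 1)) (hh : ∀ i < n, 0 < h i)
    (hρ : ∀ i < n, h i ≤ ρ) {x : ℕ → ℝ} (hx : ∀ i, 0 ≤ x i)
    (hterm : ∀ k, k ≤ n → n < k + r → ρ * x k ≤ B) {i j : ℕ} (hi : i ≤ N) (hj : j ≤ r) :
    ∑ k ∈ Finset.Ico i N, h k * x (k + j)
      ≤ κ ^ r * ∑ k ∈ Finset.Ico i N, h k * x k + r * B := by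
  -- A nonnegative majorant of the shifted summands, indexed by the shifted position. Below N the
  -- step ratios give the factor κ ^ r; since N + r = n + 1, any position from N on is terminal and
  -- costs at most B.
  let u : ℕ → ℝ := fun k => if k < N then κ ^ r * (h k * x k) else B
  have hκr : 0 ≤ κ ^ r := by positivity
  have hu : ∀ k, 0 ≤ u k := by
    intro k
    by_cases hk : k < N
    · simp only [u, if_pos hk]
      exact mul_nonneg hκr (mul_nonneg (hh k (by omega)).le (hx k))
    · simp only [u, if_neg hk]
      exact hB
  calc ∑ k ∈ Finset.Ico i N, h k * x (k + j)
      ≤ ∑ k ∈ Finset.Ico i N, u (k + j) := by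
        refine Finset.sum_le_sum fun k hk => ?_
        have hkN := (Finset.mem_Ico.1 hk).2
        by_cases hkj : k + j < N
        · simp only [u, if_pos hkj]
          rw [← mul_assoc]
          refine mul_le_mul_of_nonneg_right ?_ (hx _)
          refine (step_le_pow_mul hκ hratio k j (by omega)).trans ?_
          exact mul_le_mul_of_nonneg_right (pow_le_pow_right₀ hκ hj) (hh _ (by omega)).le
        · simp only [u, if_neg hkj]
          exact (mul_le_mul_of_nonneg_right (hρ k (by omega)) (hx _)).trans
            (hterm _ (by omega) (by omega))
    _ = ∑ k ∈ Finset.Ico (i + j) (N + j), u k := Finset.sum_Ico_add' u i N j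
    _ ≤ ∑ k ∈ Finset.Ico i (N + r), u k :=
        Finset.sum_le_sum_of_subset_of_nonneg
          (Finset.Ico_subset_Ico (by omega) (by omega)) fun k _ _ => hu k
    _ = ∑ k ∈ Finset.Ico i N, u k + ∑ k ∈ Finset.Ico N (N + r), u k :=
        (Finset.sum_Ico_consecutive u hi (by omega)).symm
    _ = κ ^ r * ∑ k ∈ Finset.Ico i N, h k * x k + r * B := by
        congr 1
        · rw [Finset.mul_sum]
          refine Finset.sum_congr rfl fun k hk => ?_
          simp only [u, if_pos (Finset.mem_Ico.1 hk).2]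
        · rw [Finset.sum_congr rfl (g := fun _ => B) fun k hk => ?_]
          · simp
          · simp only [u, if_neg (not_lt.2 (Finset.mem_Ico.1 hk).1)]

/-- Such windows come from the Lipschitz bounds on the driver at all the nodes used in one step; the
shift 0 is included because of the implicit term. After exchanging the sums, each shift is estimated
separately. -/
lemma sum_step_mul_window_le (hκ : 1 ≤ κ) (hB : 0 ≤ B) (hN : N + r = n + 1) (hr : 1 ≤ r)
    (hratio : ∀ i, i + 1 < n → h i ≤ κ * h (i + 1)) (hh : ∀ i < n, 0 < h i)
    (hρ : ∀ i < n, h i ≤ ρ) {x : ℕ → ℝ} (hx : ∀ i, 0 ≤ x i)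
    (hterm : ∀ k, k ≤ n → n < k + r → ρ * x k ≤ B) {i : ℕ} (hi : i ≤ N) :
    ∑ k ∈ Finset.Ico i N, h k * ∑ j ∈ Finset.range (r + 1), x (k + j)
      ≤ (r + 1) * (κ ^ r + r) * (∑ k ∈ Finset.Ico i N, h k * x k + B) := by
  have hX : 0 ≤ ∑ k ∈ Finset.Ico i N, h k * x k := Finset.sum_nonneg fun k hk =>
    mul_nonneg (hh k (by have := (Finset.mem_Ico.1 hk).2; omega)).le (hx k)
  have hκr : 0 ≤ κ ^ r := by positivity
  simp_rw [Finset.mul_sum]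
  rw [Finset.sum_comm]
  calc ∑ j ∈ Finset.range (r + 1), ∑ k ∈ Finset.Ico i N, h k * x (k + j)
      ≤ ∑ j ∈ Finset.range (r + 1), (κ ^ r * ∑ k ∈ Finset.Ico i N, h k * x k + r * B) :=
        Finset.sum_le_sum fun j hj => sum_step_mul_shift_le hκ hB hN hr hratio hh hρ hx hterm hi
          (by have := Finset.mem_range.1 hj; omega)
    _ = (r + 1) * (κ ^ r * ∑ k ∈ Finset.Ico i N, h k * x k + r * B) := by
        simp
        ring
    _ ≤ _ := by
        rw [mul_assoc]
        refine mul_le_mul_of_nonneg_left ?_ (by positivity)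
        have h1 : 0 ≤ (r : ℝ) * ∑ k ∈ Finset.Ico i N, h k * x k := by positivity
        have h2 : 0 ≤ κ ^ r * B := by positivity
        nlinarith

/-- Summation of the multi-step relation against the weights `a`. -/
lemma add_sum_le_of_multistep {a : ℕ → ℝ} (ha : ∀ j ∈ Finset.Icc 1 r, 0 ≤ a j)
    (ha1 : ∑ j ∈ Finset.Icc 1 r, a j = 1) (hB : 0 ≤ B) (hN : N + r = n + 1)
    {e v s : ℕ → ℝ} (he : ∀ i, 0 ≤ e i) (hterm : ∀ k, k ≤ n → n < k + r → e k ≤ B)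
    (hrec : ∀ i < N, e i + v i ≤ ∑ j ∈ Finset.Icc 1 r, a j * e (i + j) + s i) {i : ℕ}
    (hi : i ≤ N) :
    e i + ∑ k ∈ Finset.Ico i N, v k ≤ (r + 1) * B + ∑ k ∈ Finset.Ico i N, s k := by
  rcases hi.eq_or_lt with rfl | hlt
  · by_cases hr : r = 0
    · subst hr
      simp at ha1
    · have := hterm i (by omega) (by omega)
      simp only [Finset.Ico_self, Finset.sum_empty, add_zero]
      have : 0 ≤ (r : ℝ) * B := by positivity
      linarith
  -- A potential whose decrement from i to i + 1 is exactly e i - ∑ a_j e (i + j), because the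
  -- weights sum to 1. It dominates e i, and at N it only involves terminal values.
  let Φ : ℕ → ℝ := fun i => ∑ j ∈ Finset.Icc 1 r, a j * ∑ k ∈ Finset.range j, e (i + k)
  have hΦ : ∀ i, Φ i - Φ (i + 1) = e i - ∑ j ∈ Finset.Icc 1 r, a j * e (i + j) := by
    intro i
    have h1 : ∀ j, ∑ k ∈ Finset.range j, e (i + k) - ∑ k ∈ Finset.range j, e (i + 1 + k)
        = e i - e (i + j) := by
      intro j
      rw [← Finset.sum_sub_distrib]
      have := Finset.sum_range_sub' (fun k => e (i + k)) j
      simpa [add_assoc, add_comm 1] using this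
    have h2 : e i = ∑ j ∈ Finset.Icc 1 r, a j * e i := by rw [← Finset.sum_mul, ha1, one_mul]
    simp only [Φ]
    rw [h2, ← Finset.sum_sub_distrib, ← Finset.sum_sub_distrib]
    refine Finset.sum_congr rfl fun j _ => ?_
    rw [← mul_sub, h1, mul_sub]
  have hΦe : e i ≤ Φ i := by
    calc e i = ∑ j ∈ Finset.Icc 1 r, a j * e i := by rw [← Finset.sum_mul, ha1, one_mul]
      _ ≤ Φ i := by
        refine Finset.sum_le_sum fun j hj => mul_le_mul_of_nonneg_left ?_ (ha j hj)
        have h0 : 0 ∈ Finset.range j :=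
          Finset.mem_range.2 (by have := (Finset.mem_Icc.1 hj).1; omega)
        exact Finset.single_le_sum (f := fun k => e (i + k)) (fun k _ => he _) h0
  have hΦN : Φ N ≤ r * B := by
    calc Φ N ≤ ∑ j ∈ Finset.Icc 1 r, a j * (r * B) := by
          refine Finset.sum_le_sum fun j hj => mul_le_mul_of_nonneg_left ?_ (ha j hj)
          have hj := Finset.mem_Icc.1 hj
          calc ∑ k ∈ Finset.range j, e (N + k) ≤ ∑ k ∈ Finset.range j, B :=
                Finset.sum_le_sum fun k hk => by
                  have := Finset.mem_range.1 hk
                  exact hterm _ (by omega) (by omega)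
            _ = j * B := by simp
            _ ≤ r * B := mul_le_mul_of_nonneg_right (by exact_mod_cast hj.2) hB
      _ = r * B := by rw [← Finset.sum_mul, ha1, one_mul]
  have htel : ∑ k ∈ Finset.Ico i N, (Φ k - Φ (k + 1)) = Φ i - Φ N := by
    rw [← neg_sub (Φ N), ← Finset.sum_Ico_sub Φ hi, ← Finset.sum_neg_distrib]
    exact Finset.sum_congr rfl fun k _ => by ring
  have hsum : ∑ k ∈ Finset.Ico i N, (Φ k - Φ (k + 1)) + ∑ k ∈ Finset.Ico i N, v k
      ≤ ∑ k ∈ Finset.Ico i N, s k := by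
    rw [← Finset.sum_add_distrib]
    refine Finset.sum_le_sum fun k hk => ?_
    have := hrec k (Finset.mem_Ico.1 hk).2
    rw [hΦ]
    linarith
  linarith

/-- A backward discrete Gronwall lemma. -/
lemma add_le_exp_of_backward {e : ℕ → ℝ} {c : ℝ} (hc : 0 ≤ c) (hB : 0 ≤ B)
    (hh : ∀ i < N, 0 < h i) (hsmall : ∀ i < N, c * h i ≤ 1 / 2) (he : ∀ i, 0 ≤ e i)
    (hrec : ∀ i < N, e i ≤ c * (∑ k ∈ Finset.Ico i N, h k * e k + B)) {i : ℕ} (hi : i ≤ N) :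
    ∑ k ∈ Finset.Ico i N, h k * e k + B
      ≤ Real.exp (2 * c * ∑ k ∈ Finset.Ico i N, h k) * B := by
  induction hd : N - i generalizing i with
  | zero =>
    obtain rfl : i = N := by omega
    simp
  | succ l ih =>
    have hlt : i < N := by omega
    have ih := ih (i := i + 1) (by omega) (by omega)
    rw [Finset.sum_eq_sum_Ico_succ_bot hlt h]
    have hR := Finset.sum_eq_sum_Ico_succ_bot hlt (fun k => h k * e k)
    have hr := hrec i hlt
    set R := ∑ k ∈ Finset.Ico i N, h k * e k + B with hRdef
    have hR0 : 0 ≤ R := add_nonneg (Finset.sum_nonneg fun k hk =>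
      mul_nonneg (hh k (Finset.mem_Ico.1 hk).2).le (he k)) hB
    have hhi := hh i hlt
    have hsm := hsmall i hlt
    have h1 : R ≤ c * h i * R + (∑ k ∈ Finset.Ico (i + 1) N, h k * e k + B) := by
      have := mul_le_mul_of_nonneg_left hr hhi.le
      nlinarith
    have hx0 : 0 ≤ c * h i := mul_nonneg hc hhi.le
    have h2 : R ≤ Real.exp (2 * (c * h i)) * (∑ k ∈ Finset.Ico (i + 1) N, h k * e k + B) := by
      have hexp : 1 + 2 * (c * h i) ≤ Real.exp (2 * (c * h i)) := by
        linarith [Real.add_one_le_exp (2 * (c * h i))]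
      -- This is 1/(1 - x) ≤ 1 + 2x for 0 ≤ x ≤ 1/2, with x = c h_i.
      have h3 : R ≤ (1 + 2 * (c * h i)) * ((1 - c * h i) * R) := by
        have := mul_nonneg (mul_nonneg hx0 (by linarith : 0 ≤ 1 - 2 * (c * h i))) hR0
        nlinarith
      have h4 : (1 - c * h i) * R ≤ ∑ k ∈ Finset.Ico (i + 1) N, h k * e k + B := by linarith
      have h5 : 0 ≤ (1 - c * h i) * R := mul_nonneg (by linarith) hR0
      exact h3.trans (mul_le_mul hexp h4 h5 (Real.exp_pos _).le)
    refine h2.trans ((mul_le_mul_of_nonneg_left ih (Real.exp_pos _).le).trans (le_of_eq ?_))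
    rw [← mul_assoc, ← Real.exp_add]
    ring_nf

set_option maxHeartbeats 1000000 in
/-- Stability of the multi-step recursion: the mean square errors `e`, `w` are controlled by the
truncation errors `p`, `q` and the terminal errors, all bounded by `B`. -/
theorem exists_recursion_bound (r : ℕ) (hr : 1 ≤ r) (κ K T : ℝ) (hκ : 1 ≤ κ) (hK : 1 ≤ K) :
    ∃ C δ : ℝ, 0 < C ∧ 0 < δ ∧ ∀ (n N : ℕ) (h e w p q v a : ℕ → ℝ) (B ρ : ℝ),
      N + r = n + 1 →
      (∀ j ∈ Finset.Icc 1 r, 0 ≤ a j) → ∑ j ∈ Finset.Icc 1 r, a j = 1 →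
      (∀ i < n, 0 < h i) → (∀ i < n, h i ≤ ρ) → ρ ≤ δ → 0 ≤ ρ →
      ∑ i ∈ Finset.range n, h i ≤ T →
      (∀ i, i + 1 < n → h i ≤ κ * h (i + 1)) →
      (∀ i, 0 ≤ e i) → (∀ i, 0 ≤ w i) → (∀ i, 0 ≤ p i) → (∀ i, 0 ≤ q i) → (∀ i < N, 0 ≤ v i) →
      0 ≤ B →
      (∀ k, k ≤ n → n < k + r → e k ≤ B ∧ ρ * w k ≤ B) →
      ∑ i ∈ Finset.range N, h i * (p i / h i ^ 2 + q i) ≤ B →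
      (∀ i < N, ∀ ε : ℝ, 0 < ε →
        e i ≤ (1 + ε * h i) * (∑ j ∈ Finset.Icc 1 r, a j * e (i + j) - v i)
          + (1 + 1 / (ε * h i)) * (K * (h i ^ 2 * ∑ j ∈ Finset.range (r + 1), e (i + j)
            + h i ^ 2 * ∑ j ∈ Finset.range (r + 1), w (i + j) + h i ^ 2 * q i + p i))) →
      (∀ i < N, h i * w i ≤ K * (v i + h i ^ 2 * ∑ j ∈ Finset.range (r + 1), e (i + j)
            + h i ^ 2 * ∑ j ∈ Finset.range (r + 1), w (i + j) + h i * q i)) →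
      (∀ i ≤ n, e i ≤ C * B) ∧ ∑ i ∈ Finset.range n, h i * w i ≤ C * B := by
  set M : ℝ := (r + 1) * (κ ^ r + r) with hM
  have hκr : 1 ≤ κ ^ r := one_le_pow₀ hκ
  have hr0 : (0 : ℝ) ≤ r := Nat.cast_nonneg r
  have hM1 : 1 ≤ M := by rw [hM]; nlinarith
  -- Chosen so that (2K/ε) M = 1/(8K): once ∑ h w is replaced by 4K ∑ v plus other terms, ∑ v
  -- returns with coefficient 1/2 and is absorbed.
  set ε : ℝ := 16 * K ^ 2 * M with hε
  have hε1 : 1 ≤ ε := by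
    have h1 : 1 ≤ K ^ 2 := one_le_pow₀ hK
    have h2 : 1 ≤ K ^ 2 * M := one_le_mul_of_one_le_of_one_le h1 hM1
    rw [hε, mul_assoc]
    linarith
  -- The summands account for the terminal values, the windows of e, the remainder of the absorbed
  -- w-terms, and the truncation errors.
  set c : ℝ := (r + 1) + (ε + 2 * K) * M + 1 + 2 * K with hc
  have hc1 : 1 ≤ c := by
    have : 0 ≤ (ε + 2 * K) * M := by positivity
    rw [hc]; linarith
  set E : ℝ := Real.exp (2 * c * T) with hE
  have hE0 : 0 < E := Real.exp_pos _
  -- In C, the terms 1 and c E serve the values of e, at terminal and earlier indices; the other two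
  -- serve ∑ h w, with r for its terminal part. The thresholds in δ allow, in order, to absorb ∑ h w
  -- into itself, to bound 1 + 1/(ε h) by 2/(ε h), to apply Gronwall, and to use ρ e ≤ e at the
  -- terminal indices.
  refine ⟨1 + c * E + 4 * K * ((2 * c + 1) * E) + r,
    min (1 / (2 * K * M)) (min (1 / ε) (min (1 / (2 * c)) 1)),
    by positivity, by positivity, ?_⟩
  intro n N h e w p q v a B ρ hN ha ha1 hh hρ hρδ hρ0 hT hratio he hw hp hq hv hB hterm hpq hI hII
  have hρ1 : 2 * K * M * ρ ≤ 1 := by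
    have := hρδ.trans (min_le_left _ _)
    rwa [le_div_iff₀ (by positivity), mul_comm] at this
  have hρ2 : ε * ρ ≤ 1 := by
    have := hρδ.trans ((min_le_right _ _).trans (min_le_left _ _))
    rwa [le_div_iff₀ (by positivity), mul_comm] at this
  have hρ3 : 2 * c * ρ ≤ 1 := by
    have := hρδ.trans ((min_le_right _ _).trans ((min_le_right _ _).trans (min_le_left _ _)))
    rwa [le_div_iff₀ (by positivity), mul_comm] at this
  have hρ4 : ρ ≤ 1 :=
    hρδ.trans ((min_le_right _ _).trans ((min_le_right _ _).trans (min_le_right _ _)))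
  have hNn : N ≤ n := by omega
  have hhN : ∀ i < N, 0 < h i := fun i hi => hh i (by omega)
  have hρN : ∀ i < N, h i ≤ ρ := fun i hi => hρ i (by omega)
  set G : ℕ → ℝ := fun i => ∑ j ∈ Finset.range (r + 1), e (i + j) with hG
  set W : ℕ → ℝ := fun i => ∑ j ∈ Finset.range (r + 1), w (i + j) with hWdef
  set η : ℕ → ℝ := fun i => h i * (p i / h i ^ 2 + q i) with hη
  have hG0 : ∀ i, 0 ≤ G i := fun i => Finset.sum_nonneg fun j _ => he _
  have hW0 : ∀ i, 0 ≤ W i := fun i => Finset.sum_nonneg fun j _ => hw _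
  have hη0 : ∀ i < N, 0 ≤ η i := fun i hi => by
    have := hhN i hi
    have := hp i
    have := hq i
    positivity
  have hηB : ∀ i, ∑ k ∈ Finset.Ico i N, η k ≤ B := by
    intro i
    refine le_trans (Finset.sum_le_sum_of_subset_of_nonneg (fun k hk => ?_) fun k hk _ => ?_) hpq
    · exact Finset.mem_range.2 (Finset.mem_Ico.1 hk).2
    · exact hη0 k (Finset.mem_range.1 hk)
  -- the pointwise recursions with the chosen `ε`
  have hrec : ∀ i < N, e i + v i ≤ ∑ j ∈ Finset.Icc 1 r, a j * e (i + j)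
      + ((ε + 2 * K) * (h i * G i) + 2 * K / ε * (h i * W i) + 2 * K * η i) := by
    intro i hi
    have hhi := hhN i hi
    have hεh : ε * h i ≤ 1 := (mul_le_mul_of_nonneg_left (hρN i hi) (by positivity)).trans hρ2
    have hS : ∑ j ∈ Finset.Icc 1 r, a j * e (i + j) ≤ G i := by
      refine (Finset.sum_le_sum (g := fun j => e (i + j)) fun j hj => ?_).trans
        (Finset.sum_le_sum_of_subset_of_nonneg (fun j hj => ?_) fun j _ _ => he _)
      · refine mul_le_of_le_one_left (he _) ?_
        rw [← ha1]
        exact Finset.single_le_sum ha hj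
      · exact Finset.mem_range.2 (by have := (Finset.mem_Icc.1 hj).2; omega)
    have h1 : e i ≤ (1 + ε * h i) * (∑ j ∈ Finset.Icc 1 r, a j * e (i + j) - v i)
        + (1 + 1 / (ε * h i)) * (K * (h i ^ 2 * G i + h i ^ 2 * W i + h i ^ 2 * q i + p i)) :=
      hI i hi ε (by positivity)
    have h2 : 1 + 1 / (ε * h i) ≤ 2 / (ε * h i) := by
      have : 1 ≤ 1 / (ε * h i) := by rw [le_div_iff₀ (by positivity)]; linarith
      have h3 : 2 / (ε * h i) = 1 / (ε * h i) + 1 / (ε * h i) := by ring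
      linarith
    have h3 : 0 ≤ K * (h i ^ 2 * G i + h i ^ 2 * W i + h i ^ 2 * q i + p i) := by
      have := hG0 i
      have := hW0 i
      have := hq i
      have := hp i
      positivity
    have h4 := mul_le_mul_of_nonneg_right h2 h3
    have h5 : 2 / (ε * h i) * (K * (h i ^ 2 * G i + h i ^ 2 * W i + h i ^ 2 * q i + p i))
        = 2 * K / ε * (h i * G i) + 2 * K / ε * (h i * W i) + 2 * K / ε * η i := by
      simp only [hη]
      field_simp
      ring
    have h6 : 2 * K / ε ≤ 2 * K := div_le_self (by positivity) hε1
    have h7 := mul_le_mul_of_nonneg_right h6 (mul_nonneg hhi.le (hG0 i))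
    have h8 := mul_le_mul_of_nonneg_right h6 (hη0 i hi)
    have h9 : 0 ≤ ε * h i * v i := mul_nonneg (by positivity) (hv i hi)
    have h10 := mul_le_mul_of_nonneg_left hS (by positivity : 0 ≤ ε * h i)
    have h11 : (1 + ε * h i) * (∑ j ∈ Finset.Icc 1 r, a j * e (i + j) - v i)
        = ∑ j ∈ Finset.Icc 1 r, a j * e (i + j) - v i
          + ε * h i * ∑ j ∈ Finset.Icc 1 r, a j * e (i + j) - ε * h i * v i := by ring
    have h12 : (ε + 2 * K) * (h i * G i) = ε * h i * G i + 2 * K * (h i * G i) := by ring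
    linarith
  have hrecw : ∀ i < N, h i * w i ≤ K * v i + K * ρ * (h i * G i) + K * ρ * (h i * W i)
      + K * η i := by
    intro i hi
    have hhi := hhN i hi
    have h1 : h i * w i ≤ K * (v i + h i ^ 2 * G i + h i ^ 2 * W i + h i * q i) := hII i hi
    have h2 : h i ^ 2 * G i ≤ ρ * (h i * G i) := by
      rw [sq, mul_assoc]
      exact mul_le_mul_of_nonneg_right (hρN i hi) (mul_nonneg hhi.le (hG0 i))
    have h3 : h i ^ 2 * W i ≤ ρ * (h i * W i) := by
      rw [sq, mul_assoc]
      exact mul_le_mul_of_nonneg_right (hρN i hi) (mul_nonneg hhi.le (hW0 i))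
    have h4 : h i * q i ≤ η i := by
      simp only [hη]
      exact mul_le_mul_of_nonneg_left (le_add_of_nonneg_left (div_nonneg (hp i) (sq_nonneg _)))
        hhi.le
    refine h1.trans ?_
    have h5 : v i + h i ^ 2 * G i + h i ^ 2 * W i + h i * q i
        ≤ v i + ρ * (h i * G i) + ρ * (h i * W i) + η i := by linarith
    refine (mul_le_mul_of_nonneg_left h5 (by positivity)).trans (le_of_eq ?_)
    ring
  -- the summed recursions
  have hmain : ∀ i ≤ N,
      ∑ k ∈ Finset.Ico i N, h k * w k ≤ 4 * K * (∑ k ∈ Finset.Ico i N, v k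
        + ∑ k ∈ Finset.Ico i N, h k * e k + B) ∧
      e i + (∑ k ∈ Finset.Ico i N, v k) / 2 ≤ c * (∑ k ∈ Finset.Ico i N, h k * e k + B) := by
    intro i hi
    have hsum := add_sum_le_of_multistep ha ha1 hB hN he (fun k h1 h2 => (hterm k h1 h2).1)
      hrec hi
    have hsumw : ∑ k ∈ Finset.Ico i N, h k * w k ≤ ∑ k ∈ Finset.Ico i N,
        (K * v k + K * ρ * (h k * G k) + K * ρ * (h k * W k) + K * η k) :=
      Finset.sum_le_sum fun k hk => hrecw k (Finset.mem_Ico.1 hk).2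
    simp only [Finset.sum_add_distrib, ← Finset.mul_sum] at hsum hsumw
    have hwG := sum_step_mul_window_le hκ hB hN hr hratio hh hρ he
      (fun k h1 h2 => (mul_le_of_le_one_left (he k) hρ4).trans (hterm k h1 h2).1) hi
    have hwW := sum_step_mul_window_le hκ hB hN hr hratio hh hρ hw
      (fun k h1 h2 => (hterm k h1 h2).2) hi
    have hηi := hηB i
    have hV0 : 0 ≤ ∑ k ∈ Finset.Ico i N, v k :=
      Finset.sum_nonneg fun k hk => hv k (Finset.mem_Ico.1 hk).2
    have hQ0 : 0 ≤ ∑ k ∈ Finset.Ico i N, h k * e k := Finset.sum_nonneg fun k hk =>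
      mul_nonneg (hhN k (Finset.mem_Ico.1 hk).2).le (he k)
    have hΩ0 : 0 ≤ ∑ k ∈ Finset.Ico i N, h k * w k := Finset.sum_nonneg fun k hk =>
      mul_nonneg (hhN k (Finset.mem_Ico.1 hk).2).le (hw k)
    rw [← hM] at hwG hwW
    change ∑ k ∈ Finset.Ico i N, h k * G k ≤ _ at hwG
    change ∑ k ∈ Finset.Ico i N, h k * W k ≤ _ at hwW
    set SG := ∑ k ∈ Finset.Ico i N, h k * G k
    set SW := ∑ k ∈ Finset.Ico i N, h k * W k
    set V := ∑ k ∈ Finset.Ico i N, v k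
    set Q := ∑ k ∈ Finset.Ico i N, h k * e k
    set Ω := ∑ k ∈ Finset.Ico i N, h k * w k
    set H := ∑ k ∈ Finset.Ico i N, η k
    -- The small mesh makes the w-window contribute at most half of Ω, which is absorbed on the
    -- left.
    have hΩ : Ω ≤ 4 * K * (V + Q + B) := by
      have h1 : K * ρ * SG ≤ 1 / 2 * (Q + B) := by
        calc K * ρ * SG ≤ K * ρ * (M * (Q + B)) := mul_le_mul_of_nonneg_left hwG (by positivity)
          _ = (2 * K * M * ρ) * (1 / 2 * (Q + B)) := by ring
          _ ≤ 1 * (1 / 2 * (Q + B)) := mul_le_mul_of_nonneg_right hρ1 (by positivity)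
          _ = _ := one_mul _
      have h2 : K * ρ * SW ≤ 1 / 2 * (Ω + B) := by
        calc K * ρ * SW ≤ K * ρ * (M * (Ω + B)) := mul_le_mul_of_nonneg_left hwW (by positivity)
          _ = (2 * K * M * ρ) * (1 / 2 * (Ω + B)) := by ring
          _ ≤ 1 * (1 / 2 * (Ω + B)) := mul_le_mul_of_nonneg_right hρ1 (by positivity)
          _ = _ := one_mul _
      have h3 : K * H ≤ K * B := mul_le_mul_of_nonneg_left hηi (by positivity)
      have h4 : Q ≤ K * Q := le_mul_of_one_le_left hQ0 hK
      have h5 : B ≤ K * B := le_mul_of_one_le_left hB hK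
      have h6 : 0 ≤ K * V := by positivity
      have h7 : 0 ≤ K * Q := by positivity
      linarith
    refine ⟨hΩ, ?_⟩
    have h1 : (ε + 2 * K) * SG ≤ (ε + 2 * K) * M * (Q + B) := by
      rw [mul_assoc]
      exact mul_le_mul_of_nonneg_left hwG (by positivity)
    have h2 : 2 * K / ε * SW ≤ 1 / 2 * (V + Q + B) + 1 / 2 * B := by
      have h3 : 2 * K / ε * M = 1 / (8 * K) := by
        rw [hε]
        field_simp
        norm_num
      calc 2 * K / ε * SW ≤ 2 * K / ε * (M * (Ω + B)) :=
            mul_le_mul_of_nonneg_left hwW (by positivity)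
        _ = 1 / (8 * K) * (Ω + B) := by rw [← mul_assoc, h3]
        _ ≤ 1 / (8 * K) * (4 * K * (V + Q + B) + 4 * K * B) := by
            refine mul_le_mul_of_nonneg_left (add_le_add hΩ ?_) (by positivity)
            exact le_mul_of_one_le_left hB (by linarith)
        _ = _ := by field_simp; ring
    have h3 : 2 * K * H ≤ 2 * K * B := mul_le_mul_of_nonneg_left hηi (by positivity)
    have h4 : c * (Q + B) = (r + 1) * (Q + B) + (ε + 2 * K) * M * (Q + B) + (Q + B)
        + 2 * K * (Q + B) := by rw [hc]; ring
    have h5 : 0 ≤ (r : ℝ) * Q := by positivity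
    have h6 : 0 ≤ K * Q := by positivity
    linarith
  -- the discrete Gronwall inequality
  have hgron : ∀ i ≤ N, ∑ k ∈ Finset.Ico i N, h k * e k + B ≤ E * B := by
    intro i hi
    have hrec' : ∀ i < N, e i ≤ c * (∑ k ∈ Finset.Ico i N, h k * e k + B) := by
      intro i hi
      have h1 := (hmain i hi.le).2
      have h2 : 0 ≤ ∑ k ∈ Finset.Ico i N, v k :=
        Finset.sum_nonneg fun k hk => hv k (Finset.mem_Ico.1 hk).2
      linarith
    have hg := add_le_exp_of_backward (by linarith : 0 ≤ c) hB hhN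
      (fun i hi => by
        have := mul_le_mul_of_nonneg_left (hρN i hi) (by linarith : 0 ≤ c)
        linarith) he hrec' hi
    refine hg.trans (mul_le_mul_of_nonneg_right (Real.exp_le_exp.2 ?_) hB)
    refine mul_le_mul_of_nonneg_left (le_trans ?_ hT) (by positivity)
    refine Finset.sum_le_sum_of_subset_of_nonneg (fun k hk => ?_) fun k hk _ => ?_
    · have := (Finset.mem_Ico.1 hk).2
      exact Finset.mem_range.2 (by omega)
    · exact (hh k (Finset.mem_range.1 hk)).le
  have hEB : 0 ≤ E * B := by positivity
  have hcEB : 0 ≤ c * (E * B) := by positivity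
  have hKEB : 0 ≤ 4 * K * ((2 * c + 1) * (E * B)) := by positivity
  have hrB : 0 ≤ r * B := by positivity
  have hCB : (1 + c * E + 4 * K * ((2 * c + 1) * E) + r) * B
      = B + c * (E * B) + 4 * K * ((2 * c + 1) * (E * B)) + r * B := by ring
  rw [hCB]
  constructor
  · intro i hi
    rcases lt_or_ge i N with hiN | hiN
    · have h1 := (hmain i hiN.le).2
      have h2 := mul_le_mul_of_nonneg_left (hgron i hiN.le) (by linarith : 0 ≤ c)
      have h3 : 0 ≤ ∑ k ∈ Finset.Ico i N, v k :=
        Finset.sum_nonneg fun k hk => hv k (Finset.mem_Ico.1 hk).2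
      linarith
    · have := (hterm i hi (by omega)).1
      linarith
  · rw [Finset.range_eq_Ico, ← Finset.sum_Ico_consecutive _ (Nat.zero_le N) hNn]
    have h1 := hmain 0 (Nat.zero_le N)
    have h2 := hgron 0 (Nat.zero_le N)
    have h3 := mul_le_mul_of_nonneg_left h2 (by linarith : 0 ≤ c)
    have h4 : ∑ k ∈ Finset.Ico 0 N, v k ≤ 2 * c * (E * B) := by
      have := he 0
      linarith [h1.2]
    have h5 : ∑ k ∈ Finset.Ico 0 N, h k * w k ≤ 4 * K * ((2 * c + 1) * (E * B)) :=
      h1.1.trans (mul_le_mul_of_nonneg_left (by linarith) (by positivity))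
    -- All these indices are terminal. Only the bound on ρ w is available there, and h ≤ ρ is
    -- enough.
    have h6 : ∑ k ∈ Finset.Ico N n, h k * w k ≤ r * B := by
      calc ∑ k ∈ Finset.Ico N n, h k * w k ≤ ∑ k ∈ Finset.Ico N n, B :=
            Finset.sum_le_sum fun k hk => by
              have hk := Finset.mem_Ico.1 hk
              exact (mul_le_mul_of_nonneg_right (hρ k hk.2) (hw k)).trans
                (hterm k hk.2.le (by omega)).2
        _ = ((n - N : ℕ) : ℝ) * B := by simp
        _ ≤ r * B := mul_le_mul_of_nonneg_right (by exact_mod_cast (by omega)) hB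
    linarith

end Recursion


/-! ### One step of the scheme: error inequalities for Y and for Z. -/

section OneStep

variable {Ω : Type*} {m mΩ : MeasurableSpace Ω} {μ : Measure Ω} [IsProbabilityMeasure μ] {d : ℕ}
  {f : ℝ → Vec d → ℝ} {L : NNReal} {r : ℕ} {a b α β : ℕ → ℝ} {h b₀ Λ : ℝ}
  {y y' : ℕ → Ω → ℝ} {z z' : ℕ → Ω → Vec d} {y₀ yc yh : Ω → ℝ} {z₀ zc zh : Ω → Vec d}

/-- The explicit part of the `Y`-step of the scheme. -/
def explicitPart (f : ℝ → Vec d → ℝ) (r : ℕ) (a b : ℕ → ℝ) (h : ℝ) (y : ℕ → Ω → ℝ)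
    (z : ℕ → Ω → Vec d) (ω : Ω) : ℝ :=
  ∑ j ∈ Finset.Icc 1 r, a j * y j ω + h * ∑ j ∈ Finset.Icc 1 r, b j * f (y j ω) (z j ω)

lemma memLp_explicitPart (hf : LipschitzWith L (fun p : ℝ × Vec d => f p.1 p.2))
    (hy : ∀ j ∈ Finset.Icc 1 r, MemLp (y j) 2 μ) (hz : ∀ j ∈ Finset.Icc 1 r, MemLp (z j) 2 μ) :
    MemLp (explicitPart f r a b h y z) 2 μ :=
  (memLp_finsetSum _ fun j hj => (hy j hj).const_mul (a j)).add
    ((memLp_finsetSum _ fun j hj =>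
      (memLp_comp_of_lipschitz hf (hy j hj) (hz j hj)).const_mul (b j)).const_mul h)

/-- The two implicit equations are subtracted: the error is the conditional expectation of the
a-combination of later errors, plus a remainder made of h times driver differences and the local
error y₀ - yc. The implicit driver difference compares yc with yh and is split through y₀, so the
current errors reappear on the right; h ≤ 1 lets h² times the local Y-error be counted as that
error. The Young parameter x stays free for a later choice proportional to the step. -/
theorem Y_step_bound (hm : m ≤ mΩ) (hf : LipschitzWith L (fun p : ℝ × Vec d => f p.1 p.2))
    (ha : ∀ j ∈ Finset.Icc 1 r, 0 ≤ a j) (ha1 : ∑ j ∈ Finset.Icc 1 r, a j = 1)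
    (hb : ∀ j ∈ Finset.Icc 1 r, |b j| ≤ Λ) (hb₀ : |b₀| ≤ Λ) (hh : 0 < h) (hh1 : h ≤ 1)
    (hy : ∀ j ∈ Finset.Icc 1 r, MemLp (y j) 2 μ) (hz : ∀ j ∈ Finset.Icc 1 r, MemLp (z j) 2 μ)
    (hy' : ∀ j ∈ Finset.Icc 1 r, MemLp (y' j) 2 μ)
    (hz' : ∀ j ∈ Finset.Icc 1 r, MemLp (z' j) 2 μ)
    (hy₀ : MemLp y₀ 2 μ) (hyc : MemLp yc 2 μ) (hyh : MemLp yh 2 μ)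
    (hz₀ : MemLp z₀ 2 μ) (hzc : MemLp zc 2 μ) (hzh : MemLp zh 2 μ)
    (hzcm : AEStronglyMeasurable[m] zc μ) (hzhm : AEStronglyMeasurable[m] zh μ)
    (hc : yc =ᵐ[μ] μ[fun ω => explicitPart f r a b h y z ω + h * b₀ * f (yc ω) (zc ω) | m])
    (hh' : yh =ᵐ[μ] μ[fun ω => explicitPart f r a b h y' z' ω + h * b₀ * f (yh ω) (zh ω) | m])
    {x : ℝ} (hx : 0 < x) :
    ∫ ω, ‖y₀ ω - yh ω‖ ^ 2 ∂μ ≤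
      (1 + x) * (∑ j ∈ Finset.Icc 1 r, a j * ∫ ω, (μ[y j - y' j | m]) ω ^ 2 ∂μ)
      + (1 + 1 / x) * ((4 * r * Λ ^ 2 * L ^ 2 + 16 * Λ ^ 2 * L ^ 2 + 4) *
        (h ^ 2 * (∑ j ∈ Finset.Icc 1 r,
            (∫ ω, ‖y j ω - y' j ω‖ ^ 2 ∂μ + ∫ ω, ‖z j ω - z' j ω‖ ^ 2 ∂μ)
          + (∫ ω, ‖y₀ ω - yh ω‖ ^ 2 ∂μ + ∫ ω, ‖z₀ ω - zh ω‖ ^ 2 ∂μ))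
          + h ^ 2 * ∫ ω, ‖z₀ ω - zc ω‖ ^ 2 ∂μ + ∫ ω, ‖y₀ ω - yc ω‖ ^ 2 ∂μ)) := by
  set J := Finset.Icc 1 r with hJ
  have hG := memLp_explicitPart (a := a) (b := b) (h := h) hf hy hz
  have hG' := memLp_explicitPart (a := a) (b := b) (h := h) hf hy' hz'
  have hF : ∀ j ∈ J, MemLp (fun ω => f (y j ω) (z j ω) - f (y' j ω) (z' j ω)) 2 μ := fun j hj =>
    (memLp_comp_of_lipschitz hf (hy j hj) (hz j hj)).sub
      (memLp_comp_of_lipschitz hf (hy' j hj) (hz' j hj))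
  set S : Ω → ℝ := fun ω => ∑ j ∈ J, b j * (f (y j ω) (z j ω) - f (y' j ω) (z' j ω)) with hS
  have hSL : MemLp S 2 μ := memLp_finsetSum J fun j hj => (hF j hj).const_mul (b j)
  set F₀ : Ω → ℝ := fun ω => f (yc ω) (zc ω) - f (yh ω) (zh ω) with hF₀
  have hfc := memLp_comp_of_lipschitz hf hyc hzc
  have hfh := memLp_comp_of_lipschitz hf hyh hzh
  have hF₀L : MemLp F₀ 2 μ := hfc.sub hfh
  have hU : ∀ j ∈ J, MemLp (y j - y' j) 2 μ := fun j hj => (hy j hj).sub (hy' j hj)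
  have hUS : MemLp (fun ω => ∑ j ∈ J, a j * (y j - y' j) ω) 2 μ :=
    memLp_finsetSum J fun j hj => (hU j hj).const_mul (a j)
  have hES := memLp_two_condExp (m := m) hSL
  have hP : MemLp (fun ω => h * b₀ * F₀ ω + (y₀ ω - yc ω)) 2 μ :=
    (hF₀L.const_mul (h * b₀)).add (hy₀.sub hyc)
  have hR : MemLp (fun ω => h * (μ[S | m]) ω + (h * b₀ * F₀ ω + (y₀ ω - yc ω))) 2 μ :=
    (hES.const_mul h).add hP
  have e1 := implicit_eq_of_integrable hm hf (hG.integrable (by norm_num)) hzcm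
    ((hfc.integrable (by norm_num)).const_mul (h * b₀)) hc
  have e2 := implicit_eq_of_integrable hm hf (hG'.integrable (by norm_num)) hzhm
    ((hfh.integrable (by norm_num)).const_mul (h * b₀)) hh'
  have e3 := condExp_sub (hG.integrable (by norm_num)) (hG'.integrable (by norm_num)) m
  have hdiff : explicitPart f r a b h y z - explicitPart f r a b h y' z'
      = (fun ω => ∑ j ∈ J, a j * (y j - y' j) ω) + h • S := by
    ext ω
    simp only [explicitPart, Pi.sub_apply, Pi.add_apply, Pi.smul_apply, smul_eq_mul, hS, mul_sub,
      Finset.sum_sub_distrib, hJ]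
    ring
  rw [hdiff] at e3
  have e4 := condExp_add (hUS.integrable (by norm_num))
    ((hSL.integrable (by norm_num)).smul h) m
  have e5 := condExp_smul h S m (μ := μ)
  have hV : (fun ω => y₀ ω - yh ω) =ᵐ[μ]
      fun ω => (μ[fun ω => ∑ j ∈ J, a j * (y j - y' j) ω | m]) ω
        + (h * (μ[S | m]) ω + (h * b₀ * F₀ ω + (y₀ ω - yc ω))) := by
    filter_upwards [e1, e2, e3, e4, e5] with ω h1 h2 h3 h4 h5
    rw [Pi.sub_apply] at h3
    rw [h3, Pi.add_apply, h5, Pi.smul_apply, smul_eq_mul] at h4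
    simp only [hF₀]
    linarith
  have key := integral_sq_le_of_convex_step ha ha1 hU hR hV hx
  have hF2 : ∀ j ∈ J, ∫ ω, (f (y j ω) (z j ω) - f (y' j ω) (z' j ω)) ^ 2 ∂μ
      ≤ 2 * (L : ℝ) ^ 2 * (∫ ω, ‖y j ω - y' j ω‖ ^ 2 ∂μ + ∫ ω, ‖z j ω - z' j ω‖ ^ 2 ∂μ) :=
    fun j hj => integral_sub_sq_le_of_lipschitz hf (hy j hj) (hz j hj) (hy' j hj) (hz' j hj)
  have hSS : ∫ ω, S ω ^ 2 ∂μ ≤ r * (Λ ^ 2 * (2 * (L : ℝ) ^ 2 * ∑ j ∈ J,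
      (∫ ω, ‖y j ω - y' j ω‖ ^ 2 ∂μ + ∫ ω, ‖z j ω - z' j ω‖ ^ 2 ∂μ))) := by
    have h1 := integral_sum_sq_le (U := fun j ω => b j * (f (y j ω) (z j ω) - f (y' j ω) (z' j ω)))
      fun j hj => (hF j hj).const_mul (b j)
    have hcard : J.card = r := by simp [hJ]
    rw [hcard] at h1
    refine h1.trans (mul_le_mul_of_nonneg_left ?_ (Nat.cast_nonneg r))
    rw [Finset.mul_sum, Finset.mul_sum]
    refine Finset.sum_le_sum fun j hj => ?_
    simp only [mul_pow]
    rw [integral_const_mul]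
    refine mul_le_mul ?_ (hF2 j hj) (integral_nonneg fun ω => sq_nonneg _) (sq_nonneg _)
    rw [← sq_abs]
    exact pow_le_pow_left₀ (abs_nonneg _) (hb j hj) 2
  have hF₀2 : ∫ ω, F₀ ω ^ 2 ∂μ ≤ 2 * (L : ℝ) ^ 2 *
      (2 * ∫ ω, ‖y₀ ω - yh ω‖ ^ 2 ∂μ + 2 * ∫ ω, ‖y₀ ω - yc ω‖ ^ 2 ∂μ
        + (2 * ∫ ω, ‖z₀ ω - zh ω‖ ^ 2 ∂μ + 2 * ∫ ω, ‖z₀ ω - zc ω‖ ^ 2 ∂μ)) := by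
    refine (integral_sub_sq_le_of_lipschitz hf hyc hzc hyh hzh).trans
      (mul_le_mul_of_nonneg_left (add_le_add ?_ ?_) (by positivity))
    · exact integral_norm_sub_sq_le hy₀ hyc hyh
    · exact integral_norm_sub_sq_le hz₀ hzc hzh
  have hRR : ∫ ω, (h * (μ[S | m]) ω + (h * b₀ * F₀ ω + (y₀ ω - yc ω))) ^ 2 ∂μ
      ≤ 2 * (h ^ 2 * ∫ ω, S ω ^ 2 ∂μ) + 2 * (2 * (h ^ 2 * (Λ ^ 2 * ∫ ω, F₀ ω ^ 2 ∂μ))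
        + 2 * ∫ ω, ‖y₀ ω - yc ω‖ ^ 2 ∂μ) := by
    have h1 := integral_norm_add_sq_le (hES.const_mul h) hP
    have h2 := integral_norm_add_sq_le (hF₀L.const_mul (h * b₀)) (hy₀.sub hyc)
    simp only [Real.norm_eq_abs, sq_abs, mul_pow] at h1 h2 ⊢
    rw [integral_const_mul] at h1 h2
    simp only [Pi.sub_apply] at h2
    have h3 := mul_le_mul_of_nonneg_left (integral_condExp_sq_le hm hSL) (sq_nonneg h)
    have h4 : h ^ 2 * b₀ ^ 2 * ∫ ω, F₀ ω ^ 2 ∂μ ≤ h ^ 2 * (Λ ^ 2 * ∫ ω, F₀ ω ^ 2 ∂μ) := by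
      rw [mul_assoc]
      refine mul_le_mul_of_nonneg_left (mul_le_mul_of_nonneg_right ?_
        (integral_nonneg fun ω => sq_nonneg _)) (sq_nonneg _)
      rw [← sq_abs]
      exact pow_le_pow_left₀ (abs_nonneg _) hb₀ 2
    linarith
  have hVn : ∫ ω, ‖y₀ ω - yh ω‖ ^ 2 ∂μ = ∫ ω, (y₀ ω - yh ω) ^ 2 ∂μ := by
    simp only [Real.norm_eq_abs, sq_abs]
  refine hVn.le.trans (key.trans (add_le_add_right (mul_le_mul_of_nonneg_left ?_
    (by positivity)) _))
  have hS0 : 0 ≤ ∑ j ∈ J,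
      (∫ ω, ‖y j ω - y' j ω‖ ^ 2 ∂μ + ∫ ω, ‖z j ω - z' j ω‖ ^ 2 ∂μ) :=
    Finset.sum_nonneg fun j _ => add_nonneg (integral_nonneg fun ω => sq_nonneg _)
      (integral_nonneg fun ω => sq_nonneg _)
  have n1 : 0 ≤ ∫ ω, ‖y₀ ω - yh ω‖ ^ 2 ∂μ := integral_nonneg fun ω => sq_nonneg _
  have n2 : 0 ≤ ∫ ω, ‖y₀ ω - yc ω‖ ^ 2 ∂μ := integral_nonneg fun ω => sq_nonneg _
  have n3 : 0 ≤ ∫ ω, ‖z₀ ω - zh ω‖ ^ 2 ∂μ := integral_nonneg fun ω => sq_nonneg _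
  have n4 : 0 ≤ ∫ ω, ‖z₀ ω - zc ω‖ ^ 2 ∂μ := integral_nonneg fun ω => sq_nonneg _
  have f1 := mul_le_mul_of_nonneg_left hSS (sq_nonneg h)
  have f2 := mul_le_mul_of_nonneg_left (mul_le_mul_of_nonneg_left hF₀2 (sq_nonneg Λ))
    (sq_nonneg h)
  refine hRR.trans ?_
  generalize ∑ j ∈ J,
    (∫ ω, ‖y j ω - y' j ω‖ ^ 2 ∂μ + ∫ ω, ‖z j ω - z' j ω‖ ^ 2 ∂μ) = A at *
  generalize ∫ ω, ‖y₀ ω - yh ω‖ ^ 2 ∂μ = e₀ at *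
  generalize ∫ ω, ‖y₀ ω - yc ω‖ ^ 2 ∂μ = p at *
  generalize ∫ ω, ‖z₀ ω - zh ω‖ ^ 2 ∂μ = w₀ at *
  generalize ∫ ω, ‖z₀ ω - zc ω‖ ^ 2 ∂μ = q at *
  have hh2 : h ^ 2 ≤ 1 := pow_le_one₀ hh.le hh1
  have c1 : 0 ≤ (r : ℝ) * Λ ^ 2 * L ^ 2 := by positivity
  have c2 : 0 ≤ Λ ^ 2 * (L : ℝ) ^ 2 := by positivity
  have g1 : 0 ≤ h ^ 2 * (e₀ + w₀ + q) := by positivity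
  have g2 : 0 ≤ h ^ 2 * A := by positivity
  have g3 := mul_nonneg c1 g1
  have g4 := mul_nonneg c1 n2
  have g5 := mul_nonneg c2 g2
  have g6 := mul_le_mul_of_nonneg_left (mul_le_mul_of_nonneg_right hh2 n2) c2
  linarith

/-- Multiplying by h cancels the 1/h in the second moment of the weights, leaving conditional
variances of the Y-errors. The domination of α_j² by a_j rewrites them with the weights a_j, so that
they match the quantity gained in the Y-step. -/
theorem Z_step_bound (hm : m ≤ mΩ) (hf : LipschitzWith L (fun p : ℝ × Vec d => f p.1 p.2))
    {c₀ Ka : ℝ} (hc₀ : 0 < c₀) (hKa : 0 ≤ Ka)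
    (ha : ∀ j ∈ Finset.Icc 1 r, 0 ≤ a j)
    (hα : ∀ j ∈ Finset.Icc 1 r, α j ^ 2 ≤ Ka * a j)
    (hβ : ∀ j ∈ Finset.Icc 1 r, |β j| ≤ Λ) (hh : 0 < h)
    {HY Hf : ℕ → Ω → Vec d}
    (hHY : ∀ j ∈ Finset.Icc 1 r, ∀ l, IsCenteredWeight μ m (c₀ / h) (fun ω => HY j ω l))
    (hHf : ∀ j ∈ Finset.Icc 1 r, ∀ l, IsCenteredWeight μ m (c₀ / h) (fun ω => Hf j ω l))
    (hy : ∀ j ∈ Finset.Icc 1 r, MemLp (y j) 2 μ) (hz : ∀ j ∈ Finset.Icc 1 r, MemLp (z j) 2 μ)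
    (hy' : ∀ j ∈ Finset.Icc 1 r, MemLp (y' j) 2 μ)
    (hz' : ∀ j ∈ Finset.Icc 1 r, MemLp (z' j) 2 μ)
    (hz₀ : MemLp z₀ 2 μ)
    (hc : zc =ᵐ[μ] μ[weightedSum (Finset.Icc 1 r) h α β HY Hf y
      (fun j ω => f (y j ω) (z j ω)) | m])
    (hh' : zh =ᵐ[μ] μ[weightedSum (Finset.Icc 1 r) h α β HY Hf y'
      (fun j ω => f (y' j ω) (z' j ω)) | m]) :
    h * ∫ ω, ‖z₀ ω - zh ω‖ ^ 2 ∂μ ≤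
      (4 * d * r * c₀ * Ka + 8 * d * r * c₀ * Λ ^ 2 * L ^ 2 + 2) *
        (∑ j ∈ Finset.Icc 1 r, a j *
            (∫ ω, ‖y j ω - y' j ω‖ ^ 2 ∂μ - ∫ ω, (μ[y j - y' j | m]) ω ^ 2 ∂μ)
          + h ^ 2 * (∑ j ∈ Finset.Icc 1 r,
            (∫ ω, ‖y j ω - y' j ω‖ ^ 2 ∂μ + ∫ ω, ‖z j ω - z' j ω‖ ^ 2 ∂μ))
          + h * ∫ ω, ‖z₀ ω - zc ω‖ ^ 2 ∂μ) := by
  set J := Finset.Icc 1 r with hJ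
  have hch : 0 < c₀ / h := div_pos hc₀ hh
  have hfy : ∀ j ∈ J, MemLp (fun ω => f (y j ω) (z j ω)) 2 μ := fun j hj =>
    memLp_comp_of_lipschitz hf (hy j hj) (hz j hj)
  have hfy' : ∀ j ∈ J, MemLp (fun ω => f (y' j ω) (z' j ω)) 2 μ := fun j hj =>
    memLp_comp_of_lipschitz hf (hy' j hj) (hz' j hj)
  have hzc : MemLp zc 2 μ := (memLp_congr_ae hc).2 (memLp_condExp_weightedSum hm hch hHY hHf hy hfy)
  have hzh : MemLp zh 2 μ :=
    (memLp_congr_ae hh').2 (memLp_condExp_weightedSum hm hch hHY hHf hy' hfy')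
  have hU : ∀ j ∈ J, MemLp (y j - y' j) 2 μ := fun j hj => (hy j hj).sub (hy' j hj)
  have hF : ∀ j ∈ J, MemLp ((fun j ω => f (y j ω) (z j ω)) j - (fun j ω => f (y' j ω) (z' j ω)) j)
      2 μ := fun j hj => (hfy j hj).sub (hfy' j hj)
  have e1 := condExp_sub (integrable_weightedSum (h := h) (α := α) (β := β) hHY hHf hy hfy)
    (integrable_weightedSum (h := h) (α := α) (β := β) hHY hHf hy' hfy') m
  rw [weightedSum_sub] at e1
  have hb := integral_condExp_weightedSum_sq_le (h := h) (α := α) (β := β) hm hch hHY hHf hU hF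
  have hcard : J.card = r := by simp [hJ]
  rw [hcard] at hb
  have e2 : ∫ ω, ‖zc ω - zh ω‖ ^ 2 ∂μ = ∫ ω, ‖(μ[weightedSum J h α β HY Hf (fun j => y j - y' j)
      (fun j => (fun j ω => f (y j ω) (z j ω)) j - (fun j ω => f (y' j ω) (z' j ω)) j) | m]) ω‖ ^ 2
        ∂μ := by
    refine integral_congr_ae ?_
    filter_upwards [e1, hc, hh'] with ω h1 h2 h3
    rw [h1, Pi.sub_apply, ← h2, ← h3]
  rw [← e2] at hb
  have e3 : ∫ ω, ‖z₀ ω - zh ω‖ ^ 2 ∂μ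
      ≤ 2 * ∫ ω, ‖z₀ ω - zc ω‖ ^ 2 ∂μ + 2 * ∫ ω, ‖zc ω - zh ω‖ ^ 2 ∂μ := by
    refine le_trans (le_of_eq (integral_congr_ae (ae_of_all _ fun ω => ?_)))
      (integral_norm_add_sq_le (hz₀.sub hzc) (hzc.sub hzh))
    simp
  have e4 : ∑ j ∈ J, α j ^ 2 *
      (∫ ω, (y j - y' j) ω ^ 2 ∂μ - ∫ ω, (μ[y j - y' j | m]) ω ^ 2 ∂μ)
      ≤ Ka * ∑ j ∈ J, a j *
        (∫ ω, ‖y j ω - y' j ω‖ ^ 2 ∂μ - ∫ ω, (μ[y j - y' j | m]) ω ^ 2 ∂μ) := by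
    rw [Finset.mul_sum]
    refine Finset.sum_le_sum fun j hj => ?_
    have h0 := integral_condExp_sq_le hm (hU j hj)
    simp only [Real.norm_eq_abs, sq_abs, Pi.sub_apply] at h0 ⊢
    rw [← mul_assoc]
    exact mul_le_mul_of_nonneg_right (hα j hj) (sub_nonneg.2 h0)
  have e5 : ∑ j ∈ J, β j ^ 2 *
      ∫ ω, ((fun j ω => f (y j ω) (z j ω)) j - (fun j ω => f (y' j ω) (z' j ω)) j) ω ^ 2 ∂μ
      ≤ Λ ^ 2 * (2 * (L : ℝ) ^ 2 * ∑ j ∈ J,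
        (∫ ω, ‖y j ω - y' j ω‖ ^ 2 ∂μ + ∫ ω, ‖z j ω - z' j ω‖ ^ 2 ∂μ)) := by
    rw [Finset.mul_sum, Finset.mul_sum]
    refine Finset.sum_le_sum fun j hj => ?_
    refine mul_le_mul ?_ (integral_sub_sq_le_of_lipschitz hf (hy j hj) (hz j hj) (hy' j hj)
      (hz' j hj)) (integral_nonneg fun ω => sq_nonneg _) (sq_nonneg _)
    rw [← sq_abs]
    exact pow_le_pow_left₀ (abs_nonneg _) (hβ j hj) 2
  have hv0 : 0 ≤ ∑ j ∈ J, a j *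
      (∫ ω, ‖y j ω - y' j ω‖ ^ 2 ∂μ - ∫ ω, (μ[y j - y' j | m]) ω ^ 2 ∂μ) := by
    refine Finset.sum_nonneg fun j hj => mul_nonneg (ha j hj) (sub_nonneg.2 ?_)
    have h0 := integral_condExp_sq_le hm (hU j hj)
    simpa only [Real.norm_eq_abs, sq_abs, Pi.sub_apply] using h0
  have hS0 : 0 ≤ ∑ j ∈ J,
      (∫ ω, ‖y j ω - y' j ω‖ ^ 2 ∂μ + ∫ ω, ‖z j ω - z' j ω‖ ^ 2 ∂μ) :=
    Finset.sum_nonneg fun j _ => add_nonneg (integral_nonneg fun ω => sq_nonneg _)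
      (integral_nonneg fun ω => sq_nonneg _)
  have hq0 : 0 ≤ ∫ ω, ‖z₀ ω - zc ω‖ ^ 2 ∂μ := integral_nonneg fun ω => sq_nonneg _
  have e6 := add_le_add e4 (mul_le_mul_of_nonneg_left e5 (sq_nonneg h))
  have e7 := hb.trans (mul_le_mul_of_nonneg_left (mul_le_mul_of_nonneg_left e6
    (by positivity : (0 : ℝ) ≤ 2 * r * (c₀ / h))) (Nat.cast_nonneg d))
  generalize ∑ j ∈ J, a j *
      (∫ ω, ‖y j ω - y' j ω‖ ^ 2 ∂μ - ∫ ω, (μ[y j - y' j | m]) ω ^ 2 ∂μ) = v at *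
  generalize ∑ j ∈ J,
    (∫ ω, ‖y j ω - y' j ω‖ ^ 2 ∂μ + ∫ ω, ‖z j ω - z' j ω‖ ^ 2 ∂μ) = A at *
  generalize ∫ ω, ‖z₀ ω - zh ω‖ ^ 2 ∂μ = w₀ at *
  generalize ∫ ω, ‖z₀ ω - zc ω‖ ^ 2 ∂μ = q at *
  generalize ∫ ω, ‖zc ω - zh ω‖ ^ 2 ∂μ = D at *
  have e8 := mul_le_mul_of_nonneg_left e7 hh.le
  have e9 : h * (d * (2 * r * (c₀ / h) * (Ka * v + h ^ 2 * (Λ ^ 2 * (2 * L ^ 2 * A)))))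
      = 2 * d * r * c₀ * Ka * v + 4 * d * r * c₀ * Λ ^ 2 * L ^ 2 * (h ^ 2 * A) := by
    field_simp
    ring
  rw [e9] at e8
  have e10 := mul_le_mul_of_nonneg_left e3 hh.le
  have hA0 : 0 ≤ h ^ 2 * A := by positivity
  have hhq : 0 ≤ h * q := by positivity
  have k1 : 0 ≤ 4 * d * r * c₀ * Ka := by positivity
  have k2 : 0 ≤ 8 * d * r * c₀ * Λ ^ 2 * (L : ℝ) ^ 2 := by positivity
  have t1 := mul_nonneg k1 hA0
  have t2 := mul_nonneg k1 hhq
  have t3 := mul_nonneg k2 hv0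
  have t4 := mul_nonneg k2 hhq
  linarith

end OneStep


/-! ### Partitions. -/

namespace Grid

variable {T : ℝ} (π : Grid T)

lemma n_pos (hT : 0 < T) : 0 < π.n := by
  rcases Nat.eq_zero_or_pos π.n with h | h
  · have h1 := π.right
    rw [h, π.left] at h1
    exact absurd h1 hT.ne
  · exact h

lemma h_pos {i : ℕ} (hi : i < π.n) : 0 < π.h i := sub_pos.2 (π.lt i hi)

lemma t_le {i j : ℕ} (hij : i ≤ j) (hj : j ≤ π.n) : π.t i ≤ π.t j := by
  induction j, hij using Nat.le_induction with
  | base => exact le_rfl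
  | succ j _ ih => exact (ih (by omega)).trans (π.lt j (by omega)).le

lemma t_mem {i : ℕ} (hi : i ≤ π.n) : π.t i ∈ Set.Icc 0 T :=
  ⟨π.left.symm.le.trans (π.t_le (Nat.zero_le i) hi), (π.t_le hi le_rfl).trans π.right.le⟩

lemma h_le_mesh {i : ℕ} (hi : i < π.n) : π.h i ≤ π.mesh :=
  le_ciSup (f := fun i : Fin π.n => π.h i) (Set.finite_range _).bddAbove ⟨i, hi⟩

lemma mesh_pos (hT : 0 < T) : 0 < π.mesh :=
  (π.h_pos (π.n_pos hT)).trans_le (π.h_le_mesh (π.n_pos hT))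

lemma sum_h : ∑ i ∈ Finset.range π.n, π.h i = T := by
  have := Finset.sum_range_sub π.t π.n
  rw [π.left, π.right, sub_zero] at this
  exact this

lemma h_le_sub {i j : ℕ} (hj : 1 ≤ j) (hij : i + j ≤ π.n) : π.h i ≤ π.t (i + j) - π.t i :=
  sub_le_sub_right (π.t_le (by omega) hij) _

end Grid

/-! ### Square integrability of the exact and approximate values at grid points. -/

section Regularity

variable {Ω : Type*} {mΩ : MeasurableSpace Ω} {μ : Measure Ω} {ℱ : Filtration ℝ mΩ} {T : ℝ}
  {d : ℕ}

lemma msd_eq_ofReal {E : Type*} [NormedAddCommGroup E] {U V : Ω → E} (hU : MemLp U 2 μ)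
    (hV : MemLp V 2 μ) : msd μ U V = ENNReal.ofReal (∫ ω, ‖U ω - V ω‖ ^ 2 ∂μ) :=
  lintegral_enorm_sq (hU.sub hV)

lemma memLp_of_msd_lt_top {E : Type*} [NormedAddCommGroup E] {U V : Ω → E}
    (hU : AEStronglyMeasurable U μ) (hV : MemLp V 2 μ) (h : msd μ U V < ∞) : MemLp U 2 μ := by
  have h1 : MemLp (U - V) 2 μ := memLp_two_of_lintegral (hU.sub hV.aestronglyMeasurable) h
  simpa using h1.add hV

lemma memLp_of_lt_top_msd {E : Type*} [NormedAddCommGroup E] {U V : Ω → E}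
    (hU : MemLp U 2 μ) (hV : AEStronglyMeasurable V μ) (h : msd μ U V < ∞) : MemLp V 2 μ := by
  have h1 : MemLp (U - V) 2 μ := memLp_two_of_lintegral (hU.aestronglyMeasurable.sub hV) h
  simpa using hU.sub h1

lemma IsS2.memLp {E : Type*} [NormedAddCommGroup E] {V : ℝ → Ω → E} (hV : IsS2 μ ℱ T V) {t : ℝ}
    (ht : t ∈ Set.Icc 0 T) : MemLp (V t) 2 μ := by
  refine memLp_two_of_lintegral ((hV.adapted t ht).mono (ℱ.le t)).aestronglyMeasurable
    (lt_of_le_of_lt (lintegral_mono fun ω => ?_) hV.sup_sq)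
  exact le_iSup₂ (f := fun t (_ : t ∈ Set.Icc 0 T) => ‖V t ω‖ₑ ^ 2) t ht

lemma IsH2.stronglyMeasurable {E : Type*} [NormedAddCommGroup E] {V : ℝ → Ω → E}
    (hV : IsH2 μ ℱ T V) {t : ℝ} (ht : t ∈ Set.Icc 0 T) : StronglyMeasurable[ℱ t] (V t) := by
  have h := hV.progressive.stronglyAdapted t
  simpa only [Set.indicator_of_mem ht] using h

/-- The interval of the weight with index j has length at least h_i, so a single bound of order
1/h_i serves all j. -/
lemma IsWeightFamily.isCenteredWeight [IsProbabilityMeasure μ] {W : ℝ → Ω → Vec d}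
    (hW : IsBrownianMotion μ ℱ T W) {r : ℕ} {ψ : Fin d → ℝ → ℝ} {π : Grid T}
    {H : ℕ → ℕ → Ω → Vec d} (hH : IsWeightFamily μ ℱ W r ψ π H) {K : ℝ} (hK : 0 ≤ K)
    (hψ : ∀ l, ∀ u ∈ Set.Icc (0 : ℝ) 1, |ψ l u| ≤ K) {i : ℕ} (hr : 1 ≤ r) (hi : i + r ≤ π.n) :
    ∀ j ∈ Finset.Icc 1 r, ∀ l,
      IsCenteredWeight μ (ℱ (π.t i)) (4 * K ^ 2 / π.h i) (fun ω => H i j ω l) := by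
  intro j hj l
  obtain ⟨hj1, hjr⟩ := Finset.mem_Icc.1 hj
  have hh := π.h_pos (show i < π.n by omega)
  have hle := π.h_le_sub hj1 (show i + j ≤ π.n by omega)
  refine ((hH i j hi hj1 hjr).isCenteredWeight hW (π.t_mem (by omega)).1 (hh.trans_le hle)
    ?_ hK hψ l).mono ?_
  · linarith [(π.t_mem (show i + j ≤ π.n by omega)).2]
  · exact div_le_div_of_nonneg_left (by positivity) hh hle

lemma exists_bound_of_moment {ψ : Fin d → ℝ → ℝ} (hψ : ∀ l, IsMomentFunction 0 (ψ l)) :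
    ∃ K : ℝ, 0 ≤ K ∧ ∀ l, ∀ u ∈ Set.Icc (0 : ℝ) 1, |ψ l u| ≤ K := by
  choose K hK using fun l => (hψ l).bdd
  refine ⟨∑ l, |K l|, Finset.sum_nonneg fun l _ => abs_nonneg _, fun l u hu => ?_⟩
  exact (hK l u hu).trans ((le_abs_self _).trans
    (Finset.single_le_sum (f := fun l => |K l|) (fun l _ => abs_nonneg _) (Finset.mem_univ l)))

variable [IsProbabilityMeasure μ] {f : ℝ → Vec d → ℝ} {L : NNReal} {r : ℕ} {a α : ℕ → ℝ}
  {b β : ℕ → ℕ → ℝ} {π : Grid T} {HY Hf : ℕ → ℕ → Ω → Vec d} {c₀ : ℝ}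

lemma memLp_stepZ (hf : LipschitzWith L (fun p : ℝ × Vec d => f p.1 p.2)) (hc₀ : 0 < c₀) {i : ℕ}
    (hh : 0 < π.h i)
    (hHY : ∀ j ∈ Finset.Icc 1 r, ∀ l,
      IsCenteredWeight μ (ℱ (π.t i)) (c₀ / π.h i) (fun ω => HY i j ω l))
    (hHf : ∀ j ∈ Finset.Icc 1 r, ∀ l,
      IsCenteredWeight μ (ℱ (π.t i)) (c₀ / π.h i) (fun ω => Hf i j ω l))
    {y : ℕ → Ω → ℝ} {z : ℕ → Ω → Vec d}
    (hy : ∀ j ∈ Finset.Icc 1 r, MemLp (y (i + j)) 2 μ)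
    (hz : ∀ j ∈ Finset.Icc 1 r, MemLp (z (i + j)) 2 μ) :
    MemLp (stepZ μ ℱ f r α β HY Hf π y z i) 2 μ :=
  memLp_condExp_weightedSum (ℱ.le _) (div_pos hc₀ hh) hHY hHf hy
    fun j hj => memLp_comp_of_lipschitz hf (hy j hj) (hz j hj)

/-- The approximations are square integrable when the implicit step is a contraction. -/
lemma IsApproximation.memLp (hf : LipschitzWith L (fun p : ℝ × Vec d => f p.1 p.2))
    (hc₀ : 0 < c₀) {Yh : ℕ → Ω → ℝ} {Zh : ℕ → Ω → Vec d} (hr : 1 ≤ r)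
    (hA : IsApproximation μ ℱ f r a α b β HY Hf π Yh Zh)
    (hHY : ∀ i, i + r ≤ π.n → ∀ j ∈ Finset.Icc 1 r, ∀ l,
      IsCenteredWeight μ (ℱ (π.t i)) (c₀ / π.h i) (fun ω => HY i j ω l))
    (hHf : ∀ i, i + r ≤ π.n → ∀ j ∈ Finset.Icc 1 r, ∀ l,
      IsCenteredWeight μ (ℱ (π.t i)) (c₀ / π.h i) (fun ω => Hf i j ω l))
    (hb : ∀ i, i + r ≤ π.n → |π.h i * b i 0| * L ≤ 1 / 2) {k : ℕ} (hk : k ≤ π.n) :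
    MemLp (Yh k) 2 μ ∧ MemLp (Zh k) 2 μ := by
  induction hd : π.n - k using Nat.strong_induction_on generalizing k with
  | _ s ih =>
    by_cases hkr : π.n < k + r
    · exact hA.terminal_sq k hk hkr
    · have hi : k + r ≤ π.n := by omega
      have hnext : ∀ j ∈ Finset.Icc 1 r, MemLp (Yh (k + j)) 2 μ ∧ MemLp (Zh (k + j)) 2 μ := by
        intro j hj
        obtain ⟨hj1, hjr⟩ := Finset.mem_Icc.1 hj
        exact ih (π.n - (k + j)) (by omega) (by omega) rfl
      have hZ : MemLp (Zh k) 2 μ := (memLp_congr_ae (hA.eqZ k hi)).2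
        (memLp_stepZ hf hc₀ (π.h_pos (by omega)) (hHY k hi) (hHf k hi)
          (fun j hj => (hnext j hj).1) fun j hj => (hnext j hj).2)
      refine ⟨?_, hZ⟩
      have hZm : AEStronglyMeasurable[ℱ (π.t k)] (Zh k) μ :=
        (stronglyMeasurable_condExp.aestronglyMeasurable).congr (hA.eqZ k hi).symm
      exact memLp_of_implicit (ℱ.le _) hf
        (memLp_explicitPart (a := a) (b := b k) (h := π.h k) hf
          (fun j hj => (hnext j hj).1) fun j hj => (hnext j hj).2) hZm hZ (hb k hi) (hA.eqY k hi)

/-- The exact control process is square integrable at the grid points as soon as the truncation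
and terminal errors are finite. -/
lemma memLp_of_truncation (hf : LipschitzWith L (fun p : ℝ × Vec d => f p.1 p.2))
    (hc₀ : 0 < c₀) {y : ℕ → Ω → ℝ} {z Zc : ℕ → Ω → Vec d} (hr : 1 ≤ r)
    (hHY : ∀ i, i + r ≤ π.n → ∀ j ∈ Finset.Icc 1 r, ∀ l,
      IsCenteredWeight μ (ℱ (π.t i)) (c₀ / π.h i) (fun ω => HY i j ω l))
    (hHf : ∀ i, i + r ≤ π.n → ∀ j ∈ Finset.Icc 1 r, ∀ l,
      IsCenteredWeight μ (ℱ (π.t i)) (c₀ / π.h i) (fun ω => Hf i j ω l))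
    (hy : ∀ k ≤ π.n, MemLp (y k) 2 μ) (hzm : ∀ k ≤ π.n, AEStronglyMeasurable (z k) μ)
    (hterm : ∀ k ≤ π.n, π.n < k + r → MemLp (z k) 2 μ)
    (hZc : ∀ i, i + r ≤ π.n → Zc i = stepZ μ ℱ f r α β HY Hf π y z i)
    (hfin : ∀ i, i + r ≤ π.n → msd μ (z i) (Zc i) < ∞) {k : ℕ} (hk : k ≤ π.n) :
    MemLp (z k) 2 μ := by
  induction hd : π.n - k using Nat.strong_induction_on generalizing k with
  | _ s ih =>
    by_cases hkr : π.n < k + r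
    · exact hterm k hk hkr
    · have hi : k + r ≤ π.n := by omega
      refine memLp_of_msd_lt_top (hzm k hk) ?_ (hfin k hi)
      rw [hZc k hi]
      refine memLp_stepZ hf hc₀ (π.h_pos (by omega)) (hHY k hi) (hHf k hi)
        (fun j hj => ?_) fun j hj => ?_
      · obtain ⟨hj1, hjr⟩ := Finset.mem_Icc.1 hj
        exact hy _ (by omega)
      · obtain ⟨hj1, hjr⟩ := Finset.mem_Icc.1 hj
        exact ih (π.n - (k + j)) (by omega) (by omega) rfl

end Regularity

/-! ### From extended nonnegative errors to real integrals and back. -/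

section Errors

variable {Ω : Type*} {mΩ : MeasurableSpace Ω} {μ : Measure Ω} {T : ℝ} {d r : ℕ} {π : Grid T}
  {Y : ℝ → Ω → ℝ} {Z : ℝ → Ω → Vec d} {Yc : ℕ → Ω → ℝ} {Zc : ℕ → Ω → Vec d} {B : ℝ}

/-- Each summand of a finite sum is finite, and its coefficients are nonzero because the steps are
positive; a zero coefficient would hide an infinite error. -/
lemma msd_lt_top_of_globalTruncation (hr : 1 ≤ r)
    (h : globalTruncation μ r π Y Z Yc Zc ≤ ENNReal.ofReal B) {i : ℕ} (hi : i + r ≤ π.n) :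
    msd μ (Y (π.t i)) (Yc i) < ∞ ∧ msd μ (Z (π.t i)) (Zc i) < ∞ := by
  have hh := π.h_pos (show i < π.n by omega)
  have h1 := (ENNReal.sum_lt_top.1 (h.trans_lt ENNReal.ofReal_lt_top)) i
    (Finset.mem_range.2 (by omega))
  have h2 := ENNReal.lt_top_of_mul_ne_top_right h1.ne (ENNReal.ofReal_pos.2 hh).ne'
  obtain ⟨h3, h4⟩ := ENNReal.add_lt_top.1 h2
  exact ⟨ENNReal.lt_top_of_mul_ne_top_right h3.ne
    (ENNReal.ofReal_pos.2 (one_div_pos.2 (pow_pos hh 2))).ne', h4⟩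

lemma sum_le_of_globalTruncation (hr : 1 ≤ r) (hB : 0 ≤ B)
    (h : globalTruncation μ r π Y Z Yc Zc ≤ ENNReal.ofReal B)
    (hY : ∀ i, i + r ≤ π.n → MemLp (Y (π.t i)) 2 μ) (hZ : ∀ i, i + r ≤ π.n → MemLp (Z (π.t i)) 2 μ)
    (hYc : ∀ i, i + r ≤ π.n → MemLp (Yc i) 2 μ) (hZc : ∀ i, i + r ≤ π.n → MemLp (Zc i) 2 μ) :
    ∑ i ∈ Finset.range (π.n + 1 - r), π.h i *
      ((∫ ω, ‖Y (π.t i) ω - Yc i ω‖ ^ 2 ∂μ) / π.h i ^ 2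
        + ∫ ω, ‖Z (π.t i) ω - Zc i ω‖ ^ 2 ∂μ) ≤ B := by
  rw [← ENNReal.ofReal_le_ofReal_iff hB]
  refine le_trans (le_of_eq ?_) h
  rw [globalTruncation, ENNReal.ofReal_sum_of_nonneg]
  · refine Finset.sum_congr rfl fun i hi => ?_
    have hi : i + r ≤ π.n := by have := Finset.mem_range.1 hi; omega
    have hh := π.h_pos (show i < π.n by omega)
    have n1 : 0 ≤ ∫ ω, ‖Y (π.t i) ω - Yc i ω‖ ^ 2 ∂μ := integral_nonneg fun ω => sq_nonneg _
    have n2 : 0 ≤ ∫ ω, ‖Z (π.t i) ω - Zc i ω‖ ^ 2 ∂μ := integral_nonneg fun ω => sq_nonneg _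
    rw [msd_eq_ofReal (hY i hi) (hYc i hi), msd_eq_ofReal (hZ i hi) (hZc i hi),
      ← ENNReal.ofReal_mul (by positivity), ← ENNReal.ofReal_add (by positivity) n2,
      ← ENNReal.ofReal_mul hh.le]
    congr 3
    ring
  · intro i hi
    have hi : i + r ≤ π.n := by have := Finset.mem_range.1 hi; omega
    have hh := π.h_pos (show i < π.n by omega)
    have n1 : 0 ≤ ∫ ω, ‖Y (π.t i) ω - Yc i ω‖ ^ 2 ∂μ := integral_nonneg fun ω => sq_nonneg _
    have n2 : 0 ≤ ∫ ω, ‖Z (π.t i) ω - Zc i ω‖ ^ 2 ∂μ := integral_nonneg fun ω => sq_nonneg _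
    positivity

lemma error_le_of_integrals {Yh : ℕ → Ω → ℝ} {Zh : ℕ → Ω → Vec d} (hB : 0 ≤ B)
    (hY : ∀ i ≤ π.n, MemLp (Y (π.t i)) 2 μ) (hZ : ∀ i ≤ π.n, MemLp (Z (π.t i)) 2 μ)
    (hYh : ∀ i ≤ π.n, MemLp (Yh i) 2 μ) (hZh : ∀ i ≤ π.n, MemLp (Zh i) 2 μ)
    (h1 : ∀ i ≤ π.n, ∫ ω, ‖Y (π.t i) ω - Yh i ω‖ ^ 2 ∂μ ≤ B)
    (h2 : ∑ i ∈ Finset.range π.n, π.h i * ∫ ω, ‖Z (π.t i) ω - Zh i ω‖ ^ 2 ∂μ ≤ B) :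
    errorY μ π Y Yh + errorZ μ π Z Zh ≤ ENNReal.ofReal (2 * B) := by
  rw [two_mul, ENNReal.ofReal_add hB hB]
  refine add_le_add (Finset.sup_le fun i hi => ?_) (le_trans (le_of_eq ?_)
    (ENNReal.ofReal_le_ofReal h2))
  · have hi : i ≤ π.n := by have := Finset.mem_range.1 hi; omega
    rw [msd_eq_ofReal (hY i hi) (hYh i hi)]
    exact ENNReal.ofReal_le_ofReal (h1 i hi)
  · rw [errorZ, ENNReal.ofReal_sum_of_nonneg]
    · refine Finset.sum_congr rfl fun i hi => ?_
      have hi := Finset.mem_range.1 hi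
      rw [msd_eq_ofReal (hZ i hi.le) (hZh i hi.le), ENNReal.ofReal_mul (π.h_pos hi).le]
    · intro i hi
      exact mul_nonneg (π.h_pos (Finset.mem_range.1 hi)).le (integral_nonneg fun ω => sq_nonneg _)

lemma sum_range_succ_eq_add_sum_Icc (g : ℕ → ℝ) (r : ℕ) :
    ∑ j ∈ Finset.range (r + 1), g j = g 0 + ∑ j ∈ Finset.Icc 1 r, g j := by
  rw [Finset.range_eq_Ico, Finset.sum_eq_sum_Ico_succ_bot (Nat.succ_pos r)]
  rfl

end Errors


/-! ### Stability on one grid, and the theorem. -/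

set_option maxHeartbeats 800000 in
/-- Stability on one grid: if the truncation and terminal errors are at most `B`, then so are the
global errors, up to a constant that depends only on the fixed data. -/
theorem exists_grid_error_bound {Ω : Type*} {mΩ : MeasurableSpace Ω} (μ : Measure Ω)
    [IsProbabilityMeasure μ] (ℱ : Filtration ℝ mΩ) {T : ℝ} (hT : 0 < T) {d : ℕ}
    {f : ℝ → Vec d → ℝ} {L : NNReal} (hf : LipschitzWith L (fun p : ℝ × Vec d => f p.1 p.2))
    {Y : ℝ → Ω → ℝ} {Z : ℝ → Ω → Vec d} (hY : ∀ t ∈ Set.Icc 0 T, MemLp (Y t) 2 μ)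
    (hZ : ∀ t ∈ Set.Icc 0 T, AEStronglyMeasurable (Z t) μ)
    {r : ℕ} (hr : 1 ≤ r) {a α : ℕ → ℝ} (hHc : Hc r a α) {c₀ : ℝ} (hc₀ : 0 < c₀) (Λ κ : ℝ) :
    ∃ C δ : ℝ, 0 < C ∧ 0 < δ ∧ ∀ (π : Grid T) (b β : ℕ → ℕ → ℝ) (HY Hf : ℕ → ℕ → Ω → Vec d)
      (Yc Yh : ℕ → Ω → ℝ) (Zc Zh : ℕ → Ω → Vec d) (B : ℝ), 0 ≤ B →
      π.StepRatioLE κ → π.mesh ≤ δ →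
      (∀ i j, i + r ≤ π.n → 1 ≤ j → j ≤ r → |b i j| ≤ Λ ∧ |β i j| ≤ Λ) →
      (∀ i, i + r ≤ π.n → |b i 0| ≤ Λ) →
      (∀ i, i + r ≤ π.n → ∀ j ∈ Finset.Icc 1 r, ∀ l,
        IsCenteredWeight μ (ℱ (π.t i)) (c₀ / π.h i) (fun ω => HY i j ω l)) →
      (∀ i, i + r ≤ π.n → ∀ j ∈ Finset.Icc 1 r, ∀ l,
        IsCenteredWeight μ (ℱ (π.t i)) (c₀ / π.h i) (fun ω => Hf i j ω l)) →
      (∀ i, i + r ≤ π.n → Zc i = stepZ μ ℱ f r α β HY Hf π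
        (fun k => Y (π.t k)) (fun k => Z (π.t k)) i) →
      (∀ i, i + r ≤ π.n → Yc i =ᵐ[μ] stepY μ ℱ f r a b π
        (fun k => Y (π.t k)) (fun k => Z (π.t k)) i (Yc i) (Zc i)) →
      globalTruncation μ r π Y Z Yc Zc ≤ ENNReal.ofReal B →
      IsApproximation μ ℱ f r a α b β HY Hf π Yh Zh →
      (∀ k, k ≤ π.n → π.n < k + r → msd μ (Y (π.t k)) (Yh k)
        + ENNReal.ofReal π.mesh * msd μ (Z (π.t k)) (Zh k) ≤ ENNReal.ofReal B) →
      errorY μ π Y Yh + errorZ μ π Z Zh ≤ ENNReal.ofReal (C * B) := by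
  -- Nothing forces Λ to be nonnegative, and the constants are fixed before any grid is given.
  set Λ' : ℝ := max Λ 0 with hΛ'
  have hΛ0 : 0 ≤ Λ' := le_max_right _ _
  -- Terms with a_j = 0 are 0 by the convention for division, and there α_j = 0 as well; hence the
  -- domination of α_j² by Ka a_j for every j.
  set Ka : ℝ := ∑ j ∈ Finset.Icc 1 r, α j ^ 2 / a j with hKa
  have ha0 : ∀ j ∈ Finset.Icc 1 r, 0 ≤ a j := fun j hj =>
    hHc.nonneg j (Finset.mem_Icc.1 hj).1 (Finset.mem_Icc.1 hj).2
  have hKa0 : 0 ≤ Ka := Finset.sum_nonneg fun j hj => div_nonneg (sq_nonneg _) (ha0 j hj)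
  have hα : ∀ j ∈ Finset.Icc 1 r, α j ^ 2 ≤ Ka * a j := by
    intro j hj
    rcases (ha0 j hj).eq_or_lt with h0 | h0
    · rw [hHc.support j (Finset.mem_Icc.1 hj).1 (Finset.mem_Icc.1 hj).2 h0.symm, ← h0]
      simp
    · rw [← div_le_iff₀ h0]
      exact Finset.single_le_sum (f := fun j => α j ^ 2 / a j)
        (fun j hj => div_nonneg (sq_nonneg _) (ha0 j hj)) hj
  set KY : ℝ := 4 * r * Λ' ^ 2 * L ^ 2 + 16 * Λ' ^ 2 * L ^ 2 + 4 with hKY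
  set KZ : ℝ := 4 * d * r * c₀ * Ka + 8 * d * r * c₀ * Λ' ^ 2 * L ^ 2 + 2 with hKZ
  have hKY1 : 1 ≤ KY := by
    have : 0 ≤ 4 * r * Λ' ^ 2 * (L : ℝ) ^ 2 + 16 * Λ' ^ 2 * (L : ℝ) ^ 2 := by positivity
    linarith
  have hKZ0 : 0 ≤ KZ := by positivity
  obtain ⟨C, δ, hC, hδ, hrec⟩ := exists_recursion_bound r hr (max κ 1) (KY + KZ) T
    (le_max_right _ _) (by linarith)
  -- The factor 2 adds the two errors; r + 1 covers grids too short for a single step. The last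
  -- threshold makes the implicit step a contraction with constant 1/2.
  refine ⟨2 * (C + r + 1), min δ (min 1 (1 / (2 * (Λ' + 1) * (L + 1)))), by positivity,
    by positivity, ?_⟩
  intro π b β HY Hf Yc Yh Zc Zh B hB hratio hmesh hb hb0 hHY hHf hZc hYc htrunc happ hterm
  have hmesh0 := π.mesh_pos hT
  have hmeshδ : π.mesh ≤ δ := hmesh.trans (min_le_left _ _)
  have hmesh1 : π.mesh ≤ 1 := hmesh.trans ((min_le_right _ _).trans (min_le_left _ _))
  have hmesh2 : π.mesh * (2 * (Λ' + 1) * (L + 1)) ≤ 1 := by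
    have := hmesh.trans ((min_le_right _ _).trans (min_le_right _ _))
    rwa [le_div_iff₀ (by positivity)] at this
  have hsmall : ∀ i, i + r ≤ π.n → |π.h i * b i 0| * L ≤ 1 / 2 := by
    intro i hi
    have hh := π.h_pos (show i < π.n by omega)
    have h1 : |π.h i * b i 0| ≤ π.mesh * (Λ' + 1) := by
      rw [abs_mul, abs_of_pos hh]
      refine mul_le_mul (π.h_le_mesh (by omega)) ?_ (abs_nonneg _) hmesh0.le
      linarith [hb0 i hi, le_max_left Λ 0]
    have h2 := mul_le_mul h1 (by linarith : (L : ℝ) ≤ L + 1) L.coe_nonneg (by positivity)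
    linarith
  have hYL : ∀ k ≤ π.n, MemLp (Y (π.t k)) 2 μ := fun k hk => hY _ (π.t_mem hk)
  have hZm : ∀ k ≤ π.n, AEStronglyMeasurable (Z (π.t k)) μ := fun k hk => hZ _ (π.t_mem hk)
  have hhL : ∀ k ≤ π.n, MemLp (Yh k) 2 μ ∧ MemLp (Zh k) 2 μ := fun k hk =>
    happ.memLp hf hc₀ hr hHY hHf hsmall hk
  have htfin : ∀ k ≤ π.n, π.n < k + r → msd μ (Z (π.t k)) (Zh k) < ∞ := fun k hk hkr =>
    ENNReal.lt_top_of_mul_ne_top_right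
      ((le_add_self.trans (hterm k hk hkr)).trans_lt ENNReal.ofReal_lt_top).ne
      (ENNReal.ofReal_pos.2 hmesh0).ne'
  have hfin := fun i (hi : i + r ≤ π.n) => msd_lt_top_of_globalTruncation hr htrunc hi
  -- Membership in ℋ² says nothing about Z at a fixed time. At terminal indices square integrability
  -- is inherited from the approximation, and it then propagates backward through finite truncation
  -- errors.
  have hZL : ∀ k ≤ π.n, MemLp (Z (π.t k)) 2 μ := fun k hk =>
    memLp_of_truncation hf hc₀ hr hHY hHf hYL hZm
      (fun k hk hkr => memLp_of_msd_lt_top (hZm k hk) (hhL k hk).2 (htfin k hk hkr)) hZc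
      (fun i hi => (hfin i hi).2) hk
  have hZcm : ∀ i, i + r ≤ π.n → AEStronglyMeasurable[ℱ (π.t i)] (Zc i) μ := by
    intro i hi
    rw [hZc i hi]
    exact stronglyMeasurable_condExp.aestronglyMeasurable
  have hZcL : ∀ i, i + r ≤ π.n → MemLp (Zc i) 2 μ := fun i hi =>
    memLp_of_lt_top_msd (hZL i (by omega)) ((hZcm i hi).mono (ℱ.le _)) (hfin i hi).2
  have hYcL : ∀ i, i + r ≤ π.n → MemLp (Yc i) 2 μ := fun i hi =>
    memLp_of_lt_top_msd (hYL i (by omega))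
      (((stronglyMeasurable_condExp.mono (ℱ.le _)).aestronglyMeasurable).congr (hYc i hi).symm)
      (hfin i hi).1
  set e : ℕ → ℝ := fun i => ∫ ω, ‖Y (π.t i) ω - Yh i ω‖ ^ 2 ∂μ with he
  set w : ℕ → ℝ := fun i => ∫ ω, ‖Z (π.t i) ω - Zh i ω‖ ^ 2 ∂μ with hw
  set p : ℕ → ℝ := fun i => ∫ ω, ‖Y (π.t i) ω - Yc i ω‖ ^ 2 ∂μ with hp
  set q : ℕ → ℝ := fun i => ∫ ω, ‖Z (π.t i) ω - Zc i ω‖ ^ 2 ∂μ with hq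
  have he0 : ∀ i, 0 ≤ e i := fun i => integral_nonneg fun ω => sq_nonneg _
  have hw0 : ∀ i, 0 ≤ w i := fun i => integral_nonneg fun ω => sq_nonneg _
  have hp0 : ∀ i, 0 ≤ p i := fun i => integral_nonneg fun ω => sq_nonneg _
  have hq0 : ∀ i, 0 ≤ q i := fun i => integral_nonneg fun ω => sq_nonneg _
  have htermR : ∀ k, k ≤ π.n → π.n < k + r → e k ≤ B ∧ π.mesh * w k ≤ B := by
    intro k hk hkr
    have h1 := hterm k hk hkr
    rw [msd_eq_ofReal (hYL k hk) (hhL k hk).1, msd_eq_ofReal (hZL k hk) (hhL k hk).2,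
      ← ENNReal.ofReal_mul hmesh0.le, ← ENNReal.ofReal_add (he0 k)
        (mul_nonneg hmesh0.le (hw0 k)), ENNReal.ofReal_le_ofReal_iff hB] at h1
    exact ⟨(le_add_of_nonneg_right (mul_nonneg hmesh0.le (hw0 k))).trans h1,
      (le_add_of_nonneg_left (he0 k)).trans h1⟩
  have main : (∀ i ≤ π.n, e i ≤ (C + r + 1) * B) ∧
      ∑ i ∈ Finset.range π.n, π.h i * w i ≤ (C + r + 1) * B := by
    have hCB : 0 ≤ C * B := by positivity
    have hrB : 0 ≤ r * B := by positivity
    have hexp : (C + r + 1) * B = C * B + r * B + B := by ring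
    rw [hexp]
    -- Here every index is terminal, and the natural subtraction n + 1 - r would truncate to 0, so
    -- the recursion does not apply.
    by_cases hrn : π.n + 1 < r
    · refine ⟨fun i hi => by linarith [(htermR i hi (by omega)).1], ?_⟩
      have h1 : ∑ i ∈ Finset.range π.n, π.h i * w i ≤ ∑ i ∈ Finset.range π.n, B :=
        Finset.sum_le_sum fun i hi => by
          have hi := Finset.mem_range.1 hi
          exact (mul_le_mul_of_nonneg_right (π.h_le_mesh hi) (hw0 i)).trans
            (htermR i hi.le (by omega)).2
      have h2 : ∑ i ∈ Finset.range π.n, B = π.n * B := by simp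
      have h3 : (π.n : ℝ) * B ≤ r * B :=
        mul_le_mul_of_nonneg_right (by exact_mod_cast (by omega)) hB
      linarith
    · have hN : (π.n + 1 - r) + r = π.n + 1 := by omega
      -- The a-weighted expected conditional variances of the Y-errors, which couple the two
      -- recursions.
      set v : ℕ → ℝ := fun i => ∑ j ∈ Finset.Icc 1 r, a j * (e (i + j)
        - ∫ ω, (μ[Y (π.t (i + j)) - Yh (i + j) | ℱ (π.t i)]) ω ^ 2 ∂μ) with hv
      have hnext : ∀ i, i + r ≤ π.n → ∀ j ∈ Finset.Icc 1 r, i + j ≤ π.n := by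
        intro i hi j hj
        have := (Finset.mem_Icc.1 hj).2
        omega
      have hbound := hrec π.n (π.n + 1 - r) π.h e w p q v a B π.mesh hN ha0 hHc.sum_a
        (fun i hi => π.h_pos hi) (fun i hi => π.h_le_mesh hi) hmeshδ hmesh0.le π.sum_h.le
        (fun i hi => (hratio i hi).trans (mul_le_mul_of_nonneg_right (le_max_left _ _)
          (π.h_pos hi).le)) he0 hw0 hp0 hq0 ?_ hB htermR
        (sum_le_of_globalTruncation hr hB htrunc (fun i hi => hYL i (by omega))
          (fun i hi => hZL i (by omega)) hYcL hZcL) ?_ ?_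
      · exact ⟨fun i hi => by linarith [hbound.1 i hi], by linarith [hbound.2]⟩
      · intro i hi
        refine Finset.sum_nonneg fun j hj => mul_nonneg (ha0 j hj) (sub_nonneg.2 ?_)
        have hij := hnext i (by omega) j hj
        have h0 := integral_condExp_sq_le (ℱ.le (π.t i)) ((hYL _ hij).sub (hhL _ hij).1)
        simpa only [he, Real.norm_eq_abs, sq_abs, Pi.sub_apply] using h0
      · intro i hi ε hε
        have hi : i + r ≤ π.n := by omega
        have hh := π.h_pos (show i < π.n by omega)
        -- With x proportional to the step, the amplification 1 + ε h_i stays summable, while driver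
        -- terms of size h_i² divided by x are still of order h_i.
        have h1 := Y_step_bound (Λ := Λ') (x := ε * π.h i) (z₀ := Z (π.t i)) (ℱ.le (π.t i)) hf
          ha0 hHc.sum_a (b := b i)
          (fun j hj => (hb i j hi (Finset.mem_Icc.1 hj).1 (Finset.mem_Icc.1 hj).2).1.trans
            (le_max_left _ _)) ((hb0 i hi).trans (le_max_left _ _)) hh
          ((π.h_le_mesh (by omega)).trans hmesh1)
          (fun j hj => hYL _ (hnext i hi j hj)) (fun j hj => hZL _ (hnext i hi j hj))
          (fun j hj => (hhL _ (hnext i hi j hj)).1) (fun j hj => (hhL _ (hnext i hi j hj)).2)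
          (hYL i (by omega)) (hYcL i hi) (hhL i (by omega)).1
          (hZL i (by omega)) (hZcL i hi) (hhL i (by omega)).2 (hZcm i hi)
          ((stronglyMeasurable_condExp.aestronglyMeasurable).congr (happ.eqZ i hi).symm)
          (hYc i hi) (happ.eqY i hi) (mul_pos hε hh)
        have hsplit : ∑ j ∈ Finset.Icc 1 r, a j * e (i + j) - v i
            = ∑ j ∈ Finset.Icc 1 r, a j *
              ∫ ω, (μ[Y (π.t (i + j)) - Yh (i + j) | ℱ (π.t i)]) ω ^ 2 ∂μ := by
          simp only [hv, mul_sub, Finset.sum_sub_distrib]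
          ring
        rw [Finset.sum_add_distrib, ← hKY] at h1
        change e i ≤ (1 + ε * π.h i) * (∑ j ∈ Finset.Icc 1 r, a j *
            ∫ ω, (μ[Y (π.t (i + j)) - Yh (i + j) | ℱ (π.t i)]) ω ^ 2 ∂μ)
          + (1 + 1 / (ε * π.h i)) * (KY * (π.h i ^ 2 * (∑ j ∈ Finset.Icc 1 r, e (i + j)
            + ∑ j ∈ Finset.Icc 1 r, w (i + j) + (e i + w i)) + π.h i ^ 2 * q i + p i)) at h1
        rw [← hsplit] at h1
        rw [sum_range_succ_eq_add_sum_Icc, sum_range_succ_eq_add_sum_Icc]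
        simp only [add_zero]
        have hS1 : 0 ≤ ∑ j ∈ Finset.Icc 1 r, e (i + j) := Finset.sum_nonneg fun j _ => he0 _
        have hS2 : 0 ≤ ∑ j ∈ Finset.Icc 1 r, w (i + j) := Finset.sum_nonneg fun j _ => hw0 _
        have n1 := he0 i
        have n2 := hw0 i
        have n3 := hq0 i
        have n4 := hp0 i
        have hε' : 0 ≤ 1 + 1 / (ε * π.h i) := by positivity
        generalize 1 + 1 / (ε * π.h i) = x at h1 hε' ⊢
        generalize (1 + ε * π.h i) * (∑ j ∈ Finset.Icc 1 r, a j * e (i + j) - v i) = D at h1 ⊢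
        generalize ∑ j ∈ Finset.Icc 1 r, e (i + j) = E₁ at h1 hS1 ⊢
        generalize ∑ j ∈ Finset.Icc 1 r, w (i + j) = W₁ at h1 hS2 ⊢
        have hin : 0 ≤ π.h i ^ 2 * (E₁ + W₁ + (e i + w i)) + π.h i ^ 2 * q i + p i := by positivity
        have hx := mul_le_mul_of_nonneg_left (mul_le_mul_of_nonneg_right
          (le_add_of_nonneg_right hKZ0 : KY ≤ KY + KZ) hin) hε'
        refine (h1.trans (add_le_add_right hx D)).trans (le_of_eq ?_)
        ring
      · intro i hi
        have hi : i + r ≤ π.n := by omega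
        have hh := π.h_pos (show i < π.n by omega)
        have h1 := Z_step_bound (Λ := Λ') (z₀ := Z (π.t i)) (ℱ.le (π.t i)) hf hc₀ hKa0
          ha0 hα (β := β i)
          (fun j hj => (hb i j hi (Finset.mem_Icc.1 hj).1 (Finset.mem_Icc.1 hj).2).2.trans
            (le_max_left _ _)) hh (hHY i hi) (hHf i hi)
          (fun j hj => hYL _ (hnext i hi j hj)) (fun j hj => hZL _ (hnext i hi j hj))
          (fun j hj => (hhL _ (hnext i hi j hj)).1) (fun j hj => (hhL _ (hnext i hi j hj)).2)
          (hZL i (by omega)) (hZc i hi).eventuallyEq (happ.eqZ i hi)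
        have hv0 : 0 ≤ v i := by
          refine Finset.sum_nonneg fun j hj => mul_nonneg (ha0 j hj) (sub_nonneg.2 ?_)
          have hij := hnext i hi j hj
          have h0 := integral_condExp_sq_le (ℱ.le (π.t i)) ((hYL _ hij).sub (hhL _ hij).1)
          simpa only [he, Real.norm_eq_abs, sq_abs, Pi.sub_apply] using h0
        rw [Finset.sum_add_distrib, ← hKZ] at h1
        change π.h i * w i ≤ KZ * (v i + π.h i ^ 2 * (∑ j ∈ Finset.Icc 1 r, e (i + j)
          + ∑ j ∈ Finset.Icc 1 r, w (i + j)) + π.h i * q i) at h1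
        rw [sum_range_succ_eq_add_sum_Icc, sum_range_succ_eq_add_sum_Icc]
        simp only [add_zero]
        have hS1 : 0 ≤ ∑ j ∈ Finset.Icc 1 r, e (i + j) := Finset.sum_nonneg fun j _ => he0 _
        have hS2 : 0 ≤ ∑ j ∈ Finset.Icc 1 r, w (i + j) := Finset.sum_nonneg fun j _ => hw0 _
        have n1 : 0 ≤ π.h i ^ 2 * e i := mul_nonneg (sq_nonneg _) (he0 i)
        have n2 : 0 ≤ π.h i ^ 2 * w i := mul_nonneg (sq_nonneg _) (hw0 i)
        have n3 : 0 ≤ π.h i * q i := mul_nonneg hh.le (hq0 i)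
        refine h1.trans (mul_le_mul (by linarith) ?_ (by positivity) (by linarith))
        linarith
  have hfinal := error_le_of_integrals (B := (C + r + 1) * B) (by positivity) hYL hZL
    (fun i hi => (hhL i hi).1) (fun i hi => (hhL i hi).2) main.1 main.2
  rwa [← mul_assoc] at hfinal

end BSDEMultistep

open BSDEMultistep in
theorem theorem2p1
    {Ω : Type*} {mΩ : MeasurableSpace Ω} (μ : Measure Ω) [IsProbabilityMeasure μ]
    (ℱ : Filtration ℝ mΩ) (T : ℝ) (hT : 0 < T)
    (d : ℕ) (W : ℝ → Ω → Vec d) (hW : IsBrownianMotion μ ℱ T W)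
    -- the forward-backward equation and its solution
    (c : Coefficients d) (X₀ : Vec d)
    (X : ℝ → Ω → Vec d) (Y : ℝ → Ω → ℝ) (Z : ℝ → Ω → Vec d)
    (hXYZ : IsSolution μ ℱ T W c X₀ X Y Z)
    -- the fixed data of the scheme
    (r : ℕ) (hr : 1 ≤ r) (a α : ℕ → ℝ) (hpre : PreConsistent r a α) (hHc : Hc r a α)
    (ψ φ : Fin d → ℝ → ℝ)
    (hψ : ∀ l, IsMomentFunction 0 (ψ l)) (hφ : ∀ l, IsMomentFunction 0 (φ l))
    (HY Hf : Grid T → ℕ → ℕ → Ω → Vec d)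
    (hHY : ∀ π : Grid T, IsWeightFamily μ ℱ W r ψ π (HY π))
    (hHf : ∀ π : Grid T, IsWeightFamily μ ℱ W r φ π (Hf π))
    -- the order and the constants of the assumptions
    (m : ℕ) (Λ κ δ₁ C₁ C₂ : ℝ) (hδ₁ : 0 < δ₁) :
    ∃ C δ : ℝ, 0 < C ∧ 0 < δ ∧
      ∀ (S : StepCoefficients T r Λ a α) (Yh : Grid T → ℕ → Ω → ℝ)
        (Zh : Grid T → ℕ → Ω → Vec d),
        HasTruncationOrder μ ℱ c.f Y Z S HY Hf m κ δ₁ C₁ →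
        (∀ π : Grid T, π.StepRatioLE κ → π.mesh ≤ δ₁ →
          IsApproximation μ ℱ c.f r a α (S.b π) (S.β π) (HY π) (Hf π) π (Yh π) (Zh π) ∧
          TerminalAccuracy μ r π Y Z (Yh π) (Zh π) m C₂) →
        ∀ π : Grid T, π.StepRatioLE κ → π.mesh ≤ δ →
          errorY μ π Y (Yh π) + errorZ μ π Z (Zh π)
            ≤ ENNReal.ofReal (C * π.mesh ^ (2 * m)) := by
  obtain ⟨K₁, hK₁, hψK⟩ := exists_bound_of_moment hψ
  obtain ⟨K₂, hK₂, hφK⟩ := exists_bound_of_moment hφ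
  obtain ⟨L, hL⟩ := c.f_lip
  -- One bound for both families of weight functions; the added 1 keeps the variance constant
  -- positive.
  have hK0 : 0 ≤ K₁ + K₂ + 1 := by positivity
  obtain ⟨C, δ, hC, hδ, hmain⟩ := exists_grid_error_bound μ ℱ hT hL
    (fun t ht => hXYZ.Y_mem.memLp ht)
    (fun t ht => ((hXYZ.Z_mem.stronglyMeasurable ht).mono (ℱ.le t)).aestronglyMeasurable)
    hr hHc (c₀ := 4 * (K₁ + K₂ + 1) ^ 2) (by positivity) Λ κ
  -- A single B has to dominate both the truncation and the terminal bounds and be nonnegative,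
  -- whatever the signs of C₁ and C₂.
  refine ⟨C * (|C₁| + |C₂| + 1), min δ δ₁, by positivity, lt_min hδ hδ₁, ?_⟩
  intro S Yh Zh htrunc happ π hratio hmesh
  obtain ⟨Yc, Zc, hZc, hYc, hglob⟩ := htrunc π hratio (hmesh.trans (min_le_right _ _))
  obtain ⟨hA, hterm⟩ := happ π hratio (hmesh.trans (min_le_right _ _))
  have hm0 : 0 ≤ π.mesh ^ (2 * m) := pow_nonneg (π.mesh_pos hT).le _
  have hC₁ : C₁ ≤ |C₁| + |C₂| + 1 := by linarith [le_abs_self C₁, abs_nonneg C₂]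
  have hC₂ : C₂ ≤ |C₁| + |C₂| + 1 := by linarith [le_abs_self C₂, abs_nonneg C₁]
  rw [mul_assoc]
  refine hmain π (S.b π) (S.β π) (HY π) (Hf π) Yc (Yh π) Zc (Zh π)
    ((|C₁| + |C₂| + 1) * π.mesh ^ (2 * m)) (by positivity) hratio (hmesh.trans (min_le_left _ _))
    (fun i j hi hj hjr => ?_) (S.bound_zero π)
    (fun i hi => (hHY π).isCenteredWeight hW hK0
      (fun l u hu => (hψK l u hu).trans (by linarith)) hr hi)
    (fun i hi => (hHf π).isCenteredWeight hW hK0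
      (fun l u hu => (hφK l u hu).trans (by linarith)) hr hi) hZc hYc
    (hglob.trans (ENNReal.ofReal_le_ofReal (mul_le_mul_of_nonneg_right hC₁ hm0))) hA
    (fun k hk hkr => (hterm k hk hkr).trans
      (ENNReal.ofReal_le_ofReal (mul_le_mul_of_nonneg_right hC₂ hm0)))
  have h := S.bound π i j hi hj hjr
  have h1 := abs_nonneg (a j)
  have h2 := abs_nonneg (S.b π i j)
  have h3 := abs_nonneg (α j)
  have h4 := abs_nonneg (S.β π i j)
  exact ⟨by linarith, by linarith⟩
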